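/- Conventions. All monoids are commutative with neutral element $1$ and absorbing element $0$; monoid morphisms preserve $0$ and $1$. A blueprint $B=A/\!\!/\mathcal R$ is a monoid $A$ together with an equivalence relation $\mathcal R$ (written $\equiv$) on the semiring $\mathbb N[A]$ of finite formal sums of elements of $A$ that is compatible with addition and multiplication, that relates the element $0\in A$ to the empty sum, and for which $a\equiv b$ with $a,b\in A$ implies $a=b$. A morphism of blueprints is a monoid morphism $f$ such that $\sum a_i\equiv\sum b_j$ implies $\sum f(a_i)\equiv\sum f(b_j)$. The blueprint $\mathbb F_1$ is the monoid $\{0,1\}$ with the smallest such relation. An ideal of $B$ is a subset $I$ with $BI\subset I$ such that $\sum a_i+c\equiv\sum b_j$ with $a_i,b_j\in I$ implies $c\in I$; it is prime if its complement is closed under multiplication and contains $1$. The spectrum $\operatorname{Spec}B$ is the set of prime ideals with the topology generated by the sets $\{\mathfrak p\mid a\notin\mathfrak p\}$ and with the sheaf of blueprints whose sections over $U$ are the families $(s(\mathfrak p)\in B_{\mathfrak p})_{\mathfrak p\in U}$ that are locally of the form $a/h$, where $\sum s_i\equiv\sum t_j$ if and only if $\sum s_i(\mathfrak p)\equiv\sum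 t_j(\mathfrak p)$ in the localization $B_{\mathfrak p}$ for all $\mathfrak p\in U$. A blue scheme is a topological space with a sheaf of blueprints that is covered by open subspaces isomorphic to spectra of blueprints; a morphism of blue schemes is a morphism of spaces with sheaves of blueprints that is local, i.e. the induced maps of stalks reflect units. A blue scheme over $B$ is a blue scheme $X$ together with a morphism $X\to\operatorname{Spec}B$. For a blueprint $B=A/\!\!/\mathcal R$ and a monoid $M$, the monoid blueprint $B[M]$ has as underlying monoid the smash product $A\wedge M$, the quotient of $A\times M$ that identifies all pairs with a zero coordinate, and its relation is generated by $\sum(a_i,1)\equiv\sum(b_j,1)$ for all $\sum a_i\equiv\sum b_j$ in $B$. A blue scheme $X$ over $B$ is called monoidal over $B$ if it has an open affine covering $\{U_i\}_{i\in\mathcal I}$ such that 1. for every $i\in\mathcal I$ there are a monoid $M_i$ and an isomorphism $U_i\simeq\operatorname{Spec}B[M_i]$ over $\operatorname{Spec} B$, fixed in what follows; 2. for all $i,j\in\mathcal I$, the intersection $U_i\cap U_j$ is covered by affine opens $V$ that have an isomorphism $V\simeq\operatorname{Spec}B[N]$ for some monoid $N$ (depending on $V$) such that the inclusion $V\to U_i$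 is given by the morphism $B[M_i]\to B[N]$ induced by a monoid morphism $M_i\to N$ that is the localization of $M_i$ at some multiplicative subset of $M_i$, and, for the same isomorphism $V\simeq\operatorname{Spec}B[N]$, the inclusion $V\to U_j$ is given by the morphism $B[M_j]\to B[N]$ induced by a localization $M_j\to N$ of $M_j$ at some multiplicative subset of $M_j$. **Proposition.** Let $B$ be a blueprint and $X$ a blue scheme over $B$. Then $X$ is monoidal over $B$ if and only if there is a monoidal scheme $X_{\mathbb F_1}$ over $\mathbb F_1$ such that $X$ is isomorphic over $B$ to the fibre product $X_{\mathbb F_1}\times_{\operatorname{Spec}\mathbb F_1}\operatorname{Spec}B$ of blue schemes. -/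

import Mathlib

open CategoryTheory TopologicalSpace Opposite

universe u

noncomputable section

/-! ### Blueprints -/

/-- A blueprint `B = A // R`: a commutative monoid `A` with absorbing element `0` together with a
pre-addition `R`, that is, an equivalence relation on the semiring `ℕ[A]` of finite formal sums of
elements of `A` which is additive and multiplicative, for which the element `0` of `A` is equivalent
to the empty sum, and which is proper (equivalent elements of `A` are equal). -/
structure Blueprint where
  carrier : Type u
  [str : CommMonoidWithZero carrier]
  rel : RingCon (MonoidAlgebra ℕ carrier)
  zero_rel : rel (MonoidAlgebra.single 0 1) 0
  proper : ∀ a b : carrier, rel (MonoidAlgebra.single a 1) (MonoidAlgebra.single b 1) → a = b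

namespace Blueprint

instance : CoeSort Blueprint.{u} (Type u) := ⟨Blueprint.carrier⟩

instance (B : Blueprint.{u}) : CommMonoidWithZero B := B.str

/-- The ring homomorphism `ℕ[A] → ℕ[A']`, `∑ aᵢ ↦ ∑ f(aᵢ)`. -/
abbrev mapSum {A A' : Type*} [CommMonoidWithZero A] [CommMonoidWithZero A'] (f : A →*₀ A') :
    MonoidAlgebra ℕ A →+* MonoidAlgebra ℕ A' :=
  MonoidAlgebra.mapDomainRingHom ℕ (f : A →* A')

lemma mapSum_single {A A' : Type*} [CommMonoidWithZero A] [CommMonoidWithZero A'] (f : A →*₀ A')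
    (a : A) (n : ℕ) :
    mapSum f (MonoidAlgebra.single a n) = MonoidAlgebra.single (f a) n := by
  simp [mapSum]

lemma mapSum_id {A : Type*} [CommMonoidWithZero A] (x : MonoidAlgebra ℕ A) :
    mapSum (MonoidWithZeroHom.id A) x = x := by
  change MonoidAlgebra.mapDomainRingHom ℕ (MonoidHom.id A) x = x
  rw [MonoidAlgebra.mapDomainRingHom_id]; rfl

lemma mapSum_comp {A A' A'' : Type*} [CommMonoidWithZero A] [CommMonoidWithZero A']
    [CommMonoidWithZero A''] (g : A' →*₀ A'') (f : A →*₀ A') (x : MonoidAlgebra ℕ A) :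
    mapSum (g.comp f) x = mapSum g (mapSum f x) := by
  change MonoidAlgebra.mapDomainRingHom ℕ ((g : A' →* A'').comp (f : A →* A')) x = _
  rw [MonoidAlgebra.mapDomainRingHom_comp]; rfl

/-- A morphism of blueprints: a multiplicative map preserving `0` and `1` such that
`∑ aᵢ ≡ ∑ bⱼ` implies `∑ f(aᵢ) ≡ ∑ f(bⱼ)`. -/
@[ext]
structure Hom (B C : Blueprint.{u}) where
  hom : B →*₀ C
  map_rel : ∀ x y : MonoidAlgebra ℕ B, B.rel x y → C.rel (mapSum hom x) (mapSum hom y)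

instance : Category Blueprint.{u} where
  Hom := Hom
  id B := ⟨MonoidWithZeroHom.id B, fun x y h => by rwa [mapSum_id, mapSum_id]⟩
  comp f g := ⟨g.hom.comp f.hom, fun x y h => by
    rw [mapSum_comp, mapSum_comp]; exact g.map_rel _ _ (f.map_rel _ _ h)⟩

@[ext]
lemma hom_ext {B C : Blueprint.{u}} {f g : B ⟶ C} (h : ∀ b, f.hom b = g.hom b) : f = g :=
  Hom.ext (MonoidWithZeroHom.ext h)

@[simp] lemma id_hom (B : Blueprint.{u}) (b : B) : Hom.hom (𝟙 B) b = b := rfl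

@[simp] lemma comp_hom {B C D : Blueprint.{u}} (f : B ⟶ C) (g : C ⟶ D) (b : B) :
    Hom.hom (f ≫ g) b = g.hom (f.hom b) := rfl

/-- The semiring `B⁺ = ℕ[A] / R`. -/
def Plus (B : Blueprint.{u}) : Type u := B.rel.Quotient

instance (B : Blueprint.{u}) : CommSemiring B.Plus := inferInstanceAs (CommSemiring B.rel.Quotient)

/-- The quotient map `ℕ[A] → B⁺`. -/
def mkPlus (B : Blueprint.{u}) : MonoidAlgebra ℕ B →+* B.Plus := B.rel.mk'

lemma mkPlus_eq_iff (B : Blueprint.{u}) (x y : MonoidAlgebra ℕ B) :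
    B.mkPlus x = B.mkPlus y ↔ B.rel x y := RingCon.eq B.rel

/-- The multiplicative map `B → B⁺`. -/
def toPlus (B : Blueprint.{u}) : B →*₀ B.Plus where
  toFun a := B.mkPlus (MonoidAlgebra.single a 1)
  map_zero' := by rw [← map_zero B.mkPlus, mkPlus_eq_iff]; exact B.zero_rel
  map_one' := map_one B.mkPlus
  map_mul' a b := by rw [← map_mul, MonoidAlgebra.single_mul_single, one_mul]

lemma toPlus_injective (B : Blueprint.{u}) : Function.Injective B.toPlus :=
  fun a b h => B.proper a b ((B.mkPlus_eq_iff _ _).1 h)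

/-- The evaluation `ℕ[A] → R`, `∑ aᵢ ↦ ∑ f(aᵢ)` of formal sums. -/
def evalSum {A R : Type*} [CommMonoidWithZero A] [CommSemiring R] (f : A →*₀ R) :
    MonoidAlgebra ℕ A →+* R :=
  (MonoidAlgebra.lift ℕ R A (f : A →* R)).toRingHom

lemma evalSum_single {A R : Type*} [CommMonoidWithZero A] [CommSemiring R] (f : A →*₀ R) (a : A) :
    evalSum f (MonoidAlgebra.single a 1) = f a := by
  simp [evalSum]

lemma ringHom_comp_evalSum {A R A' R' : Type*} [CommMonoidWithZero A] [CommSemiring R]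
    [CommMonoidWithZero A'] [CommSemiring R'] (f : A →*₀ R) (f' : A' →*₀ R') (g : A →*₀ A')
    (ψ : R →+* R') (h : ∀ a, ψ (f a) = f' (g a)) (x : MonoidAlgebra ℕ A) :
    evalSum f' (mapSum g x) = ψ (evalSum f x) := by
  induction x using MonoidAlgebra.induction_linear with
  | zero => simp
  | add x y hx hy => rw [map_add, map_add, map_add, map_add, hx, hy]
  | single a n =>
    have : (MonoidAlgebra.single a n : MonoidAlgebra ℕ A) = n • MonoidAlgebra.single a 1 := by
      simp
    rw [this, map_nsmul, map_nsmul, map_nsmul, map_nsmul, mapSum_single, evalSum_single,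
      evalSum_single, h]

/-- The blueprint given by a multiplicative submonoid of a semiring: `∑ aᵢ ≡ ∑ bⱼ` if and only if
the two sums agree in the semiring. -/
@[simps carrier rel]
def ofSemiring {A : Type u} {R : Type*} [CommMonoidWithZero A] [CommSemiring R] (f : A →*₀ R)
    (hf : Function.Injective f) : Blueprint.{u} where
  carrier := A
  rel := RingCon.ker (evalSum f)
  zero_rel := by
    rw [RingCon.ker_apply, evalSum_single, map_zero, map_zero]
  proper a b h := by
    rw [RingCon.ker_apply, evalSum_single, evalSum_single] at h
    exact hf h

/-! ### Localizations -/

/-- The image of a multiplicative subset in `B⁺`. -/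
def plusSubmonoid {B : Blueprint.{u}} (S : Submonoid B) : Submonoid B.Plus :=
  S.map (B.toPlus : B →* B.Plus)

/-- The map `S⁻¹A → S⁻¹(B⁺)`, `a / s ↦ a / s`. -/
def locToPlus {B : Blueprint.{u}} (S : Submonoid B) :
    Localization S →*₀ Localization (plusSubmonoid S) :=
  (Localization.monoidOf S).lift₀
    ((algebraMap B.Plus (Localization (plusSubmonoid S))).toMonoidWithZeroHom.comp B.toPlus)
    (fun s => IsLocalization.map_units (Localization (plusSubmonoid S))
      (⟨B.toPlus s, s, s.2, rfl⟩ : plusSubmonoid S))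

lemma locToPlus_mk_mul {B : Blueprint.{u}} (S : Submonoid B) (a : B) (s : S) :
    locToPlus S (Localization.mk a s) *
      algebraMap B.Plus (Localization (plusSubmonoid S)) (B.toPlus s) =
      algebraMap B.Plus (Localization (plusSubmonoid S)) (B.toPlus a) := by
  have h1 : ∀ b : B, locToPlus S (Localization.mk b 1) =
      algebraMap B.Plus (Localization (plusSubmonoid S)) (B.toPlus b) := by
    intro b
    rw [Localization.mk_one_eq_monoidOf_mk]
    exact (Localization.monoidOf S).lift_eq _ b
  have h2 : Localization.mk a s * Localization.mk (s : B) 1 = Localization.mk a 1 := by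
    rw [Localization.mk_mul, Localization.mk_eq_mk_iff, Localization.r_iff_exists]
    exact ⟨1, by simp [mul_comm]⟩
  rw [← h1, ← h1, ← map_mul, h2]

lemma locToPlus_injective {B : Blueprint.{u}} (S : Submonoid B) :
    Function.Injective (locToPlus S) := by
  intro x y
  induction x using Localization.induction_on with | _ x
  induction y using Localization.induction_on with | _ y
  obtain ⟨a, s⟩ := x
  obtain ⟨b, t⟩ := y
  intro h
  have ha := locToPlus_mk_mul S a s
  have hb := locToPlus_mk_mul S b t
  have key : algebraMap B.Plus (Localization (plusSubmonoid S)) (B.toPlus (t * a)) =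
      algebraMap B.Plus (Localization (plusSubmonoid S)) (B.toPlus (s * b)) := by
    rw [map_mul, map_mul, map_mul, map_mul, ← ha, ← hb, h]; ring
  obtain ⟨⟨_, c, hc, rfl⟩, h2⟩ := (IsLocalization.eq_iff_exists (plusSubmonoid S) _).1 key
  rw [Localization.mk_eq_mk_iff, Localization.r_iff_exists]
  refine ⟨⟨c, hc⟩, B.toPlus_injective ?_⟩
  rw [map_mul]; exact h2.trans (map_mul _ _ _).symm

/-- The localization `S⁻¹B` of a blueprint: its underlying monoid is `S⁻¹A`, and
`∑ aᵢ/sᵢ ≡ ∑ bⱼ/tⱼ` if and only if the two sums agree in `S⁻¹(B⁺)`. -/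
def localization (B : Blueprint.{u}) (S : Submonoid B) : Blueprint.{u} :=
  ofSemiring (locToPlus S) (locToPlus_injective S)

/-- The fraction `a / s` in `S⁻¹B`. -/
def frac {B : Blueprint.{u}} (S : Submonoid B) (a : B) (s : S) : B.localization S :=
  Localization.mk a s

section frac
variable {B : Blueprint.{u}} {S : Submonoid B}

lemma frac_surj (x : B.localization S) : ∃ a s, x = frac S a s := by
  refine Localization.induction_on (p := fun x => ∃ a s, x = frac S a s) x ?_
  exact fun x => ⟨x.1, x.2, rfl⟩

lemma frac_mul (a b : B) (s t : S) : frac S a s * frac S b t = frac S (a * b) (s * t) :=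
  Localization.mk_mul a b s t

lemma frac_one : frac S 1 1 = 1 := Localization.mk_one

lemma frac_zero (s : S) : frac S 0 s = 0 := Localization.mk_zero s

lemma frac_eq_iff (a b : B) (s t : S) :
    frac S a s = frac S b t ↔ ∃ c : S, (c : B) * (t * a) = c * (s * b) := by
  change Localization.mk a s = Localization.mk b t ↔ _
  rw [Localization.mk_eq_mk_iff, Localization.r_iff_exists]

end frac

/-- The map `B⁺ → C⁺` induced by a morphism. -/
def plusMap {B C : Blueprint.{u}} (φ : B ⟶ C) : B.Plus →+* C.Plus :=
  RingCon.lift B.rel (C.mkPlus.comp (mapSum φ.hom))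
    (fun {x y} h => (C.mkPlus_eq_iff _ _).2 (φ.map_rel x y h))

lemma plusMap_toPlus {B C : Blueprint.{u}} (φ : B ⟶ C) (b : B) :
    plusMap φ (B.toPlus b) = C.toPlus (φ.hom b) := by
  change C.mkPlus (mapSum φ.hom (MonoidAlgebra.single b 1)) = C.mkPlus _
  rw [mapSum_single]

/-- The map `S⁻¹A → T⁻¹A'` underlying `locMap`. -/
def locMapHom {B C : Blueprint.{u}} (φ : B ⟶ C) (S : Submonoid B) (T : Submonoid C)
    (h : ∀ s ∈ S, φ.hom s ∈ T) : Localization S →*₀ Localization T :=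
  (Localization.monoidOf S).lift₀
    { toFun := fun b => Localization.mk (φ.hom b) 1
      map_zero' := by rw [map_zero, Localization.mk_zero]
      map_one' := by rw [map_one, Localization.mk_one]
      map_mul' := fun a b => by rw [map_mul, Localization.mk_mul, one_mul] }
    (fun s => by
      refine IsUnit.of_mul_eq_one (Localization.mk 1 ⟨φ.hom s, h s s.2⟩) ?_
      change Localization.mk (φ.hom s) 1 * _ = _
      rw [Localization.mk_mul, one_mul, mul_one]
      exact Localization.mk_self (⟨φ.hom s, h s s.2⟩ : T))

lemma locMapHom_mk {B C : Blueprint.{u}} (φ : B ⟶ C) (S : Submonoid B) (T : Submonoid C)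
    (h : ∀ s ∈ S, φ.hom s ∈ T) (a : B) (s : S) :
    locMapHom φ S T h (Localization.mk a s) =
      Localization.mk (φ.hom a) ⟨φ.hom s, h s s.2⟩ := by
  have h1 : ∀ b : B, locMapHom φ S T h (Localization.mk b 1) = Localization.mk (φ.hom b) 1 := by
    intro b
    rw [Localization.mk_one_eq_monoidOf_mk]
    exact (Localization.monoidOf S).lift_eq _ b
  have h2 : locMapHom φ S T h (Localization.mk a s) * Localization.mk (φ.hom s) 1 =
      Localization.mk (φ.hom a) 1 := by
    rw [← h1, ← h1, ← map_mul, Localization.mk_mul]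
    congr 1
    rw [Localization.mk_eq_mk_iff, Localization.r_iff_exists]
    exact ⟨1, by simp [mul_comm]⟩
  calc locMapHom φ S T h (Localization.mk a s)
      = locMapHom φ S T h (Localization.mk a s) *
          (Localization.mk (φ.hom s) 1 * Localization.mk 1 ⟨φ.hom s, h s s.2⟩) := by
        rw [Localization.mk_mul, one_mul, mul_one,
          Localization.mk_self (⟨φ.hom s, h s s.2⟩ : T), mul_one]
    _ = _ := by rw [← mul_assoc, h2, Localization.mk_mul, one_mul, mul_one]

/-- The morphism `S⁻¹B → T⁻¹C`, `a / s ↦ φ(a) / φ(s)`, induced by `φ : B → C` with `φ(S) ⊆ T`. -/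
def locMap {B C : Blueprint.{u}} (φ : B ⟶ C) (S : Submonoid B) (T : Submonoid C)
    (h : ∀ s ∈ S, φ.hom s ∈ T) : B.localization S ⟶ C.localization T where
  hom := locMapHom φ S T h
  map_rel x y hxy := by
    have hle : plusSubmonoid S ≤ (plusSubmonoid T).comap (plusMap φ) := by
      rintro _ ⟨s, hs, rfl⟩
      exact ⟨φ.hom s, h s hs, (plusMap_toPlus φ s).symm⟩
    let ψ : Localization (plusSubmonoid S) →+* Localization (plusSubmonoid T) :=
      IsLocalization.map _ (plusMap φ) hle
    have hψ : ∀ a : Localization S,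
        ψ (locToPlus S a) = locToPlus T (locMapHom φ S T h a) := by
      intro a
      induction a using Localization.induction_on with | _ x
      obtain ⟨a, s⟩ := x
      rw [locMapHom_mk]
      have e1 := congrArg ψ (locToPlus_mk_mul S a s)
      have e2 := locToPlus_mk_mul T (φ.hom a) ⟨φ.hom s, h s s.2⟩
      rw [map_mul, IsLocalization.map_eq, IsLocalization.map_eq, plusMap_toPlus,
        plusMap_toPlus, ← e2] at e1
      exact (IsLocalization.map_units (Localization (plusSubmonoid T))
        (⟨C.toPlus (φ.hom s), φ.hom s, h s s.2, rfl⟩ : plusSubmonoid T)).mul_right_cancel e1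
    change evalSum (locToPlus S) x = evalSum (locToPlus S) y at hxy
    have e := ringHom_comp_evalSum (locToPlus S) (locToPlus T) (locMapHom φ S T h) ψ hψ
    exact (e x).trans ((congrArg ψ hxy).trans (e y).symm)

lemma locMap_frac {B C : Blueprint.{u}} (φ : B ⟶ C) (S : Submonoid B) (T : Submonoid C)
    (h : ∀ s ∈ S, φ.hom s ∈ T) (a : B) (s : S) :
    (locMap φ S T h).hom (frac S a s) = frac T (φ.hom a) ⟨φ.hom s, h s s.2⟩ :=
  locMapHom_mk φ S T h a s

end Blueprint

namespace Blueprint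

/-! ### Prime spectra -/

/-- An ideal of a blueprint: a subset `I` with `B · I ⊆ I` such that `∑ aᵢ + c ≡ ∑ bⱼ` with
all `aᵢ, bⱼ ∈ I` implies `c ∈ I` (in particular `0 ∈ I`, by taking empty sums). -/
structure IsIdeal (B : Blueprint.{u}) (I : Set B) : Prop where
  mul_mem : ∀ a b : B, b ∈ I → a * b ∈ I
  sum_mem : ∀ (x y : MonoidAlgebra ℕ B) (c : B), (∀ a ∈ x.coeff.support, a ∈ I) →
    (∀ b ∈ y.coeff.support, b ∈ I) → B.rel (x + MonoidAlgebra.single c 1) y → c ∈ I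

/-- A prime ideal of a blueprint: an ideal whose complement contains `1` and is closed under
multiplication. -/
@[ext]
structure PrimeIdeal (B : Blueprint.{u}) where
  asSet : Set B
  isIdeal : B.IsIdeal asSet
  one_notMem : (1 : B) ∉ asSet
  mem_or_mem : ∀ a b : B, a * b ∈ asSet → a ∈ asSet ∨ b ∈ asSet

/-- The set `D(a)` of prime ideals not containing `a`. -/
def basicOpenSet {B : Blueprint.{u}} (a : B) : Set B.PrimeIdeal := {p | a ∉ p.asSet}

/-- The topology on the set of prime ideals generated by the sets `D(a)`. -/
instance (B : Blueprint.{u}) : TopologicalSpace B.PrimeIdeal :=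
  TopologicalSpace.generateFrom (Set.range basicOpenSet)

lemma isOpen_basicOpenSet {B : Blueprint.{u}} (a : B) : IsOpen (basicOpenSet a) :=
  TopologicalSpace.isOpen_generateFrom_of_mem ⟨a, rfl⟩

namespace PrimeIdeal

/-- The complement of a prime ideal. -/
def compl {B : Blueprint.{u}} (p : B.PrimeIdeal) : Submonoid B where
  carrier := {a | a ∉ p.asSet}
  one_mem' := p.one_notMem
  mul_mem' := fun {a b} ha hb h => (p.mem_or_mem a b h).elim ha hb

/-- The inverse image of a prime ideal under a morphism. -/
def comap {B C : Blueprint.{u}} (φ : B ⟶ C) (q : C.PrimeIdeal) : B.PrimeIdeal where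
  asSet := {b | φ.hom b ∈ q.asSet}
  isIdeal :=
    { mul_mem := fun a b hb => by
        change φ.hom (a * b) ∈ q.asSet
        rw [map_mul]; exact q.isIdeal.mul_mem _ _ hb
      sum_mem := fun x y c hx hy h => by
        have key : ∀ z : MonoidAlgebra ℕ B,
            (∀ a ∈ z.coeff.support, φ.hom a ∈ q.asSet) →
            ∀ b ∈ (mapSum φ.hom z).coeff.support, b ∈ q.asSet := by
          intro z hz b hb
          classical
          have hb' : b ∈ (Finsupp.mapDomain φ.hom z.coeff).support := hb
          obtain ⟨a, ha, rfl⟩ := Finset.mem_image.1 (Finsupp.mapDomain_support hb')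
          exact hz a ha
        refine q.isIdeal.sum_mem (mapSum φ.hom x) (mapSum φ.hom y) (φ.hom c) (key x hx)
          (key y hy) ?_
        have := φ.map_rel _ _ h
        rwa [map_add, mapSum_single] at this }
  one_notMem h := q.one_notMem (by
    have h' : φ.hom 1 ∈ q.asSet := h
    rwa [map_one] at h')
  mem_or_mem a b h := q.mem_or_mem _ _ (by
    have h' : φ.hom (a * b) ∈ q.asSet := h
    rwa [map_mul] at h')

lemma continuous_comap {B C : Blueprint.{u}} (φ : B ⟶ C) :
    Continuous (comap φ : C.PrimeIdeal → B.PrimeIdeal) := by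
  refine continuous_generateFrom_iff.2 ?_
  rintro _ ⟨a, rfl⟩
  exact isOpen_basicOpenSet (φ.hom a)

end PrimeIdeal

/-- The localization `B_p` at a prime ideal. -/
abbrev stalkAt (B : Blueprint.{u}) (p : B.PrimeIdeal) : Blueprint.{u} := B.localization p.compl

/-! ### The structure sheaf -/

/-- The blueprint with underlying monoid `A` and pre-addition the largest one for which all members
of a jointly injective family of maps `A → Dᵢ` are morphisms. -/
@[simps carrier rel]
def ofFamily {A : Type u} [CommMonoidWithZero A] {ι : Type*} (D : ι → Blueprint.{u})
    (ev : ∀ i, A →*₀ D i) (inj : ∀ a b, (∀ i, ev i a = ev i b) → a = b) : Blueprint.{u} where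
  carrier := A
  rel := ⨅ i, (D i).rel.comap (mapSum (ev i))
  zero_rel := by
    rw [RingCon.coe_iInf, iInf_apply, iInf_apply, iInf_Prop_eq]
    intro i
    rw [RingCon.comap_rel, mapSum_single, map_zero, map_zero]
    exact (D i).zero_rel
  proper a b h := by
    rw [RingCon.coe_iInf, iInf_apply, iInf_apply, iInf_Prop_eq] at h
    refine inj a b fun i => (D i).proper _ _ ?_
    have := h i
    rwa [RingCon.comap_rel, mapSum_single, mapSum_single] at this

lemma ofFamily_rel_iff {A : Type u} [CommMonoidWithZero A] {ι : Type*} (D : ι → Blueprint.{u})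
    (ev : ∀ i, A →*₀ D i) (inj : ∀ a b, (∀ i, ev i a = ev i b) → a = b)
    (x y : MonoidAlgebra ℕ A) :
    (ofFamily D ev inj).rel x y ↔ ∀ i, (D i).rel (mapSum (ev i) x) (mapSum (ev i) y) := by
  change (⨅ i, (D i).rel.comap (mapSum (ev i)) : RingCon _) x y ↔ _
  rw [RingCon.coe_iInf, iInf_apply, iInf_apply, iInf_Prop_eq]
  rfl

/-- The underlying topological space of `Spec B`. -/
def specTop (B : Blueprint.{u}) : TopCat.{u} := TopCat.of B.PrimeIdeal

/-- A family of elements `s(p) ∈ B_p` for `p ∈ U` is locally a fraction if every point of `U` has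
an open neighbourhood `V ⊆ U` and `a, h ∈ B` such that `h ∉ q` and `s(q) = a / h` for all
`q ∈ V`. -/
def IsLocallyFraction {B : Blueprint.{u}} {U : Opens B.specTop}
    (s : ∀ p : U, B.stalkAt p.1) : Prop :=
  ∀ p : U, ∃ (V : Opens B.specTop) (_ : p.1 ∈ V) (hV : V ≤ U) (a h : B),
    ∀ q : V, ∃ hq : h ∈ q.1.compl, s ⟨q.1, hV q.2⟩ = frac q.1.compl a ⟨h, hq⟩

/-- The monoid of sections over `U`: the families `(s(p))`, `p ∈ U`, that are locally fractions. -/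
def sectionsSubmonoid (B : Blueprint.{u}) (U : Opens B.specTop) :
    Submonoid (∀ p : U, B.stalkAt p.1) where
  carrier := {s | IsLocallyFraction s}
  one_mem' p := ⟨U, p.2, le_rfl, 1, 1, fun q => ⟨q.1.compl.one_mem, frac_one.symm⟩⟩
  mul_mem' := by
    intro s t hs ht p
    obtain ⟨V, hp, hV, a, h, e⟩ := hs p
    obtain ⟨V', hp', hV', a', h', e'⟩ := ht p
    refine ⟨V ⊓ V', ⟨hp, hp'⟩, inf_le_left.trans hV, a * a', h * h', fun q => ?_⟩
    obtain ⟨hq, e⟩ := e ⟨q.1, q.2.1⟩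
    obtain ⟨hq', e'⟩ := e' ⟨q.1, q.2.2⟩
    refine ⟨q.1.compl.mul_mem hq hq', ?_⟩
    rw [Pi.mul_apply, e, e', frac_mul]
    rfl

/-- Sections over `U`. -/
def Sections (B : Blueprint.{u}) (U : Opens B.specTop) : Type u := B.sectionsSubmonoid U

lemma zero_mem_sections (B : Blueprint.{u}) (U : Opens B.specTop) :
    (0 : ∀ p : U, B.stalkAt p.1) ∈ B.sectionsSubmonoid U :=
  fun p => ⟨U, p.2, le_rfl, 0, 1, fun q => ⟨q.1.compl.one_mem, (frac_zero _).symm⟩⟩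

instance (B : Blueprint.{u}) (U : Opens B.specTop) : CommMonoid (B.Sections U) :=
  inferInstanceAs (CommMonoid (B.sectionsSubmonoid U))

instance (B : Blueprint.{u}) (U : Opens B.specTop) : CommMonoidWithZero (B.Sections U) where
  zero := ⟨0, B.zero_mem_sections U⟩
  zero_mul s := Subtype.ext (zero_mul s.1)
  mul_zero s := Subtype.ext (mul_zero s.1)

/-- The value `s(p)` of a section. -/
def evalAt (B : Blueprint.{u}) {U : Opens B.specTop} (p : U) :
    B.Sections U →*₀ B.stalkAt p.1 where
  toFun s := s.1 p
  map_zero' := rfl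
  map_one' := rfl
  map_mul' _ _ := rfl

lemma sections_ext (B : Blueprint.{u}) {U : Opens B.specTop} (s t : B.Sections U)
    (h : ∀ p, B.evalAt p s = B.evalAt p t) : s = t :=
  Subtype.ext (funext h)

/-- The blueprint of sections over `U`: `∑ sᵢ ≡ ∑ tⱼ` if and only if `∑ sᵢ(p) ≡ ∑ tⱼ(p)` in `B_p`
for all `p ∈ U`. -/
def sectionsBlueprint (B : Blueprint.{u}) (U : Opens B.specTop) : Blueprint.{u} :=
  ofFamily (fun p : U => B.stalkAt p.1) (fun p => B.evalAt p) B.sections_ext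

lemma sectionsBlueprint_rel_iff (B : Blueprint.{u}) (U : Opens B.specTop)
    (x y : MonoidAlgebra ℕ (B.Sections U)) :
    (B.sectionsBlueprint U).rel x y ↔
      ∀ p : U, (B.stalkAt p.1).rel (mapSum (B.evalAt p) x) (mapSum (B.evalAt p) y) :=
  ofFamily_rel_iff _ _ _ _ _

/-- Evaluation at a point as a morphism of blueprints. -/
def evalHom (B : Blueprint.{u}) {U : Opens B.specTop} (p : U) :
    B.sectionsBlueprint U ⟶ B.stalkAt p.1 where
  hom := B.evalAt p
  map_rel x y h := (B.sectionsBlueprint_rel_iff U x y).1 h p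

/-- The underlying map of `homToSections`. -/
def toSectionsHom (B : Blueprint.{u}) {E : Blueprint.{u}} (U : Opens B.specTop)
    (f : ∀ p : U, E ⟶ B.stalkAt p.1)
    (hf : ∀ e : E, IsLocallyFraction fun p => (f p).hom e) : E →*₀ B.Sections U where
  toFun e := ⟨fun p => (f p).hom e, hf e⟩
  map_zero' := Subtype.ext (funext fun p => map_zero (f p).hom)
  map_one' := Subtype.ext (funext fun p => map_one (f p).hom)
  map_mul' a b := Subtype.ext (funext fun p => map_mul (f p).hom a b)

/-- A family of morphisms `E → B_p`, `p ∈ U`, whose values are locally fractions, defines a morphism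
to the blueprint of sections over `U`. -/
def homToSections (B : Blueprint.{u}) {E : Blueprint.{u}} (U : Opens B.specTop)
    (f : ∀ p : U, E ⟶ B.stalkAt p.1)
    (hf : ∀ e : E, IsLocallyFraction fun p => (f p).hom e) : E ⟶ B.sectionsBlueprint U where
  hom := B.toSectionsHom U f hf
  map_rel x y h := by
    refine (B.sectionsBlueprint_rel_iff U _ _).2 fun p => ?_
    have key : ∀ z : MonoidAlgebra ℕ E, mapSum (f p).hom z =
        mapSum (B.evalAt p) (mapSum (B.toSectionsHom U f hf) z) := by
      intro z
      rw [← mapSum_comp]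
      rfl
    have h' := (f p).map_rel x y h
    rw [key, key] at h'
    exact h'

lemma homToSections_evalHom (B : Blueprint.{u}) {E : Blueprint.{u}} (U : Opens B.specTop)
    (f : ∀ p : U, E ⟶ B.stalkAt p.1)
    (hf : ∀ e : E, IsLocallyFraction fun p => (f p).hom e) (p : U) :
    B.homToSections U f hf ≫ B.evalHom p = f p := rfl

lemma hom_sections_ext (B : Blueprint.{u}) {E : Blueprint.{u}} {U : Opens B.specTop}
    {f g : E ⟶ B.sectionsBlueprint U} (h : ∀ p : U, f ≫ B.evalHom p = g ≫ B.evalHom p) :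
    f = g := by
  refine hom_ext fun e => B.sections_ext _ _ fun p => ?_
  exact congrArg (fun k : E ⟶ B.stalkAt p.1 => k.hom e) (h p)

/-- The structure presheaf of `Spec B`, with the evident restriction maps. -/
def specPresheaf (B : Blueprint.{u}) : TopCat.Presheaf Blueprint.{u} B.specTop where
  obj U := B.sectionsBlueprint U.unop
  map {U V} i := B.homToSections V.unop (fun p => B.evalHom ⟨p.1, i.unop.le p.2⟩) (fun s p => by
    obtain ⟨W, hp, hW, a, h, e⟩ := s.2 ⟨p.1, i.unop.le p.2⟩
    exact ⟨W ⊓ V.unop, ⟨hp, p.2⟩, inf_le_right, a, h, fun q => e ⟨q.1, q.2.1⟩⟩)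

lemma specPresheaf_map_evalHom (B : Blueprint.{u}) {U V : (Opens B.specTop)ᵒᵖ} (i : U ⟶ V)
    (p : V.unop) : B.specPresheaf.map i ≫ B.evalHom p = B.evalHom ⟨p.1, i.unop.le p.2⟩ := rfl

lemma specPresheaf_isSheaf (B : Blueprint.{u}) : B.specPresheaf.IsSheaf := by
  intro E U S hS x hx
  have cov : ∀ p : U, ∃ (V : Opens B.specTop) (i : V ⟶ U), S i ∧ p.1 ∈ V :=
    fun p => hS p.1 p.2
  choose V i hi hp using cov
  have indep : ∀ (p : U) {W : Opens B.specTop} (j : W ⟶ U) (hj : S j) (hpW : p.1 ∈ W),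
      x (i p) (hi p) ≫ B.evalHom ⟨p.1, hp p⟩ = x j hj ≫ B.evalHom ⟨p.1, hpW⟩ := by
    intro p W j hj hpW
    have h := hx (Z := V p ⊓ W) (homOfLE inf_le_left) (homOfLE inf_le_right) (hi p) hj
      (Subsingleton.elim _ _)
    have h' := congrArg
      (fun k : E ⟶ B.sectionsBlueprint (V p ⊓ W) =>
        k ≫ B.evalHom (U := V p ⊓ W) ⟨p.1, (⟨hp p, hpW⟩ : p.1 ∈ V p ⊓ W)⟩) h
    exact h'
  refine ⟨B.homToSections U (fun p => x (i p) (hi p) ≫ B.evalHom ⟨p.1, hp p⟩) ?_, ?_, ?_⟩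
  · intro e p
    obtain ⟨W, hpW, hW, a, h, ha⟩ := ((x (i p) (hi p)).hom e).2 ⟨p.1, hp p⟩
    refine ⟨W, hpW, hW.trans (i p).le, a, h, fun q => ?_⟩
    obtain ⟨hq, hh⟩ := ha q
    refine ⟨hq, Eq.trans ?_ hh⟩
    exact congrArg (fun k : E ⟶ B.stalkAt q.1 => k.hom e)
      (indep ⟨q.1, (i p).le (hW q.2)⟩ (i p) (hi p) (hW q.2))
  · intro W j hj
    refine B.hom_sections_ext fun p => ?_
    exact indep ⟨p.1, j.le p.2⟩ j hj p.2
  · intro y hy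
    refine B.hom_sections_ext fun p => ?_
    have h := hy (i p) (hi p)
    have h' := congrArg
      (fun k : E ⟶ B.sectionsBlueprint (V p) => k ≫ B.evalHom ⟨p.1, hp p⟩) h
    exact h'

end Blueprint

/-! ### Blue schemes -/

/-- A blueprinted space: a topological space together with a sheaf of blueprints. -/
abbrev BlueprintedSpace : Type (u + 1) := AlgebraicGeometry.SheafedSpace Blueprint.{u}

namespace BlueprintedSpace

/-- The restriction of a section to a smaller open subset. -/
abbrev res (X : BlueprintedSpace.{u}) {U V : Opens X} (h : V ≤ U) (s : X.presheaf.obj (op U)) :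
    X.presheaf.obj (op V) :=
  (X.presheaf.map (homOfLE h).op).hom s

/-- The germ at `x ∈ U` of the section `s` over `U` is a unit of the stalk at `x`. -/
def IsUnitAt (X : BlueprintedSpace.{u}) {U : Opens X} (s : X.presheaf.obj (op U)) (x : X) : Prop :=
  ∃ (V : Opens X) (h : V ≤ U), x ∈ V ∧ IsUnit (X.res h s)

/-- The pullback `f♯(s)` of a section along a morphism of blueprinted spaces. -/
abbrev pullbackSection {X Y : BlueprintedSpace.{u}} (f : X ⟶ Y) {U : Opens Y}
    (s : Y.presheaf.obj (op U)) : X.presheaf.obj (op ((Opens.map f.hom.base).obj U)) :=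
  (f.hom.c.app (op U)).hom s

/-- A morphism of blueprinted spaces is local if the induced morphisms of stalks reflect units. -/
def IsLocalHom {X Y : BlueprintedSpace.{u}} (f : X ⟶ Y) : Prop :=
  ∀ (U : Opens Y) (s : Y.presheaf.obj (op U)) (x : X), f.hom.base x ∈ U →
    X.IsUnitAt (pullbackSection f s) x → Y.IsUnitAt s (f.hom.base x)

lemma isLocalHom_id (X : BlueprintedSpace.{u}) : IsLocalHom (𝟙 X) :=
  fun _ _ _ _ h => h

lemma isLocalHom_comp {X Y Z : BlueprintedSpace.{u}} (f : X ⟶ Y) (g : Y ⟶ Z)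
    (hf : IsLocalHom f) (hg : IsLocalHom g) : IsLocalHom (f ≫ g) :=
  fun U s x hx h => hg U s (f.hom.base x) hx
    (hf ((Opens.map g.hom.base).obj U) (pullbackSection g s) x hx h)

end BlueprintedSpace

namespace Blueprint

/-- The spectrum of a blueprint as a blueprinted space. -/
def specSpace (B : Blueprint.{u}) : BlueprintedSpace.{u} where
  carrier := B.specTop
  presheaf := B.specPresheaf
  IsSheaf := B.specPresheaf_isSheaf

/-- The continuous map `Spec C → Spec B` induced by `φ : B → C`. -/
def specTopMap {B C : Blueprint.{u}} (φ : B ⟶ C) : C.specTop ⟶ B.specTop :=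
  TopCat.ofHom ⟨PrimeIdeal.comap φ, PrimeIdeal.continuous_comap φ⟩

/-- The morphism `B_{φ⁻¹(q)} → C_q`. -/
def stalkMapAt {B C : Blueprint.{u}} (φ : B ⟶ C) (q : C.PrimeIdeal) :
    B.stalkAt (q.comap φ) ⟶ C.stalkAt q :=
  locMap φ _ _ (fun _ h => h)

/-- The morphism on sections over `U` which at `q` is given by `B_{φ⁻¹(q)} → C_q`. -/
def specSectionsMap {B C : Blueprint.{u}} (φ : B ⟶ C) (U : Opens B.specTop) :
    B.sectionsBlueprint U ⟶ C.sectionsBlueprint ((Opens.map (specTopMap φ)).obj U) :=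
  C.homToSections _
    (fun q => B.evalHom (U := U) ⟨PrimeIdeal.comap φ q.1, q.2⟩ ≫ stalkMapAt φ q.1)
    (fun s q => by
      obtain ⟨V, hp, hV, a, h, e⟩ := s.2 ⟨PrimeIdeal.comap φ q.1, q.2⟩
      refine ⟨(Opens.map (specTopMap φ)).obj V, hp, fun x hx => hV hx, φ.hom a, φ.hom h,
        fun r => ?_⟩
      obtain ⟨hr, er⟩ := e ⟨PrimeIdeal.comap φ r.1, r.2⟩
      refine ⟨hr, ?_⟩
      refine (congrArg (stalkMapAt φ r.1).hom er).trans ?_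
      exact locMap_frac φ _ _ _ a ⟨h, hr⟩)

/-- The morphism of blueprinted spaces `Spec C → Spec B` induced by `φ : B → C`. -/
def specSpaceMap {B C : Blueprint.{u}} (φ : B ⟶ C) : C.specSpace ⟶ B.specSpace :=
  InducedCategory.homMk
    { base := specTopMap φ
      c :=
        { app := fun U => specSectionsMap φ U.unop
          naturality := fun _ _ _ => rfl } }

lemma isUnit_frac_iff {B : Blueprint.{u}} (p : B.PrimeIdeal) (a : B) (h : p.compl) :
    IsUnit (frac p.compl a h) ↔ a ∈ p.compl := by
  constructor
  · intro hu
    obtain ⟨z, hz⟩ := hu.exists_right_inv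
    obtain ⟨b, t, rfl⟩ := frac_surj z
    rw [frac_mul, ← frac_one, frac_eq_iff] at hz
    obtain ⟨c, hc⟩ := hz
    intro ha
    have : (c : B) * (((1 : p.compl) : B) * (a * b)) ∈ p.asSet := by
      have e : (c : B) * (((1 : p.compl) : B) * (a * b)) = (c * b) * a := by
        rw [OneMemClass.coe_one, one_mul, mul_assoc, mul_comm a b]
      rw [e]
      exact p.isIdeal.mul_mem _ _ ha
    rw [hc] at this
    have h2 : (c : B) * (((h * t : p.compl) : B) * 1) ∈ p.compl := by
      rw [mul_one]
      exact p.compl.mul_mem c.2 (h * t).2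
    exact h2 this
  · intro ha
    refine IsUnit.of_mul_eq_one (frac p.compl h ⟨a, ha⟩) ?_
    rw [frac_mul, ← frac_one, frac_eq_iff]
    exact ⟨1, by simp [mul_comm]⟩

lemma specSpaceMap_isLocalHom {B C : Blueprint.{u}} (φ : B ⟶ C) :
    BlueprintedSpace.IsLocalHom (specSpaceMap φ) := by
  intro U s q hq hu
  let q' : C.PrimeIdeal := q
  let s' : B.Sections U := s
  obtain ⟨W, hW, hqW, hunit⟩ := hu
  obtain ⟨V, hp, hV, a, h, e⟩ := s'.2 ⟨PrimeIdeal.comap φ q', hq⟩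
  have hmem : ∀ r : V, h ∈ r.1.compl := fun r => (e r).1
  have hu2 : IsUnit ((stalkMapAt φ q').hom (s'.1 ⟨PrimeIdeal.comap φ q', hq⟩)) :=
    hunit.map (C.evalAt (U := W) ⟨q', hqW⟩)
  obtain ⟨h0, e0⟩ := e ⟨PrimeIdeal.comap φ q', hp⟩
  have e1 : (stalkMapAt φ q').hom (s'.1 ⟨PrimeIdeal.comap φ q', hq⟩) =
      frac q'.compl (φ.hom a) ⟨φ.hom h, h0⟩ :=
    (congrArg (stalkMapAt φ q').hom e0).trans (locMap_frac φ _ _ _ a ⟨h, h0⟩)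
  rw [e1, isUnit_frac_iff] at hu2
  let V' : Opens B.specTop := V ⊓ ⟨basicOpenSet a, isOpen_basicOpenSet a⟩
  have hV' : V' ≤ U := inf_le_left.trans hV
  refine ⟨V', hV', ⟨hp, hu2⟩, ?_⟩
  let t : B.Sections V' := ⟨fun r => frac r.1.compl h ⟨a, r.2.2⟩,
    fun r => ⟨V', r.2, le_rfl, h, a, fun r => ⟨r.2.2, rfl⟩⟩⟩
  let s'' : B.Sections V' := (B.specPresheaf.map (homOfLE hV').op).hom s'
  have : s'' * t = 1 := by
    refine B.sections_ext _ _ fun r => ?_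
    obtain ⟨h1, e1⟩ := e ⟨r.1, r.2.1⟩
    have e2 : B.evalAt r s'' = frac r.1.compl a ⟨h, h1⟩ := e1
    have e3 : B.evalAt r t = frac r.1.compl h ⟨a, r.2.2⟩ := rfl
    rw [map_mul, e2, e3, map_one, frac_mul, ← frac_one, frac_eq_iff]
    exact ⟨1, by simp [mul_comm]⟩
  exact IsUnit.of_mul_eq_one t this

end Blueprint

/-- A blue scheme: a blueprinted space that is covered by open subspaces isomorphic to spectra of
blueprints. (The stalks are then automatically local blueprints.) -/
structure BlueScheme where
  space : BlueprintedSpace.{u}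
  locallyAffine : ∀ x : space, ∃ (B : Blueprint.{u}) (j : B.specSpace ⟶ space),
    AlgebraicGeometry.SheafedSpace.IsOpenImmersion j ∧ x ∈ Set.range j.hom.base

namespace BlueScheme

/-- A morphism of blue schemes: a local morphism of blueprinted spaces. -/
@[ext]
structure Hom (X Y : BlueScheme.{u}) where
  toSpaceHom : X.space ⟶ Y.space
  isLocalHom : BlueprintedSpace.IsLocalHom toSpaceHom

instance : Category BlueScheme.{u} where
  Hom := Hom
  id X := ⟨𝟙 X.space, BlueprintedSpace.isLocalHom_id _⟩
  comp f g := ⟨f.toSpaceHom ≫ g.toSpaceHom,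
    BlueprintedSpace.isLocalHom_comp _ _ f.isLocalHom g.isLocalHom⟩
  id_comp f := Hom.ext (Category.id_comp f.toSpaceHom)
  comp_id f := Hom.ext (Category.comp_id f.toSpaceHom)
  assoc f g h := Hom.ext (Category.assoc f.toSpaceHom g.toSpaceHom h.toSpaceHom)

/-- The underlying set of points. -/
instance : CoeSort BlueScheme.{u} (Type u) := ⟨fun X => X.space⟩

/-- The spectrum of a blueprint as a blue scheme. -/
def Spec (B : Blueprint.{u}) : BlueScheme.{u} where
  space := B.specSpace
  locallyAffine x := ⟨B, 𝟙 _, inferInstance, x, rfl⟩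

/-- The morphism `Spec C → Spec B` induced by `φ : B → C`. -/
def specMap {B C : Blueprint.{u}} (φ : B ⟶ C) : Spec C ⟶ Spec B :=
  ⟨Blueprint.specSpaceMap φ, Blueprint.specSpaceMap_isLocalHom φ⟩

/-- The image of a morphism of blue schemes, as a set of points. -/
def range {X Y : BlueScheme.{u}} (f : X ⟶ Y) : Set Y := Set.range f.toSpaceHom.hom.base

/-- An open immersion: an isomorphism onto an open subspace of the target. -/
def IsOpenImmersion {X Y : BlueScheme.{u}} (f : X ⟶ Y) : Prop :=
  AlgebraicGeometry.SheafedSpace.IsOpenImmersion f.toSpaceHom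

end BlueScheme

/-! ### Monoid blueprints -/

/-- The congruence on `A × M` generated by `(a, 0) ∼ (b, 0)` and `(0, m) ∼ (0, n)`: it identifies all
pairs that have a zero coordinate, and nothing else. -/
def smashCon (A M : Type*) [CommMonoidWithZero A] [CommMonoidWithZero M] : Con (A × M) where
  r p q := p = q ∨ ((p.1 = 0 ∨ p.2 = 0) ∧ (q.1 = 0 ∨ q.2 = 0))
  iseqv :=
    { refl := fun _ => Or.inl rfl
      symm := by
        rintro p q (h | ⟨h, h'⟩)
        · exact Or.inl h.symm
        · exact Or.inr ⟨h', h⟩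
      trans := by
        rintro p q r (rfl | ⟨h, h'⟩) (rfl | ⟨k, k'⟩)
        · exact Or.inl rfl
        · exact Or.inr ⟨k, k'⟩
        · exact Or.inr ⟨h, h'⟩
        · exact Or.inr ⟨h, k'⟩ }
  mul' := by
    have aux : ∀ p q : A × M, (p.1 = 0 ∨ p.2 = 0) → ((p * q).1 = 0 ∨ (p * q).2 = 0) := by
      rintro p q (h | h)
      · exact Or.inl (by rw [Prod.fst_mul, h, zero_mul])
      · exact Or.inr (by rw [Prod.snd_mul, h, zero_mul])
    rintro p q r s (rfl | ⟨h, h'⟩) (rfl | ⟨k, k'⟩)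
    · exact Or.inl rfl
    · refine Or.inr ⟨?_, ?_⟩
      · rw [mul_comm]; exact aux _ _ k
      · rw [mul_comm]; exact aux _ _ k'
    · exact Or.inr ⟨aux _ _ h, aux _ _ h'⟩
    · exact Or.inr ⟨aux _ _ h, aux _ _ h'⟩

/-- The smash product `A ∧ M` of two monoids with zero. -/
def Smash (A M : Type*) [CommMonoidWithZero A] [CommMonoidWithZero M] : Type _ :=
  (smashCon A M).Quotient

namespace Smash

variable {A M N : Type*} [CommMonoidWithZero A] [CommMonoidWithZero M] [CommMonoidWithZero N]

instance : CommMonoid (Smash A M) := inferInstanceAs (CommMonoid (smashCon A M).Quotient)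

/-- The class `a ∧ m` of `(a, m)`. -/
def mk : A × M →* Smash A M := (smashCon A M).mk'

lemma mk_surjective : Function.Surjective (mk : A × M → Smash A M) := Con.mk'_surjective

lemma mk_eq_iff (p q : A × M) :
    mk p = mk q ↔ p = q ∨ ((p.1 = 0 ∨ p.2 = 0) ∧ (q.1 = 0 ∨ q.2 = 0)) :=
  Con.eq (smashCon A M)

instance : CommMonoidWithZero (Smash A M) where
  zero := mk (0, 0)
  zero_mul x := by
    obtain ⟨x, rfl⟩ := mk_surjective x
    refine (map_mul mk (0, 0) x).symm.trans ?_
    exact (mk_eq_iff _ _).2 (Or.inr ⟨Or.inl (zero_mul _), Or.inl rfl⟩)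
  mul_zero x := by
    obtain ⟨x, rfl⟩ := mk_surjective x
    refine (map_mul mk x (0, 0)).symm.trans ?_
    exact (mk_eq_iff _ _).2 (Or.inr ⟨Or.inl (mul_zero _), Or.inl rfl⟩)

lemma mk_eq_zero_iff (p : A × M) : mk p = (0 : Smash A M) ↔ p.1 = 0 ∨ p.2 = 0 := by
  refine (mk_eq_iff p (0, 0)).trans ⟨?_, fun h => Or.inr ⟨h, Or.inl rfl⟩⟩
  rintro (rfl | h)
  · exact Or.inl rfl
  · exact h.1

/-- The map out of `A ∧ M` given by a multiplicative map on `A × M` that sends all pairs with a zero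
coordinate to `0`. -/
def lift {R : Type*} [CommMonoidWithZero R] (g : A × M →* R)
    (hg : ∀ p, (p.1 = 0 ∨ p.2 = 0) → g p = 0) : Smash A M →*₀ R where
  toFun := (smashCon A M).lift g (by
    rintro p q (rfl | ⟨h, h'⟩)
    · rfl
    · exact (hg p h).trans (hg q h').symm)
  map_zero' := hg (0, 0) (Or.inl rfl)
  map_one' := map_one g
  map_mul' := map_mul ((smashCon A M).lift g _)

lemma lift_mk {R : Type*} [CommMonoidWithZero R] (g : A × M →* R)
    (hg : ∀ p, (p.1 = 0 ∨ p.2 = 0) → g p = 0) (p : A × M) : lift g hg (mk p) = g p := rfl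

variable (A M) in
/-- The map `A → A ∧ M`, `a ↦ a ∧ 1`. -/
def inl : A →*₀ Smash A M where
  toFun a := mk (a, 1)
  map_zero' := (mk_eq_zero_iff _).2 (Or.inl rfl)
  map_one' := map_one mk
  map_mul' a b := by rw [← map_mul, Prod.mk_mul_mk, one_mul]

variable (A) in
/-- The map `A ∧ M → A ∧ N`, `a ∧ m ↦ a ∧ f(m)`. -/
def map (f : M →*₀ N) : Smash A M →*₀ Smash A N :=
  lift (mk.comp ((MonoidHom.id A).prodMap (f : M →* N))) (by
    rintro ⟨a, m⟩ (h | h)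
    · exact (mk_eq_zero_iff _).2 (Or.inl h)
    · refine (mk_eq_zero_iff _).2 (Or.inr ?_)
      change f m = 0
      have h : m = 0 := h
      rw [h, map_zero])

end Smash

namespace Blueprint

/-- The generators `∑ (aᵢ, 1) ≡ ∑ (bⱼ, 1)`, for `∑ aᵢ ≡ ∑ bⱼ` in `B`, of the pre-addition of
`B[M]`. -/
def monoidGen (B : Blueprint.{u}) (M : Type u) [CommMonoidWithZero M]
    (x y : MonoidAlgebra ℕ (Smash B M)) : Prop :=
  ∃ x₀ y₀ : MonoidAlgebra ℕ B, B.rel x₀ y₀ ∧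
    x = mapSum (Smash.inl B M) x₀ ∧ y = mapSum (Smash.inl B M) y₀

section proper

variable (R : Type*) (M : Type*) [CommSemiring R] [CommMonoidWithZero M]

lemma mul_single_zero (x : MonoidAlgebra R M) (c : R) :
    ∃ d : R, x * MonoidAlgebra.single 0 c = MonoidAlgebra.single 0 d := by
  induction x using MonoidAlgebra.induction_linear with
  | zero => exact ⟨0, by simp⟩
  | add x y hx hy =>
    obtain ⟨d, hd⟩ := hx
    obtain ⟨e, he⟩ := hy
    exact ⟨d + e, by rw [add_mul, hd, he, MonoidAlgebra.single_add]⟩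
  | single m r => exact ⟨r * c, by rw [MonoidAlgebra.single_mul_single, mul_zero]⟩

/-- The congruence on `R[M]` identifying `0 ∈ M` with the zero of the algebra. -/
def zeroCon : RingCon (MonoidAlgebra R M) where
  r x y := ∃ a b : R, x + MonoidAlgebra.single 0 a = y + MonoidAlgebra.single 0 b
  iseqv :=
    { refl := fun x => ⟨0, 0, rfl⟩
      symm := fun ⟨a, b, h⟩ => ⟨b, a, h.symm⟩
      trans := by
        rintro x y z ⟨a, b, h⟩ ⟨c, d, k⟩
        refine ⟨a + c, d + b, ?_⟩
        rw [MonoidAlgebra.single_add, MonoidAlgebra.single_add, ← add_assoc, h, ← add_assoc, ← k]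
        abel }
  add' := by
    rintro x y z w ⟨a, b, h⟩ ⟨c, d, k⟩
    refine ⟨a + c, b + d, ?_⟩
    rw [MonoidAlgebra.single_add, MonoidAlgebra.single_add, add_add_add_comm, h, k,
      add_add_add_comm]
  mul' := by
    rintro x y z w ⟨a, b, h⟩ ⟨c, d, k⟩
    have key : ∀ (p q : MonoidAlgebra R M) (s t : R), ∃ e : R,
        (p + MonoidAlgebra.single 0 s) * (q + MonoidAlgebra.single 0 t) =
          p * q + MonoidAlgebra.single 0 e := by
      intro p q s t
      obtain ⟨e1, h1⟩ := mul_single_zero R M p t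
      obtain ⟨e2, h2⟩ := mul_single_zero R M q s
      refine ⟨e1 + (e2 + s * t), ?_⟩
      rw [mul_add, add_mul, add_mul, h1, mul_comm (MonoidAlgebra.single 0 s) q, h2, MonoidAlgebra.single_mul_single,
        zero_mul, MonoidAlgebra.single_add, MonoidAlgebra.single_add]
      abel
    obtain ⟨e, he⟩ := key x z a c
    obtain ⟨e', he'⟩ := key y w b d
    exact ⟨e, e', by rw [← he, ← he', h, k]⟩

end proper

/-- The contracted monoid algebra `B⁺[M] / (0 ∼ 0_M)`. -/
def PlusMonoid (B : Blueprint.{u}) (M : Type u) [CommMonoidWithZero M] : Type u :=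
  (zeroCon B.Plus M).Quotient

instance (B : Blueprint.{u}) (M : Type u) [CommMonoidWithZero M] : CommSemiring (B.PlusMonoid M) :=
  inferInstanceAs (CommSemiring (zeroCon B.Plus M).Quotient)

/-- The quotient map onto the contracted monoid algebra. -/
def mkPlusMonoid (B : Blueprint.{u}) (M : Type u) [CommMonoidWithZero M] :
    MonoidAlgebra B.Plus M →+* B.PlusMonoid M := (zeroCon B.Plus M).mk'

lemma mkPlusMonoid_eq_iff (B : Blueprint.{u}) (M : Type u) [CommMonoidWithZero M]
    (x y : MonoidAlgebra B.Plus M) : B.mkPlusMonoid M x = B.mkPlusMonoid M y ↔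
      ∃ a b, x + MonoidAlgebra.single 0 a = y + MonoidAlgebra.single 0 b :=
  RingCon.eq (zeroCon B.Plus M)

/-- The map `A ∧ M → B⁺[M] / (0 ∼ 0_M)`, `a ∧ m ↦ a · m`. -/
def smashToPlusMonoid (B : Blueprint.{u}) (M : Type u) [CommMonoidWithZero M] :
    Smash B M →*₀ B.PlusMonoid M :=
  Smash.lift
    { toFun := fun p => B.mkPlusMonoid M (MonoidAlgebra.single p.2 (B.toPlus p.1))
      map_one' := by
        rw [Prod.fst_one, map_one]
        exact map_one (B.mkPlusMonoid M)
      map_mul' := fun p q => by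
        rw [← map_mul, MonoidAlgebra.single_mul_single, Prod.fst_mul, Prod.snd_mul, map_mul] }
    (by
      rintro ⟨a, m⟩ (h | h)
      · have h : a = 0 := h
        subst h
        change B.mkPlusMonoid M (MonoidAlgebra.single m (B.toPlus 0)) = 0
        rw [map_zero, MonoidAlgebra.single_zero, map_zero]
      · have h : m = 0 := h
        subst h
        change B.mkPlusMonoid M (MonoidAlgebra.single 0 (B.toPlus a)) = 0
        rw [← map_zero (B.mkPlusMonoid M), mkPlusMonoid_eq_iff]
        exact ⟨0, B.toPlus a, by simp⟩)

lemma smashToPlusMonoid_injective (B : Blueprint.{u}) (M : Type u) [CommMonoidWithZero M] :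
    Function.Injective (B.smashToPlusMonoid M) := by
  have key : ∀ (a b : B) (m n : M), m ≠ 0 → a ≠ 0 →
      B.mkPlusMonoid M (MonoidAlgebra.single m (B.toPlus a)) =
        B.mkPlusMonoid M (MonoidAlgebra.single n (B.toPlus b)) → a = b ∧ m = n := by
    intro a b m n hm ha h
    obtain ⟨c, d, e⟩ := (B.mkPlusMonoid_eq_iff M _ _).1 h
    have e' := congrArg (fun z : MonoidAlgebra B.Plus M => z.coeff m) e
    simp only [MonoidAlgebra.coeff_add, MonoidAlgebra.coeff_single, Finsupp.add_apply,
      Finsupp.single_eq_same, Finsupp.single_eq_of_ne hm, add_zero] at e'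
    by_cases hmn : m = n
    · subst hmn
      rw [Finsupp.single_eq_same] at e'
      exact ⟨B.toPlus_injective e', rfl⟩
    · rw [Finsupp.single_eq_of_ne hmn, ← map_zero B.toPlus] at e'
      exact absurd (B.toPlus_injective e') ha
  intro x y hxy
  obtain ⟨⟨a, m⟩, rfl⟩ := Smash.mk_surjective x
  obtain ⟨⟨b, n⟩, rfl⟩ := Smash.mk_surjective y
  have hxy' : B.mkPlusMonoid M (MonoidAlgebra.single m (B.toPlus a)) =
    B.mkPlusMonoid M (MonoidAlgebra.single n (B.toPlus b)) := hxy
  by_cases h : a = 0 ∨ m = 0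
  · by_cases h' : b = 0 ∨ n = 0
    · exact (Smash.mk_eq_iff _ _).2 (Or.inr ⟨h, h'⟩)
    · rw [not_or] at h'
      obtain ⟨rfl, rfl⟩ := key b a n m h'.2 h'.1 hxy'.symm
      rfl
  · rw [not_or] at h
    obtain ⟨rfl, rfl⟩ := key a b m n h.2 h.1 hxy'
    rfl

lemma evalSum_toPlus (B : Blueprint.{u}) (x : MonoidAlgebra ℕ B) :
    evalSum B.toPlus x = B.mkPlus x := by
  induction x using MonoidAlgebra.induction_linear with
  | zero => rw [map_zero, map_zero]
  | add x y hx hy => rw [map_add, map_add, hx, hy]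
  | single a n =>
    have : (MonoidAlgebra.single a n : MonoidAlgebra ℕ B) = n • MonoidAlgebra.single a 1 := by
      simp
    rw [this, map_nsmul, map_nsmul, evalSum_single]
    rfl

lemma monoidGen_le_ker (B : Blueprint.{u}) (M : Type u) [CommMonoidWithZero M] :
    ringConGen (B.monoidGen M) ≤ RingCon.ker (evalSum (B.smashToPlusMonoid M)) := by
  rw [RingCon.ringConGen_le]
  rintro _ _ ⟨x, y, h, rfl, rfl⟩
  let ψ : B.Plus →+* B.PlusMonoid M :=
    (B.mkPlusMonoid M).comp MonoidAlgebra.singleOneRingHom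
  have hψ : ∀ a, ψ (B.toPlus a) = B.smashToPlusMonoid M (Smash.inl B M a) := fun a => rfl
  have e := ringHom_comp_evalSum B.toPlus (B.smashToPlusMonoid M) (Smash.inl B M) ψ hψ
  rw [RingCon.ker_apply, e, e, evalSum_toPlus, evalSum_toPlus, (B.mkPlus_eq_iff x y).2 h]

/-- The monoid blueprint `B[M]`: its underlying monoid is the smash product `A ∧ M`, and its
pre-addition is generated by the relations `∑ (aᵢ, 1) ≡ ∑ (bⱼ, 1)` with `∑ aᵢ ≡ ∑ bⱼ` in `B`. -/
def monoidBlueprint (B : Blueprint.{u}) (M : Type u) [CommMonoidWithZero M] : Blueprint.{u} where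
  carrier := Smash B M
  rel := ringConGen (B.monoidGen M)
  zero_rel := by
    refine RingCon.le_ringConGen _ _ ⟨MonoidAlgebra.single 0 1, 0, B.zero_rel, ?_, ?_⟩
    · rw [mapSum_single, map_zero]
    · rw [map_zero]
  proper a b h := by
    have h' := B.monoidGen_le_ker M h
    change evalSum (B.smashToPlusMonoid M) _ = evalSum (B.smashToPlusMonoid M) _ at h'
    rw [evalSum_single, evalSum_single] at h'
    exact B.smashToPlusMonoid_injective M h'

/-- The canonical morphism `B → B[M]`, `a ↦ a ∧ 1`. -/
def toMonoidBlueprint (B : Blueprint.{u}) (M : Type u) [CommMonoidWithZero M] :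
    B ⟶ B.monoidBlueprint M where
  hom := Smash.inl B M
  map_rel x y h := RingCon.le_ringConGen _ _ ⟨x, y, h, rfl, rfl⟩

/-- The morphism `B[M] → B[N]`, `a ∧ m ↦ a ∧ f(m)`, induced by a morphism of monoids `f : M → N`. -/
def monoidBlueprintMap (B : Blueprint.{u}) {M N : Type u} [CommMonoidWithZero M]
    [CommMonoidWithZero N] (f : M →*₀ N) : B.monoidBlueprint M ⟶ B.monoidBlueprint N where
  hom := Smash.map B f
  map_rel x y h := by
    have hle : ringConGen (B.monoidGen M) ≤
        (ringConGen (B.monoidGen N)).comap (mapSum (Smash.map B f)) := by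
      rw [RingCon.ringConGen_le]
      rintro _ _ ⟨x, y, h, rfl, rfl⟩
      have e : (Smash.map B f).comp (Smash.inl B M) = Smash.inl B N := by
        ext a
        change Smash.mk (a, f 1) = Smash.mk (a, 1)
        rw [map_one]
      refine RingCon.le_ringConGen _ _ ⟨x, y, h, ?_, ?_⟩
      · rw [← mapSum_comp, e]
      · rw [← mapSum_comp, e]
    exact hle h

/-! ### The initial blueprint `𝔽₁` -/

/-- The generator `0 ≡ (empty sum)` of the smallest pre-addition. -/
def zeroGen (A : Type u) [CommMonoidWithZero A] (x y : MonoidAlgebra ℕ A) : Prop :=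
  x = MonoidAlgebra.single 0 1 ∧ y = 0

/-- The inclusion of the monoid `{0, 1}` into a monoid with zero. -/
def zeroOneHom (A : Type*) [CommMonoidWithZero A] : WithZero PUnit.{u + 1} →*₀ A :=
  WithZero.lift' 1

lemma zeroGen_le {A : Type u} {A' : Type*} [CommMonoidWithZero A] [CommSemiring A']
    (f : MonoidAlgebra ℕ A →+* A') (c : RingCon A') (h : c (f (MonoidAlgebra.single 0 1)) 0) :
    ringConGen (zeroGen A) ≤ c.comap f := by
  rw [RingCon.ringConGen_le]
  rintro _ _ ⟨rfl, rfl⟩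
  rw [RingCon.comap_rel, map_zero]
  exact h

/-- The blueprint `𝔽₁`: the monoid `{0, 1}` with the smallest pre-addition. -/
def fOne : Blueprint.{u} where
  carrier := WithZero PUnit.{u + 1}
  rel := ringConGen (zeroGen _)
  zero_rel := RingCon.le_ringConGen _ _ ⟨rfl, rfl⟩
  proper a b h := by
    have h' := zeroGen_le (evalSum (zeroOneHom.{u} ℕ)) ⊥
      (by rw [evalSum_single, map_zero]; exact RingCon.refl _ _) h
    have h'' : evalSum (zeroOneHom.{u} ℕ) (MonoidAlgebra.single a 1) =
      evalSum (zeroOneHom.{u} ℕ) (MonoidAlgebra.single b 1) := h'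
    rw [evalSum_single, evalSum_single] at h''
    cases a with
    | zero =>
      cases b with
      | zero => rfl
      | coe b => simp [zeroOneHom] at h''
    | coe a =>
      cases b with
      | zero => simp [zeroOneHom] at h''
      | coe b => rfl

/-- The unique morphism `𝔽₁ → B`. -/
def fromFOne (B : Blueprint.{u}) : fOne.{u} ⟶ B where
  hom := zeroOneHom.{u} B
  map_rel x y h := zeroGen_le (mapSum (zeroOneHom.{u} B)) B.rel
    (by rw [mapSum_single, map_zero]; exact B.zero_rel) h

end Blueprint

/-! ### Monoidal schemes -/

open BlueScheme in
/-- A covering of a blue scheme `X` over `B` exhibiting it as a monoidal scheme over `B`.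
The open affine covering `{Uᵢ}` together with the isomorphisms `Uᵢ ≃ Spec B[Mᵢ]` over `B` is given
by open immersions `jᵢ : Spec B[Mᵢ] → X` with images `Uᵢ`. Each point of `Uᵢ ∩ Uₖ` lies in an open
`V` with an isomorphism `V ≃ Spec B[N]`, given by an open immersion `v : Spec B[N] → X` with image
`V`, such that the restrictions `B[Mᵢ] → B[N]` and `B[Mₖ] → B[N]` are induced by
localizations `Mᵢ → N = S⁻¹Mᵢ` and `Mₖ → N = T⁻¹Mₖ` of monoids. -/
structure MonoidalCovering {B : Blueprint.{u}} {X : BlueScheme.{u}} (π : X ⟶ Spec B) where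
  ι : Type u
  M : ι → Type u
  [str : ∀ i, CommMonoidWithZero (M i)]
  chart : ∀ i, Spec (B.monoidBlueprint (M i)) ⟶ X
  isOpenImmersion : ∀ i, IsOpenImmersion (chart i)
  chart_over : ∀ i, chart i ≫ π = specMap (B.toMonoidBlueprint (M i))
  covers : ∀ x : X, ∃ i, x ∈ range (chart i)
  overlap : ∀ (i k : ι) (x : X), x ∈ range (chart i) → x ∈ range (chart k) →
    ∃ (N : Type u) (_ : CommMonoidWithZero N) (v : Spec (B.monoidBlueprint N) ⟶ X)
      (f : M i →*₀ N) (S : Submonoid (M i)) (g : M k →*₀ N) (T : Submonoid (M k)),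
      IsOpenImmersion v ∧ x ∈ range v ∧
      S.IsLocalizationMap f ∧ v = specMap (B.monoidBlueprintMap f) ≫ chart i ∧
      T.IsLocalizationMap g ∧ v = specMap (B.monoidBlueprintMap g) ≫ chart k

/-- A blue scheme `π : X → Spec B` over `B` is monoidal over `B` if it has a covering as above. -/
def BlueScheme.IsMonoidalOver {X : BlueScheme.{u}} (B : Blueprint.{u})
    (π : X ⟶ BlueScheme.Spec B) : Prop :=
  Nonempty (MonoidalCovering π)

end

/-! Everything rests on the shape of `Spec B[M]`. A prime of `B[M]` is the same as a pair consisting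
of a prime of `B` and a prime of `𝔽₁[M]` (`monoidBlueprint_point_ext`,
`exists_monoidBlueprint_point`), and the stalk maps from `Spec 𝔽₁[M]` to `Spec B[M]` are injective
(`stalkMap_baseChange_injective`). Moreover `B[M]` is the pushout of `B` and `𝔽₁[M]` over `𝔽₁`, and
`Spec` turns pushouts into fibre products (`isPullback_spec`), because local morphisms `Spec D →
Spec C` are the same as morphisms from `C` to the global sections of `Spec D` (`spec_hom_ext`,
`exists_spec_hom`).

If `X` is the base change of `X₁`, pasting of cartesian squares shows that a chart `Spec 𝔽₁[Mᵢ]` of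
`X₁` pulls back to a morphism `Spec B[Mᵢ] → X`. Open immersions are stable under base change, and
the overlaps pull back in the same way (`isMonoidalOver_of_isPullback`).

Conversely, let `X` have a monoidal covering. If `Spec B` has no point, then `X` is empty and is its
own model. Otherwise fix a point `q`. The fibre of `X` over `q` is covered by copies `{q} × Spec
𝔽₁[Mᵢ]` of the spaces `Spec 𝔽₁[Mᵢ]`, so it serves as the space of the model, and no cocycle
condition has to be verified. The transition maps come from morphisms of monoids and move only the
second coordinate; hence `(q', p) ↦ (q, p)` is a well-defined retraction of `X` onto the fibre. The
structure sheaf is that of the pushout of `X ← ∐ Spec B[Mᵢ] → ∐ Spec 𝔽₁[Mᵢ]`: a section is a section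
of `X` together with a descent of its restriction to every chart.

The crucial claim is that each `Spec 𝔽₁[Mᵢ]` is an open subspace of the model
(`modelChart_isOpenImmersion`). A section on it yields a section of `X`, which is descended to the
other charts along the overlaps `Spec 𝔽₁[N]` (`exists_transition`); the local descents glue since
each is determined by its pullback to `Spec B[Mₖ]`. After this, `X` is recognised as the base change
of the model chart by chart (`isPullback_modelScheme`). -/

noncomputable section

/-! ### Sections, open immersions and locality for blueprinted spaces -/

namespace BlueprintedSpace

variable {X Y Z : BlueprintedSpace.{u}}

/-- The restriction morphism `𝒪(U) → 𝒪(V)`. -/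
def resHom (X : BlueprintedSpace.{u}) {U V : Opens X} (h : V ≤ U) :
    X.presheaf.obj (op U) ⟶ X.presheaf.obj (op V) :=
  X.presheaf.map (homOfLE h).op

/-- The inverse image of an open subset. -/
def preim (f : X ⟶ Y) (U : Opens Y) : Opens X := (Opens.map f.hom.base).obj U

lemma apply_mem_of_mem_preim (f : X ⟶ Y) {U : Opens Y} :
    ∀ x ∈ preim f U, f.hom.base x ∈ U := fun _ h => h

lemma mem_preim {f : X ⟶ Y} {U : Opens Y} {x : X} : x ∈ preim f U ↔ f.hom.base x ∈ U := Iff.rfl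

lemma le_preimage (f : X ⟶ Y) {U : Opens Y} {V : Opens X} (h : ∀ x ∈ V, f.hom.base x ∈ U) :
    V ≤ (Opens.map f.hom.base).obj U := h

/-- The morphism `𝒪_Y(U) → 𝒪_X(V)` induced by `f : X → Y` for `f(V) ⊆ U`. -/
def appLE (f : X ⟶ Y) (U : Opens Y) (V : Opens X) (h : ∀ x ∈ V, f.hom.base x ∈ U) :
    Y.presheaf.obj (op U) ⟶ X.presheaf.obj (op V) :=
  f.hom.c.app (op U) ≫ X.resHom (le_preimage f h)

lemma resHom_self {U : Opens X} (h : U ≤ U) : X.resHom h = 𝟙 _ :=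
  X.presheaf.map_id _

lemma resHom_resHom {U V W : Opens X} (h : V ≤ U) (h' : W ≤ V) :
    X.resHom h ≫ X.resHom h' = X.resHom (h'.trans h) :=
  (X.presheaf.map_comp _ _).symm

lemma appLE_resHom (f : X ⟶ Y) {U : Opens Y} {V W : Opens X} (h : ∀ x ∈ V, f.hom.base x ∈ U)
    (h' : W ≤ V) : appLE f U V h ≫ X.resHom h' = appLE f U W fun x hx => h x (h' hx) := by
  rw [appLE, Category.assoc, resHom_resHom]; rfl

lemma resHom_appLE (f : X ⟶ Y) {U U' : Opens Y} {V : Opens X} (h : ∀ x ∈ V, f.hom.base x ∈ U')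
    (h' : U' ≤ U) : Y.resHom h' ≫ appLE f U' V h = appLE f U V fun x hx => h' (h x hx) := by
  have := f.hom.c.naturality (homOfLE h').op
  rw [appLE, appLE, resHom, reassoc_of% this]
  congr 1
  exact (X.presheaf.map_comp _ _).symm

lemma appLE_comp (f : X ⟶ Y) (g : Y ⟶ Z) {U : Opens Z} {V : Opens Y} {W : Opens X}
    (h : ∀ x ∈ V, g.hom.base x ∈ U) (h' : ∀ x ∈ W, f.hom.base x ∈ V) :
    appLE g U V h ≫ appLE f V W h' = appLE (f ≫ g) U W fun x hx => h _ (h' x hx) := by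
  rw [appLE, Category.assoc, resHom_appLE]
  rfl

lemma appLE_congr {f g : X ⟶ Y} (e : f = g) {U : Opens Y} {V : Opens X}
    (h : ∀ x ∈ V, f.hom.base x ∈ U) :
    appLE f U V h = appLE g U V (by subst e; exact h) := by
  subst e; rfl

lemma app_eq_appLE (f : X ⟶ Y) (U : Opens Y) :
    f.hom.c.app (op U) = appLE f U ((Opens.map f.hom.base).obj U) fun _ h => h := by
  refine ((congrArg (f.hom.c.app (op U) ≫ ·) (X.resHom_self le_rfl)).trans ?_).symm
  exact Category.comp_id _

/-- Morphisms agree if they agree on points and on sections. -/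
lemma hom_ext' {f g : X ⟶ Y} (h : ∀ x, f.hom.base x = g.hom.base x)
    (h' : ∀ (U : Opens Y) (V : Opens X) (hf : ∀ x ∈ V, f.hom.base x ∈ U)
      (hg : ∀ x ∈ V, g.hom.base x ∈ U), appLE f U V hf = appLE g U V hg) : f = g := by
  obtain ⟨⟨b, c⟩⟩ := f
  obtain ⟨⟨b', c'⟩⟩ := g
  obtain rfl : b = b' := by ext x; exact h x
  have : c = c' := by
    refine NatTrans.ext (funext fun U' => ?_)
    obtain ⟨U, rfl⟩ : ∃ U, op U = U' := ⟨U'.unop, rfl⟩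
    have := h' U ((Opens.map b).obj U) (fun _ h => h) (fun _ h => h)
    rwa [← app_eq_appLE, ← app_eq_appLE] at this
  rw [this]

/-! ### Gluing of sections -/

section glue

variable {E : Blueprint.{u}} {ι : Type u} {U : Opens X} (V : ι → Opens X) (hV : ∀ i, V i ≤ U)
  (cov : ∀ x ∈ U, ∃ i, x ∈ V i)
include cov

/-- The sheaf condition for a presheaf of blueprints says that `Hom(E, 𝒪(-))` is a sheaf of sets for
every `E`, so results on sheaves of sets apply directly. For this reason sections are handled as
morphisms `E ⟶ 𝒪(U)`, which keeps track of the pre-addition as well. -/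
lemma section_hom_ext {f g : E ⟶ X.presheaf.obj (op U)}
    (h : ∀ i, f ≫ X.resHom (hV i) = g ≫ X.resHom (hV i)) : f = g := by
  let F : TopCat.Sheaf (Type u) X :=
    ⟨X.presheaf ⋙ coyoneda.obj (op E), (isSheaf_iff_isSheaf_of_type _ _).2 (X.IsSheaf E)⟩
  refine TopCat.Sheaf.eq_of_locally_eq' F V U (fun i => homOfLE (hV i)) ?_ f g h
  intro x hx
  obtain ⟨i, hi⟩ := cov x hx
  exact Opens.mem_iSup.2 ⟨i, hi⟩

lemma exists_section_hom (m : ∀ i, E ⟶ X.presheaf.obj (op (V i)))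
    (hm : ∀ i k, m i ≫ X.resHom (inf_le_left : V i ⊓ V k ≤ V i) =
      m k ≫ X.resHom (inf_le_right : V i ⊓ V k ≤ V k)) :
    ∃ f : E ⟶ X.presheaf.obj (op U), ∀ i, f ≫ X.resHom (hV i) = m i := by
  let F : TopCat.Sheaf (Type u) X :=
    ⟨X.presheaf ⋙ coyoneda.obj (op E), (isSheaf_iff_isSheaf_of_type _ _).2 (X.IsSheaf E)⟩
  obtain ⟨f, hf, -⟩ := TopCat.Sheaf.existsUnique_gluing' F V U (fun i => homOfLE (hV i)) (by
    intro x hx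
    obtain ⟨i, hi⟩ := cov x hx
    exact Opens.mem_iSup.2 ⟨i, hi⟩) m (fun i k => hm i k)
  exact ⟨f, hf⟩

end glue

/-! ### Open immersions -/

open AlgebraicGeometry

/-- The opens are constrained only by membership conditions, so that the lemma applies to opens that
are not literally an image and a preimage. -/
lemma isIso_appLE (j : X ⟶ Y) [H : SheafedSpace.IsOpenImmersion j] {U : Opens Y} {V : Opens X}
    (hU : ∀ y ∈ U, y ∈ Set.range j.hom.base) (h : ∀ x ∈ V, j.hom.base x ∈ U)
    (hV : ∀ x, j.hom.base x ∈ U → x ∈ V) : IsIso (appLE j U V h) := by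
  obtain rfl : V = (Opens.map j.hom.base).obj U := le_antisymm h hV
  rw [← app_eq_appLE]
  refine PresheafedSpace.IsOpenImmersion.c_iso' j.hom ((Opens.map j.hom.base).obj U) ?_
  ext y
  constructor
  · intro hy
    obtain ⟨x, rfl⟩ := hU y hy
    exact ⟨x, hy, rfl⟩
  · rintro ⟨x, hx, rfl⟩
    exact hx

lemma isOpenImmersion_of_appLE (j : X ⟶ Y) (hj : Topology.IsOpenEmbedding j.hom.base)
    (H : ∀ (U : Opens Y) (V : Opens X) (_ : ∀ y ∈ U, y ∈ Set.range j.hom.base)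
      (h : ∀ x ∈ V, j.hom.base x ∈ U) (_ : ∀ x, j.hom.base x ∈ U → x ∈ V),
      IsIso (appLE j U V h)) : SheafedSpace.IsOpenImmersion j where
  base_open := hj
  c_iso V := by
    rw [app_eq_appLE]
    refine H _ _ ?_ _ fun _ h => h
    rintro _ ⟨x, -, rfl⟩
    exact ⟨x, rfl⟩

/-- The image of an open subset under an open immersion. -/
def image (j : X ⟶ Y) [H : SheafedSpace.IsOpenImmersion j] (V : Opens X) : Opens Y :=
  ⟨j.hom.base '' V, H.base_open.isOpenMap _ V.2⟩

lemma injective (j : X ⟶ Y) [H : SheafedSpace.IsOpenImmersion j] :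
    Function.Injective j.hom.base := H.base_open.injective

lemma isUnitAt_iff_of_le {U V : Opens X} (h : V ≤ U) (s : X.presheaf.obj (op U)) {x : X}
    (hx : x ∈ V) : X.IsUnitAt (X.res h s) x ↔ X.IsUnitAt s x := by
  have key : ∀ {U V W : Opens X} (h : V ≤ U) (h' : W ≤ V) (s : X.presheaf.obj (op U)),
      X.res h' (X.res h s) = X.res (h'.trans h) s := fun h h' s =>
    congrArg (fun k => Blueprint.Hom.hom k s) (X.resHom_resHom h h')
  constructor
  · rintro ⟨W, hW, hxW, hu⟩
    exact ⟨W, hW.trans h, hxW, by rwa [key] at hu⟩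
  · rintro ⟨W, hW, hxW, hu⟩
    refine ⟨W ⊓ V, inf_le_right, ⟨hxW, hx⟩, ?_⟩
    rw [key, ← key hW (inf_le_left : W ⊓ V ≤ W)]
    exact hu.map (X.resHom (inf_le_left : W ⊓ V ≤ W)).hom

lemma isUnitAt_appLE (f : X ⟶ Y) {U : Opens Y} {V : Opens X} (h : ∀ x ∈ V, f.hom.base x ∈ U)
    (s : Y.presheaf.obj (op U)) {x : X} (hx : x ∈ V) (hs : Y.IsUnitAt s (f.hom.base x)) :
    X.IsUnitAt ((appLE f U V h).hom s) x := by
  obtain ⟨W, hW, hxW, hu⟩ := hs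
  refine ⟨V ⊓ (Opens.map f.hom.base).obj W, inf_le_left, ⟨hx, hxW⟩, ?_⟩
  have : X.res _ ((appLE f U V h).hom s) =
      (appLE f W (V ⊓ (Opens.map f.hom.base).obj W) fun _ h => h.2).hom (Y.res hW s) :=
    congrArg (fun k => Blueprint.Hom.hom k s) ((appLE_resHom f h (inf_le_left : V ⊓ (Opens.map f.hom.base).obj W ≤ V)).trans
    (resHom_appLE f (U' := W) (V := V ⊓ (Opens.map f.hom.base).obj W) (fun _ h => h.2) hW).symm)
  rw [this]
  exact hu.map (appLE f W (V ⊓ (Opens.map f.hom.base).obj W) fun _ h => h.2).hom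

lemma isLocalHom_iff (f : X ⟶ Y) : IsLocalHom f ↔
    ∀ (U : Opens Y) (V : Opens X) (h : ∀ x ∈ V, f.hom.base x ∈ U) (s : Y.presheaf.obj (op U)),
      ∀ x ∈ V, X.IsUnitAt ((appLE f U V h).hom s) x → Y.IsUnitAt s (f.hom.base x) := by
  constructor
  · intro H U V h s x hx hu
    refine H U s x (h x hx) ?_
    exact (isUnitAt_iff_of_le (V := V) (U := (Opens.map f.hom.base).obj U) h _ hx).1 hu
  · intro H U s x hx hu
    refine H U ((Opens.map f.hom.base).obj U) (fun _ h => h) s x hx ?_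
    rwa [← app_eq_appLE]

/-- If the pullback of `s` is invertible on `W`, then `s` is invertible on the image of `W`, because
sections over the two correspond isomorphically. -/
lemma isLocalHom_of_isOpenImmersion (j : X ⟶ Y) [H : SheafedSpace.IsOpenImmersion j] :
    IsLocalHom j := by
  rw [isLocalHom_iff]
  rintro U V h s x hx ⟨W, hW, hxW, hu⟩
  have hle : image j W ≤ U := by
    rintro _ ⟨y, hy, rfl⟩
    exact h y (hW hy)
  refine ⟨image j W, hle, ⟨x, hxW, rfl⟩, ?_⟩
  have hi : IsIso (appLE j (image j W) W fun y hy => ⟨y, hy, rfl⟩) := by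
    refine isIso_appLE j ?_ _ ?_
    · rintro _ ⟨y, -, rfl⟩
      exact ⟨y, rfl⟩
    · rintro y ⟨z, hz, e⟩
      exact injective j e ▸ hz
  have hm : ∀ y ∈ W, j.hom.base y ∈ image j W := fun y hy => ⟨y, hy, rfl⟩
  have e : (appLE j (image j W) W hm).hom (Y.res hle s) =
      X.res hW ((appLE j U V h).hom s) := congrArg (fun k => Blueprint.Hom.hom k s)
    ((resHom_appLE j hm hle).trans (appLE_resHom j h hW).symm)
  have hu' : IsUnit ((appLE j (image j W) W fun y hy => ⟨y, hy, rfl⟩).hom (Y.res hle s)) := by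
    rw [e]; exact hu
  have := hu'.map (inv (appLE j (image j W) W fun y hy => ⟨y, hy, rfl⟩)).hom
  rwa [← Blueprint.comp_hom, IsIso.hom_inv_id] at this

/-- A unit at `f(x)` pulls back to a unit at `x`, and the composite reflects units. Thus locality of
`g` at points in the image of `f` follows from that of the composite, and may be tested on a cover.
-/
lemma isLocalHom_of_comp {f : X ⟶ Y} {g : Y ⟶ Z} (h : IsLocalHom (f ≫ g)) (U : Opens Z)
    (s : Z.presheaf.obj (op U)) (x : X) (hx : g.hom.base (f.hom.base x) ∈ U)
    (hs : Y.IsUnitAt (pullbackSection g s) (f.hom.base x)) :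
    Z.IsUnitAt s (g.hom.base (f.hom.base x)) := by
  refine h U s x hx ?_
  have := isUnitAt_appLE f (U := (Opens.map g.hom.base).obj U)
    (V := (Opens.map f.hom.base).obj ((Opens.map g.hom.base).obj U)) (fun _ h => h)
    (pullbackSection g s) hx hs
  rwa [← app_eq_appLE] at this

end BlueprintedSpace

/-! ### Covers by open immersions and lifts along them -/

namespace BlueprintedSpace

open AlgebraicGeometry

variable {X Y Z T : BlueprintedSpace.{u}}

lemma apply_mem_image (j : X ⟶ Y) [SheafedSpace.IsOpenImmersion j] {V : Opens X} :
    ∀ x ∈ V, j.hom.base x ∈ image j V :=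
  fun x hx => ⟨x, hx, rfl⟩

instance isIso_appLE_image (j : X ⟶ Y) [SheafedSpace.IsOpenImmersion j] (V : Opens X) :
    IsIso (appLE j (image j V) V (apply_mem_image j)) := by
  refine isIso_appLE j ?_ _ ?_
  · rintro _ ⟨y, -, rfl⟩
    exact ⟨y, rfl⟩
  · rintro y ⟨z, hz, e⟩
    exact injective j e ▸ hz

lemma image_le (j : X ⟶ Y) [SheafedSpace.IsOpenImmersion j] {U : Opens Y} {V : Opens X}
    (h : ∀ x ∈ V, j.hom.base x ∈ U) : image j V ≤ U := by
  rintro _ ⟨x, hx, rfl⟩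
  exact h x hx

/-- Morphisms into a blueprint of sections agree if they agree locally, on open immersions. -/
lemma section_hom_ext_of_cover {E : Blueprint.{u}} {U : Opens X}
    {f g : E ⟶ X.presheaf.obj (op U)}
    (h : ∀ x ∈ U, ∃ (W : BlueprintedSpace.{u}) (j : W ⟶ X) (_ : SheafedSpace.IsOpenImmersion j)
      (V : Opens W) (hV : ∀ x ∈ V, j.hom.base x ∈ U), x ∈ image j V ∧
        f ≫ appLE j U V hV = g ≫ appLE j U V hV) : f = g := by
  choose W j hj V hV hx e using fun x : U => h x.1 x.2
  refine section_hom_ext (fun x : U => image (j x) (V x)) (fun x => image_le (j x) (hV x))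
    (fun x hxU => ⟨⟨x, hxU⟩, hx ⟨x, hxU⟩⟩) fun x => ?_
  rw [← cancel_mono (appLE (j x) (image (j x) (V x)) (V x) (apply_mem_image (j x))),
    Category.assoc, Category.assoc, resHom_appLE, e]

lemma hom_ext_of_cover {f g : X ⟶ Y}
    (h : ∀ x, ∃ (W : BlueprintedSpace.{u}) (j : W ⟶ X) (_ : SheafedSpace.IsOpenImmersion j),
      x ∈ Set.range j.hom.base ∧ j ≫ f = j ≫ g) : f = g := by
  refine hom_ext' ?_ ?_
  · intro x
    obtain ⟨W, j, hj, ⟨y, rfl⟩, e⟩ := h x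
    exact congrArg (fun k : W ⟶ Y => k.hom.base y) e
  · intro U V hf hg
    refine section_hom_ext_of_cover fun x hx => ?_
    obtain ⟨W, j, hj, ⟨y, rfl⟩, e⟩ := h x
    refine ⟨W, j, hj, preim j V, apply_mem_of_mem_preim j, ⟨y, hx, rfl⟩, ?_⟩
    rw [appLE_comp, appLE_comp]
    exact appLE_congr e _

lemma cancel_openImmersion (j : Y ⟶ Z) [SheafedSpace.IsOpenImmersion j] {f g : X ⟶ Y}
    (h : f ≫ j = g ≫ j) : f = g := by
  refine InducedCategory.hom_ext ?_
  rw [← cancel_mono j.hom]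
  exact congrArg InducedCategory.Hom.hom h

lemma exists_lift (j : Y ⟶ Z) [SheafedSpace.IsOpenImmersion j] (f : X ⟶ Z)
    (h : Set.range f.hom.base ⊆ Set.range j.hom.base) : ∃ g : X ⟶ Y, g ≫ j = f :=
  ⟨InducedCategory.homMk (PresheafedSpace.IsOpenImmersion.lift j.hom f.hom h),
    InducedCategory.hom_ext (PresheafedSpace.IsOpenImmersion.lift_fac j.hom f.hom h)⟩

/-- Since `j` is an isomorphism onto its image, a section `s` on `Y` comes from a section `s'` on
the image, to which locality of the composite applies. -/
lemma isLocalHom_of_comp_openImmersion (j : Y ⟶ Z) [SheafedSpace.IsOpenImmersion j] (f : X ⟶ Y)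
    (h : IsLocalHom (f ≫ j)) : IsLocalHom f := by
  rw [isLocalHom_iff] at h ⊢
  intro U V hV s x hx hu
  let s' := (inv (appLE j (image j U) U (apply_mem_image j))).hom s
  have e : (appLE j (image j U) U (apply_mem_image j)).hom s' = s :=
    congrArg (fun k => Blueprint.Hom.hom k s)
      (IsIso.inv_hom_id (appLE j (image j U) U (apply_mem_image j)))
  have e' : (appLE (f ≫ j) (image j U) V fun x hx => ⟨_, hV x hx, rfl⟩).hom s' =
      (appLE f U V hV).hom s := by
    rw [← e]
    exact congrArg (fun k => Blueprint.Hom.hom k s') (appLE_comp f j (apply_mem_image j) hV).symm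
  have := h (image j U) V (fun x hx => ⟨_, hV x hx, rfl⟩) s' x hx (e' ▸ hu)
  have := isUnitAt_appLE j (apply_mem_image j) s' (hV x hx) this
  rwa [e] at this

/-! ### Gluing of morphisms -/

section glue

variable {ι : Type u} {W : ι → BlueprintedSpace.{u}} (j : ∀ i, W i ⟶ T)
  [∀ i, SheafedSpace.IsOpenImmersion (j i)] (f : ∀ i, W i ⟶ Z)

/-- Compatibility is required only near each pair of points with the same image in `T`, on some `V`
mapping to both pieces. This avoids fibre products of the members of the cover. -/
lemma exists_hom_of_cover (cov : ∀ x, ∃ i, x ∈ Set.range (j i).hom.base)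
    (compat : ∀ (i k : ι) (y : W i) (z : W k), (j i).hom.base y = (j k).hom.base z →
      ∃ (V : BlueprintedSpace.{u}) (a : V ⟶ W i) (b : V ⟶ W k)
        (_ : SheafedSpace.IsOpenImmersion (a ≫ j i)),
        y ∈ Set.range a.hom.base ∧ a ≫ j i = b ≫ j k ∧ a ≫ f i = b ≫ f k) :
    ∃ g : T ⟶ Z, ∀ i, j i ≫ g = f i := by
  have key : ∃ F : T → Z, ∀ i y, F ((j i).hom.base y) = (f i).hom.base y := by
    choose i y hy using cov
    refine ⟨fun x => (f (i x)).hom.base (y x), fun k z => ?_⟩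
    obtain ⟨V, a, b, hV, ⟨v, hv⟩, e, e'⟩ := compat _ _ _ _ (hy ((j k).hom.base z))
    have h1 : (j (i ((j k).hom.base z))).hom.base (a.hom.base v) = (j k).hom.base (b.hom.base v) :=
      congrArg (fun k : V ⟶ T => k.hom.base v) e
    have h2 : (f (i ((j k).hom.base z))).hom.base (a.hom.base v) = (f k).hom.base (b.hom.base v) :=
      congrArg (fun k : V ⟶ Z => k.hom.base v) e'
    rw [hv] at h1 h2
    rw [hy] at h1
    exact h2.trans (by rw [injective (j k) h1])
  obtain ⟨F, hF⟩ := key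
  have hcont : Continuous F := by
    refine continuous_def.2 fun O hO => isOpen_iff_forall_mem_open.2 fun x hx => ?_
    obtain ⟨i, y, rfl⟩ := cov x
    refine ⟨image (j i) ((Opens.map (f i).hom.base).obj ⟨O, hO⟩), ?_, (image _ _).2, y, ?_, rfl⟩
    · rintro _ ⟨z, hz, rfl⟩
      change F _ ∈ O
      rw [hF]
      exact hz
    · change (f i).hom.base y ∈ O
      rw [← hF]
      exact hx
  let φ : T.carrier ⟶ Z.carrier := TopCat.ofHom ⟨F, hcont⟩
  have hφ : ∀ i y, φ ((j i).hom.base y) = (f i).hom.base y := hF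
  let V : ∀ (U : Opens Z) (i : ι), Opens (W i) := fun U i => preim (f i) U
  -- The pullback along `f i` lives on `W i`; it is transported to the image of `j i` by inverting
  -- the isomorphism on sections.
  have exm : ∀ U i, ∃ m : Z.presheaf.obj (op U) ⟶ T.presheaf.obj (op (image (j i) (V U i))),
      m ≫ appLE (j i) _ _ (apply_mem_image (j i)) =
        appLE (f i) U (V U i) (apply_mem_of_mem_preim (f i)) := fun U i =>
    ⟨appLE (f i) U (V U i) (apply_mem_of_mem_preim (f i)) ≫
      inv (appLE (j i) _ _ (apply_mem_image (j i))), by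
      rw [Category.assoc, IsIso.inv_hom_id, Category.comp_id]⟩
  choose m hm using exm
  have hle : ∀ U i, image (j i) (V U i) ≤ (Opens.map φ).obj U := fun U i => by
    rintro _ ⟨y, hy, rfl⟩
    change φ _ ∈ U
    rw [hφ]
    exact hy
  have hcov : ∀ U, ∀ x ∈ (Opens.map φ).obj U, ∃ i, x ∈ image (j i) (V U i) := by
    intro U x hx
    obtain ⟨i, y, rfl⟩ := cov x
    have hx' : φ ((j i).hom.base y) ∈ U := hx
    exact ⟨i, y, by rwa [hφ] at hx', rfl⟩
  have ex : ∀ U, ∃ c : Z.presheaf.obj (op U) ⟶ T.presheaf.obj (op ((Opens.map φ).obj U)),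
      ∀ i, c ≫ T.resHom (hle U i) = m U i := by
    intro U
    -- Agreement of the pieces on the intersection of two images is tested on the open immersions `a
    -- ≫ j i` supplied by `compat`.
    refine exists_section_hom _ (hle U) (hcov U) (m U) fun i k => ?_
    refine section_hom_ext_of_cover ?_
    rintro _ ⟨⟨y, hy, rfl⟩, ⟨z, hz, e⟩⟩
    obtain ⟨S, a, b, hS, ⟨v, rfl⟩, e, e'⟩ := compat i k y z e.symm
    let O : Opens S := preim (a ≫ j i) (image (j i) (V U i) ⊓ image (j k) (V U k))
    have hOi : ∀ s ∈ O, a.hom.base s ∈ V U i := by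
      rintro s ⟨⟨t, ht, e⟩, -⟩
      exact injective (j i) e ▸ ht
    have hOk : ∀ s ∈ O, b.hom.base s ∈ V U k := by
      rintro s ⟨-, ⟨t, ht, h⟩⟩
      have := congrArg (fun k : S ⟶ T => k.hom.base s) e
      exact injective (j k) (h.trans this) ▸ ht
    refine ⟨S, a ≫ j i, hS, O, apply_mem_of_mem_preim _, ⟨v, ⟨⟨_, hy, rfl⟩, ⟨z, hz, ‹_›⟩⟩, rfl⟩, ?_⟩
    rw [Category.assoc, Category.assoc, resHom_appLE, resHom_appLE,
      ← appLE_comp a (j i) (apply_mem_image (j i)) hOi, reassoc_of% (hm U i), appLE_comp,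
      appLE_congr e, ← appLE_comp b (j k) (apply_mem_image (j k)) hOk, reassoc_of% (hm U k),
      appLE_comp]
    exact appLE_congr e' _
  choose c hc using ex
  let g : T ⟶ Z := InducedCategory.homMk
    { base := φ
      c :=
        { app := fun U => c U.unop
          naturality := by
            intro U U' i
            obtain ⟨U, rfl⟩ : ∃ O, op O = U := ⟨U.unop, rfl⟩
            obtain ⟨U', rfl⟩ : ∃ O, op O = U' := ⟨U'.unop, rfl⟩
            have hU : U' ≤ U := i.unop.le
            have hφU : (Opens.map φ).obj U' ≤ (Opens.map φ).obj U := fun x hx => hU hx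
            change Z.resHom hU ≫ c U' = c U ≫ T.resHom hφU
            refine section_hom_ext _ (hle U') (hcov U') fun k => ?_
            rw [← cancel_mono (appLE (j k) _ _ (apply_mem_image (j k)))]
            have hV : V U' k ≤ V U k := fun x hx => hU hx
            have hh : image (j k) (V U' k) ≤ image (j k) (V U k) := Set.image_mono hV
            have e : c U ≫ T.resHom hφU ≫ T.resHom (hle U' k) = m U k ≫ T.resHom hh := by
              rw [resHom_resHom, ← hc U k, Category.assoc, resHom_resHom]
            simp only [Category.assoc]
            rw [reassoc_of% (hc U' k), hm, resHom_appLE, reassoc_of% e, resHom_appLE,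
              ← appLE_resHom (j k) (apply_mem_image (j k)) hV, reassoc_of% (hm U k),
              appLE_resHom] } }
  refine ⟨g, fun i => hom_ext' (hφ i) fun U O h h' => ?_⟩
  have hg : ∀ x ∈ (Opens.map φ).obj U, g.hom.base x ∈ U := fun _ h => h
  have h1 : appLE g U ((Opens.map φ).obj U) hg = c U := (app_eq_appLE g U).symm
  have h2 : ∀ x ∈ O, (j i).hom.base x ∈ (Opens.map φ).obj U := h
  have h3 : ∀ x ∈ V U i, (j i).hom.base x ∈ (Opens.map φ).obj U := fun x hx => hle U i ⟨x, hx, rfl⟩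
  have h4 : O ≤ V U i := h'
  have h5 := appLE_comp (j i) g hg h2
  rw [h1, ← appLE_resHom (j i) h3 h4, ← resHom_appLE (j i) (apply_mem_image (j i)) (hle U i),
    Category.assoc, reassoc_of% (hc U i), reassoc_of% (hm U i), appLE_resHom] at h5
  exact h5.symm

end glue

end BlueprintedSpace

namespace Blueprint

/-! ### The universal property of localizations -/

section localization

variable {B C D E : Blueprint.{u}} {S : Submonoid B}

/-- The map `S⁻¹B → S⁻¹(B⁺)`. -/
def fracToPlus (S : Submonoid B) : B.localization S →*₀ Localization (plusSubmonoid S) :=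
  locToPlus S

lemma loc_rel_iff (x y : MonoidAlgebra ℕ (B.localization S)) :
    (B.localization S).rel x y ↔ evalSum (fracToPlus S) x = evalSum (fracToPlus S) y := Iff.rfl

lemma fracToPlus_mul (a : B) (s : S) :
    fracToPlus S (frac S a s) * algebraMap B.Plus (Localization (plusSubmonoid S)) (B.toPlus s) =
      algebraMap B.Plus (Localization (plusSubmonoid S)) (B.toPlus a) :=
  locToPlus_mk_mul S a s

/-- The underlying map of the localization morphism `B → S⁻¹B`. -/
def toLocHom (S : Submonoid B) : B →*₀ B.localization S where
  toFun b := frac S b 1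
  map_zero' := frac_zero 1
  map_one' := frac_one
  map_mul' a b := by rw [frac_mul, one_mul]

lemma evalSum_toLocHom (x : MonoidAlgebra ℕ B) :
    evalSum (fracToPlus S) (mapSum (toLocHom S) x) =
      algebraMap B.Plus (Localization (plusSubmonoid S)) (B.mkPlus x) := by
  rw [← evalSum_toPlus]
  refine ringHom_comp_evalSum B.toPlus (fracToPlus S) (toLocHom S)
    (algebraMap B.Plus (Localization (plusSubmonoid S))) (fun a => ?_) x
  have := fracToPlus_mul a (1 : S)
  rw [OneMemClass.coe_one, map_one, map_one, mul_one] at this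
  exact this.symm

/-- The localization morphism `B → S⁻¹B`. -/
def toLoc (S : Submonoid B) : B ⟶ B.localization S where
  hom := toLocHom S
  map_rel x y h := by
    rw [loc_rel_iff, evalSum_toLocHom, evalSum_toLocHom, (B.mkPlus_eq_iff x y).2 h]

lemma toLoc_apply (b : B) : (toLoc S).hom b = frac S b 1 := rfl

lemma frac_mul_toLoc (a : B) (s : S) : frac S a s * (toLoc S).hom s = (toLoc S).hom a := by
  rw [toLoc_apply, toLoc_apply, frac_mul, frac_eq_iff]
  exact ⟨1, by simp [mul_comm]⟩

lemma isUnit_toLoc {s : B} (hs : s ∈ S) : IsUnit ((toLoc S).hom s) := by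
  refine IsUnit.of_mul_eq_one (frac S 1 ⟨s, hs⟩) ?_
  rw [mul_comm, frac_mul_toLoc _ (⟨s, hs⟩ : S), map_one]

/-- Every fraction becomes an element of `B` after multiplication by some `s`, whose image is a unit
and can be cancelled. -/
lemma loc_hom_ext {f g : B.localization S ⟶ E} (h : toLoc S ≫ f = toLoc S ≫ g) : f = g := by
  have h' : ∀ b, f.hom ((toLoc S).hom b) = g.hom ((toLoc S).hom b) := fun b =>
    congrArg (fun k : B ⟶ E => k.hom b) h
  refine hom_ext fun z => ?_
  obtain ⟨a, s, rfl⟩ := frac_surj z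
  have hu : IsUnit (g.hom ((toLoc S).hom s)) := (isUnit_toLoc s.2).map g.hom
  refine hu.mul_right_cancel ?_
  rw [← map_mul, ← h', ← map_mul, frac_mul_toLoc, h']

/-- The map underlying `locLift`. -/
def locLiftHom (φ : B ⟶ E) (h : ∀ s ∈ S, IsUnit (φ.hom s)) :
    B.localization S →*₀ E :=
  (Localization.monoidOf S).lift₀ φ.hom fun s => h s s.2

lemma locLiftHom_frac (φ : B ⟶ E) (h : ∀ s ∈ S, IsUnit (φ.hom s)) (a : B) :
    locLiftHom φ h (frac S a 1) = φ.hom a := by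
  change locLiftHom φ h (Localization.mk a 1) = _
  rw [Localization.mk_one_eq_monoidOf_mk]
  exact (Localization.monoidOf S).lift_eq _ a

/-- The morphism `S⁻¹B → E` induced by a morphism `B → E` that maps `S` to units. -/
def locLift (φ : B ⟶ E) (h : ∀ s ∈ S, IsUnit (φ.hom s)) : B.localization S ⟶ E where
  hom := locLiftHom φ h
  map_rel x y hxy := by
    have hu : ∀ y : plusSubmonoid S, IsUnit (plusMap φ y) := by
      rintro ⟨_, s, hs, rfl⟩
      change IsUnit (plusMap φ (B.toPlus s))
      rw [plusMap_toPlus]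
      exact (h s hs).map E.toPlus
    let ψ : Localization (plusSubmonoid S) →+* E.Plus := IsLocalization.lift hu
    have hψ : ∀ a, ψ (fracToPlus S a) = E.toPlus (locLiftHom φ h a) := by
      intro a
      obtain ⟨a, s, rfl⟩ := frac_surj a
      have e1 := congrArg ψ (fracToPlus_mul a s)
      rw [map_mul, IsLocalization.lift_eq, IsLocalization.lift_eq, plusMap_toPlus,
        plusMap_toPlus] at e1
      refine ((h s s.2).map E.toPlus).mul_right_cancel (e1.trans ?_)
      rw [← map_mul, ← locLiftHom_frac φ h s, ← map_mul, ← locLiftHom_frac φ h a]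
      exact congrArg (fun z => E.toPlus (locLiftHom φ h z)) (frac_mul_toLoc a s).symm
    rw [loc_rel_iff] at hxy
    have e := ringHom_comp_evalSum (fracToPlus S) E.toPlus (locLiftHom φ h) ψ hψ
    rw [← mkPlus_eq_iff, ← evalSum_toPlus, ← evalSum_toPlus]
    exact (e x).trans ((congrArg ψ hxy).trans (e y).symm)

lemma toLoc_locLift (φ : B ⟶ E) (h : ∀ s ∈ S, IsUnit (φ.hom s)) :
    toLoc S ≫ locLift φ h = φ :=
  hom_ext fun b => locLiftHom_frac φ h b

lemma toLoc_locMap (φ : B ⟶ C) (S : Submonoid B) (T : Submonoid C) (h : ∀ s ∈ S, φ.hom s ∈ T) :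
    toLoc S ≫ locMap φ S T h = φ ≫ toLoc T := by
  refine hom_ext fun b => ?_
  refine (locMap_frac φ S T h b 1).trans ?_
  rw [comp_hom, toLoc_apply]
  congr 1
  exact Subtype.ext (map_one φ.hom)

/-- A relation in `S⁻¹B` is an equality in the localized semiring `S⁻¹(B⁺)`, and such an equality
already holds in `B⁺` after multiplication by a single element of `S`. -/
lemma rel_of_toLoc_rel {x y : MonoidAlgebra ℕ B}
    (h : (B.localization S).rel (mapSum (toLoc S).hom x) (mapSum (toLoc S).hom y)) :
    ∃ s ∈ S, B.rel (MonoidAlgebra.single s 1 * x) (MonoidAlgebra.single s 1 * y) := by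
  have h' := (loc_rel_iff _ _).1 h
  rw [toLoc, evalSum_toLocHom, evalSum_toLocHom] at h'
  obtain ⟨⟨_, s, hs, rfl⟩, h2⟩ := (IsLocalization.eq_iff_exists (plusSubmonoid S) _).1 h'
  refine ⟨s, hs, ?_⟩
  rw [← mkPlus_eq_iff, map_mul, map_mul]
  exact h2

end localization

/-! ### Formal sums supported in a subset -/

section support

variable {A : Type*}

lemma sum_induction_on {I : Set A} {P : MonoidAlgebra ℕ A → Prop} (x : MonoidAlgebra ℕ A)
    (hx : ∀ a ∈ x.coeff.support, a ∈ I) (h0 : P 0) (hadd : ∀ y z, P y → P z → P (y + z))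
    (hs : ∀ a ∈ I, ∀ n, P (MonoidAlgebra.single a n)) : P x := by
  have : x = ∑ a ∈ x.coeff.support, MonoidAlgebra.single a (x.coeff a) := by
    exact (MonoidAlgebra.sum_coeff_single x).symm
  rw [this]
  exact Finset.sum_induction _ P hadd h0 fun a ha => hs a (hx a ha) _

lemma support_add {I : Set A} {x y : MonoidAlgebra ℕ A} (hx : ∀ a ∈ x.coeff.support, a ∈ I)
    (hy : ∀ a ∈ y.coeff.support, a ∈ I) : ∀ a ∈ (x + y).coeff.support, a ∈ I := by
  classical
  intro a ha
  rcases Finset.mem_union.1 (Finsupp.support_add (g₁ := x.coeff) (g₂ := y.coeff) ha) with h | h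
  exacts [hx a h, hy a h]

lemma support_single {I : Set A} {a : A} (h : a ∈ I) (n : ℕ) :
    ∀ b ∈ (MonoidAlgebra.single a n).coeff.support, b ∈ I := by
  intro b hb
  rw [Finset.mem_singleton.1 (Finsupp.support_single_subset (a := a) (b := n) hb)]
  exact h

lemma support_single_mul [CommMonoidWithZero A] {I : Set A} (hI : ∀ a b : A, b ∈ I → a * b ∈ I)
    {x : MonoidAlgebra ℕ A} (hx : ∀ a ∈ x.coeff.support, a ∈ I) (s : A) :
    ∀ a ∈ (MonoidAlgebra.single s 1 * x).coeff.support, a ∈ I := by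
  refine sum_induction_on (P := fun x => ∀ a ∈ (MonoidAlgebra.single s 1 * x).coeff.support, a ∈ I)
    x hx ?_ ?_ ?_
  · simp
  · intro y z hy hz
    rw [mul_add]
    exact support_add hy hz
  · intro a ha n
    rw [MonoidAlgebra.single_mul_single]
    exact support_single (hI s a ha) _

end support

end Blueprint

/-! ### The maximal ideal of a localization; sections over a spectrum -/

namespace Blueprint

variable {B C D E : Blueprint.{u}}

/-- A formal sum is finite, so it has a common denominator; the numerators stay in `I` because `I`
absorbs multiplication. -/
lemma exists_clear_denominators {S : Submonoid B} {I : Set B} (hI : ∀ a b : B, b ∈ I → a * b ∈ I)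
    (x : MonoidAlgebra ℕ (B.localization S))
    (hx : ∀ z ∈ x.coeff.support, z ∈ {z | ∃ a ∈ I, ∃ s : S, z = frac S a s}) :
    ∃ s ∈ S, ∃ y : MonoidAlgebra ℕ B, (∀ a ∈ y.coeff.support, a ∈ I) ∧
      MonoidAlgebra.single ((toLoc S).hom s) 1 * x = mapSum (toLoc S).hom y := by
  refine sum_induction_on (P := fun x => ∃ s ∈ S, ∃ y : MonoidAlgebra ℕ B,
    (∀ a ∈ y.coeff.support, a ∈ I) ∧
      MonoidAlgebra.single ((toLoc S).hom s) 1 * x = mapSum (toLoc S).hom y) x hx ?_ ?_ ?_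
  · exact ⟨1, S.one_mem, 0, by simp, by simp⟩
  · rintro x x' ⟨s, hs, y, hy, e⟩ ⟨s', hs', y', hy', e'⟩
    refine ⟨s * s', S.mul_mem hs hs', MonoidAlgebra.single s' 1 * y + MonoidAlgebra.single s 1 * y',
      support_add (support_single_mul hI hy _) (support_single_mul hI hy' _), ?_⟩
    have h1 : (MonoidAlgebra.single ((toLoc S).hom (s * s')) 1 :
        MonoidAlgebra ℕ (B.localization S)) =
        MonoidAlgebra.single ((toLoc S).hom s) 1 * MonoidAlgebra.single ((toLoc S).hom s') 1 := by
      rw [MonoidAlgebra.single_mul_single, one_mul, map_mul]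
    rw [h1, map_add, map_mul (mapSum _), map_mul (mapSum _), mapSum_single, mapSum_single,
      ← e, ← e']
    ring
  · rintro z ⟨a, ha, s, rfl⟩ n
    refine ⟨s, s.2, MonoidAlgebra.single a n, support_single ha n, ?_⟩
    rw [MonoidAlgebra.single_mul_single, one_mul, mapSum_single, mul_comm, frac_mul_toLoc]

/-- The prime ideal of non-units of the localization at a prime ideal. -/
def maxPrime (p : B.PrimeIdeal) : (B.stalkAt p).PrimeIdeal where
  asSet := {z | ¬ IsUnit z}
  one_notMem h := h isUnit_one
  mem_or_mem a b h := by
    by_contra! h'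
    exact h ((not_not.1 h'.1).mul (not_not.1 h'.2))
  isIdeal :=
    { mul_mem := fun a b hb h => hb (isUnit_of_mul_isUnit_right h)
      sum_mem := by
        intro x y c hx hy h hc
        have key : ∀ z : B.stalkAt p, ¬ IsUnit z →
            z ∈ {z | ∃ a ∈ p.asSet, ∃ s : p.compl, z = frac p.compl a s} := by
          intro z hz
          obtain ⟨a, s, rfl⟩ := frac_surj z
          rw [isUnit_frac_iff] at hz
          exact ⟨a, not_not.1 hz, s, rfl⟩
        obtain ⟨s, hs, x₀, hx₀, ex⟩ := exists_clear_denominators p.isIdeal.mul_mem x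
          fun z hz => key z (hx z hz)
        obtain ⟨t, ht, y₀, hy₀, ey⟩ := exists_clear_denominators p.isIdeal.mul_mem y
          fun z hz => key z (hy z hz)
        obtain ⟨a, r, rfl⟩ := frac_surj c
        rw [isUnit_frac_iff] at hc
        -- Multiplication by `s t r` removes the denominators of `x`, `y` and `c` at once. The
        -- relation then descends to `B` up to a factor `u ∉ p` and exhibits `u s t a`, a product of
        -- elements outside `p`, as an element of `p`.
        have h' := (B.stalkAt p).rel.mul ((B.stalkAt p).rel.refl
          (MonoidAlgebra.single ((toLoc p.compl).hom s * (toLoc p.compl).hom t *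
            (toLoc p.compl).hom (r : B)) 1)) h
        have e0 : ∀ u v w : B.stalkAt p, (MonoidAlgebra.single (u * v * w) 1 :
            MonoidAlgebra ℕ (B.stalkAt p)) = MonoidAlgebra.single u 1 *
              MonoidAlgebra.single v 1 * MonoidAlgebra.single w 1 := fun u v w => by
          simp [MonoidAlgebra.single_mul_single]
        have ec : (MonoidAlgebra.single ((toLoc p.compl).hom (r : B)) 1 :
            MonoidAlgebra ℕ (B.stalkAt p)) * MonoidAlgebra.single (frac p.compl a r) 1 =
              mapSum (toLoc p.compl).hom (MonoidAlgebra.single a 1) := by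
          rw [MonoidAlgebra.single_mul_single, one_mul, mapSum_single, mul_comm, frac_mul_toLoc]
        have e1 : MonoidAlgebra.single ((toLoc p.compl).hom s * (toLoc p.compl).hom t *
            (toLoc p.compl).hom (r : B)) 1 * (x + MonoidAlgebra.single (frac p.compl a r) 1) =
            mapSum (toLoc p.compl).hom (MonoidAlgebra.single t 1 * MonoidAlgebra.single (r : B) 1 *
              x₀ + MonoidAlgebra.single s 1 * MonoidAlgebra.single t 1 *
                MonoidAlgebra.single a 1) := by
          rw [e0, map_add, map_mul, map_mul, map_mul, map_mul, ← ec, ← ex]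
          simp only [mapSum_single]
          ring
        have e2 : MonoidAlgebra.single ((toLoc p.compl).hom s * (toLoc p.compl).hom t *
            (toLoc p.compl).hom (r : B)) 1 * y =
            mapSum (toLoc p.compl).hom (MonoidAlgebra.single s 1 * MonoidAlgebra.single (r : B) 1 *
              y₀) := by
          rw [e0, map_mul, map_mul, ← ey]
          simp only [mapSum_single]
          ring
        rw [e1, e2] at h'
        obtain ⟨u, hu, h''⟩ := rel_of_toLoc_rel h'
        rw [mul_add] at h''
        simp only [MonoidAlgebra.single_mul_single, one_mul] at h''
        have hI := p.isIdeal.mul_mem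
        have := p.isIdeal.sum_mem _ _ _
          (support_single_mul hI (support_single_mul hI hx₀ _) _)
          (support_single_mul hI (support_single_mul hI hy₀ _) _) h''
        exact p.compl.mul_mem hu (p.compl.mul_mem (p.compl.mul_mem hs ht) hc) this }

/-! ### Sections and values on spectra -/

/-- The complement of the prime ideal belonging to a point of the spectrum. -/
def nz (p : B.specSpace) : Submonoid B := PrimeIdeal.compl (p : B.PrimeIdeal)

/-- The localization at a point of the spectrum. -/
abbrev stalk (B : Blueprint.{u}) (p : B.specSpace) : Blueprint.{u} := B.localization (nz p)

lemma isUnit_frac_nz_iff {p : B.specSpace} (a : B) (h : nz p) :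
    IsUnit (frac (nz p) a h) ↔ a ∈ nz p := isUnit_frac_iff (p : B.PrimeIdeal) a h

lemma isUnit_toLoc_nz_iff {p : B.specSpace} (a : B) :
    IsUnit ((toLoc (nz p)).hom a) ↔ a ∈ nz p := isUnit_frac_nz_iff a 1

lemma specSpace_ext {p q : B.specSpace} (h : ∀ a, a ∈ nz p ↔ a ∈ nz q) : p = q := by
  refine PrimeIdeal.ext (x := (p : B.PrimeIdeal)) (y := (q : B.PrimeIdeal)) (Set.ext fun a => ?_)
  exact not_iff_not.1 (h a)

lemma mem_nz_of_mul {p : B.specSpace} {a b : B} (h : a * b ∈ nz p) : a ∈ nz p := fun ha =>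
  h (mul_comm a b ▸ (PrimeIdeal.isIdeal p).mul_mem b a ha)

lemma zero_notMem_nz (p : B.specSpace) : (0 : B) ∉ nz p := fun h =>
  h ((PrimeIdeal.isIdeal p).sum_mem 0 0 0 (by simp) (by simp) (by rw [zero_add]; exact B.zero_rel))

lemma mem_nz_base {φ : B ⟶ C} {q : C.specSpace} {b : B} :
    b ∈ nz ((specSpaceMap φ).hom.base q) ↔ φ.hom b ∈ nz q := Iff.rfl

/-- The point `q` is the preimage of the maximal ideal of `C_p`. This is the source of points of
spectra for which only a morphism to a stalk is known. -/
lemma exists_base_of_hom (p : C.specSpace) (ψ : B ⟶ C.stalk p) :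
    ∃ q : B.specSpace, ∀ b, b ∈ nz q ↔ IsUnit (ψ.hom b) :=
  ⟨PrimeIdeal.comap ψ (maxPrime p), fun _ => not_not⟩

/-- The value of a section over `U` at a point of `U`. -/
def specEval (B : Blueprint.{u}) (U : Opens B.specSpace) (p : B.specSpace) (hp : p ∈ U) :
    B.specSpace.presheaf.obj (op U) ⟶ B.stalk p :=
  B.evalHom (U := U) ⟨p, hp⟩

lemma spec_section_hom_ext {U : Opens B.specSpace} {f g : E ⟶ B.specSpace.presheaf.obj (op U)}
    (h : ∀ p hp, f ≫ B.specEval U p hp = g ≫ B.specEval U p hp) : f = g :=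
  B.hom_sections_ext (U := U) fun p => h p.1 p.2

lemma spec_section_ext {U : Opens B.specSpace} {s t : B.specSpace.presheaf.obj (op U)}
    (h : ∀ p hp, (B.specEval U p hp).hom s = (B.specEval U p hp).hom t) : s = t :=
  B.sections_ext (U := U) s t fun p => h p.1 p.2

lemma exists_specEval_eq_frac {U : Opens B.specSpace} (s : B.specSpace.presheaf.obj (op U))
    (p : B.specSpace) (hp : p ∈ U) : ∃ (V : Opens B.specSpace) (_ : p ∈ V) (hV : V ≤ U) (a h : B),
      ∀ q (hq : q ∈ V), ∃ hh : h ∈ nz q,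
        (B.specEval U q (hV hq)).hom s = frac (nz q) a ⟨h, hh⟩ := by
  obtain ⟨V, hpV, hV, a, h, H⟩ := Subtype.prop (p := fun s => s ∈ B.sectionsSubmonoid U) s ⟨p, hp⟩
  exact ⟨V, hpV, hV, a, h, fun q hq => H ⟨q, hq⟩⟩

/-- The morphism to a blueprint of sections given by morphisms to the localizations whose values
are locally fractions. -/
def specSectionHom (U : Opens B.specSpace) (f : ∀ p ∈ U, E ⟶ B.stalk p)
    (hf : ∀ (e : E), ∀ p ∈ U, ∃ (V : Opens B.specSpace) (_ : p ∈ V) (hV : V ≤ U) (a h : B),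
      ∀ q (hq : q ∈ V), ∃ hh : h ∈ nz q, (f q (hV hq)).hom e = frac (nz q) a ⟨h, hh⟩) :
    E ⟶ B.specSpace.presheaf.obj (op U) :=
  B.homToSections U (fun p => f p.1 p.2) (fun e p => by
    obtain ⟨V, hpV, hV, a, h, H⟩ := hf e p.1 p.2
    exact ⟨V, hpV, hV, a, h, fun q => H q.1 q.2⟩)

lemma specSectionHom_specEval (U : Opens B.specSpace) (f : ∀ p ∈ U, E ⟶ B.stalk p) (hf)
    (p : B.specSpace) (hp : p ∈ U) : specSectionHom U f hf ≫ B.specEval U p hp = f p hp := rfl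

/-- The morphism `B → 𝒪(U)`. -/
def toSpecSections (B : Blueprint.{u}) (U : Opens B.specSpace) :
    B ⟶ B.specSpace.presheaf.obj (op U) :=
  specSectionHom U (fun p _ => toLoc (nz p)) fun b _ hp =>
    ⟨U, hp, le_rfl, b, 1, fun _ _ => ⟨Submonoid.one_mem _, rfl⟩⟩

lemma toSpecSections_specEval (U : Opens B.specSpace) (p : B.specSpace) (hp : p ∈ U) :
    B.toSpecSections U ≫ B.specEval U p hp = toLoc (nz p) := rfl

lemma toSpecSections_specEval_apply (U : Opens B.specSpace) (p : B.specSpace) (hp : p ∈ U) (b : B) :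
    (B.specEval U p hp).hom ((B.toSpecSections U).hom b) = (toLoc (nz p)).hom b := rfl

lemma toSpecSections_resHom {U V : Opens B.specSpace} (h : V ≤ U) :
    B.toSpecSections U ≫ BlueprintedSpace.resHom B.specSpace h = B.toSpecSections V := rfl

/-- The morphism `B_p → C_q` induced by `φ : B → C` if `p = φ⁻¹(q)`. -/
def stalkMap (φ : B ⟶ C) (p : B.specSpace) (q : C.specSpace)
    (h : (specSpaceMap φ).hom.base q = p) : B.stalk p ⟶ C.stalk q :=
  locMap φ _ _ (by subst h; exact fun _ h => h)

lemma stalkMap_frac (φ : B ⟶ C) (p : B.specSpace) (q : C.specSpace)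
    (h : (specSpaceMap φ).hom.base q = p) (a : B) (s : nz p) :
    (stalkMap φ p q h).hom (frac (nz p) a s) =
      frac (nz q) (φ.hom a) ⟨φ.hom s, by subst h; exact s.2⟩ :=
  locMap_frac _ _ _ _ _ _

lemma toLoc_stalkMap (φ : B ⟶ C) (p : B.specSpace) (q : C.specSpace)
    (h : (specSpaceMap φ).hom.base q = p) :
    toLoc (nz p) ≫ stalkMap φ p q h = φ ≫ toLoc (nz q) :=
  toLoc_locMap _ _ _ _

lemma appLE_specEval (φ : B ⟶ C) {U : Opens B.specSpace} {V : Opens C.specSpace}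
    (h : ∀ q ∈ V, (specSpaceMap φ).hom.base q ∈ U) (p : B.specSpace) (q : C.specSpace) (hq : q ∈ V)
    (e : (specSpaceMap φ).hom.base q = p) :
    BlueprintedSpace.appLE (specSpaceMap φ) U V h ≫ C.specEval V q hq =
      B.specEval U p (e ▸ h q hq) ≫ stalkMap φ p q e := by
  subst e
  rfl

lemma toSpecSections_appLE (φ : B ⟶ C) {U : Opens B.specSpace} {V : Opens C.specSpace}
    (h : ∀ q ∈ V, (specSpaceMap φ).hom.base q ∈ U) :
    B.toSpecSections U ≫ BlueprintedSpace.appLE (specSpaceMap φ) U V h =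
      φ ≫ C.toSpecSections V := by
  refine spec_section_hom_ext fun q hq => ?_
  rw [Category.assoc, appLE_specEval φ h _ q hq rfl, reassoc_of% toSpecSections_specEval,
    toLoc_stalkMap, Category.assoc, toSpecSections_specEval]

/-- The basic open subset `D(a)`. -/
def basicOpen (a : B) : Opens B.specSpace := ⟨basicOpenSet a, isOpen_basicOpenSet a⟩

lemma continuous_of_basicOpen {X : Type*} [TopologicalSpace X] {f : X → B.specSpace}
    (h : ∀ a : B, IsOpen {x | a ∈ nz (f x)}) : Continuous f :=
  continuous_generateFrom_iff.2 (by rintro _ ⟨a, rfl⟩; exact h a)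

/-- The sets `D(a)` are closed under finite intersections because `D(a) ∩ D(b) = D(ab)` and `D(1)`
is everything, so they form a basis and not merely a subbasis. -/
lemma exists_basicOpen_le {U : Opens B.specSpace} {p : B.specSpace} (hp : p ∈ U) :
    ∃ a, p ∈ basicOpen a ∧ basicOpen a ≤ U := by
  have hb : IsTopologicalBasis (Set.range (basicOpenSet (B := B))) := by
    refine ⟨?_, ?_, rfl⟩
    · rintro _ ⟨a, rfl⟩ _ ⟨b, rfl⟩ p ⟨ha, hb⟩
      refine ⟨_, ⟨a * b, rfl⟩, PrimeIdeal.compl p |>.mul_mem ha hb, fun q hq => ⟨?_, ?_⟩⟩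
      · exact mem_nz_of_mul (p := q) hq
      · exact mem_nz_of_mul (p := q) (mul_comm a b ▸ hq)
    · exact Set.eq_univ_of_forall fun p => ⟨_, ⟨1, rfl⟩, p.one_notMem⟩
  obtain ⟨_, ⟨a, rfl⟩, ha, hle⟩ := hb.exists_subset_of_mem_open (a := (p : B.PrimeIdeal)) hp U.2
  exact ⟨a, ha, hle⟩

/-- Near `p` the section is a fraction `a / h`. If its value at `p` is a unit, then `a ∉ p`, and `h
/ a` is an inverse on the part of the neighbourhood where `a` does not vanish. -/
lemma isUnitAt_spec_iff {U : Opens B.specSpace} (s : B.specSpace.presheaf.obj (op U))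
    (p : B.specSpace) (hp : p ∈ U) :
    B.specSpace.IsUnitAt s p ↔ IsUnit ((B.specEval U p hp).hom s) := by
  constructor
  · rintro ⟨V, hV, hpV, hu⟩
    exact hu.map (B.specEval V p hpV).hom
  · intro hu
    obtain ⟨V, hpV, hV, a, h, H⟩ := exists_specEval_eq_frac s p hp
    obtain ⟨h0, e0⟩ := H p hpV
    rw [e0, isUnit_frac_nz_iff] at hu
    have hle : V ⊓ basicOpen a ≤ U := inf_le_left.trans hV
    obtain ⟨t, ht⟩ : ∃ t : B.specSpace.presheaf.obj (op (V ⊓ basicOpen a)), ∀ r hr,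
        (B.specEval _ r hr).hom t = frac (nz r) h ⟨a, hr.2⟩ :=
      ⟨⟨fun r => frac r.1.compl h ⟨a, r.2.2⟩, fun r => ⟨V ⊓ basicOpen a, r.2, le_rfl, h, a,
        fun r => ⟨r.2.2, rfl⟩⟩⟩, fun _ _ => rfl⟩
    refine ⟨V ⊓ basicOpen a, hle, ⟨hpV, hu⟩, IsUnit.of_mul_eq_one t ?_⟩
    refine spec_section_ext fun r hr => ?_
    obtain ⟨h1, e1⟩ := H r hr.1
    have e2 : (B.specEval _ r hr).hom (B.specSpace.res hle s) = frac (nz r) a ⟨h, h1⟩ := e1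
    rw [map_mul, map_one, ht, e2, frac_mul, ← frac_one, frac_eq_iff]
    exact ⟨1, by simp [mul_comm]⟩

end Blueprint

/-! ### Morphisms into a spectrum are determined by global sections -/

namespace Blueprint

open BlueprintedSpace

variable {B C D E : Blueprint.{u}} {T T' : BlueprintedSpace.{u}}

lemma _root_.BlueprintedSpace.apply_mem_top {X Y : BlueprintedSpace.{u}} (f : X ⟶ Y)
    {V : Opens X} : ∀ x ∈ V, f.hom.base x ∈ (⊤ : Opens Y) := fun _ _ => trivial

/-- The morphism `C → Γ(T)` defined by a morphism `T → Spec C`. -/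
def globalHom (f : T ⟶ C.specSpace) : C ⟶ T.presheaf.obj (op ⊤) :=
  C.toSpecSections ⊤ ≫ appLE f ⊤ ⊤ (apply_mem_top f)

lemma globalHom_comp_specSpaceMap (f : T ⟶ C.specSpace) (φ : B ⟶ C) :
    globalHom (f ≫ specSpaceMap φ) = φ ≫ globalHom f := by
  have h : ∀ q ∈ (⊤ : Opens C.specSpace), (specSpaceMap φ).hom.base q ∈ (⊤ : Opens B.specSpace) :=
    apply_mem_top (specSpaceMap φ)
  rw [globalHom, globalHom, ← appLE_comp f (specSpaceMap φ) h (apply_mem_top f), reassoc_of% toSpecSections_appLE]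

lemma toSpecSections_appLE_hom (f : T ⟶ C.specSpace) {U : Opens C.specSpace} {V : Opens T}
    (h : ∀ x ∈ V, f.hom.base x ∈ U) :
    C.toSpecSections U ≫ appLE f U V h = globalHom f ≫ T.resHom le_top := by
  rw [globalHom, Category.assoc, appLE_resHom, ← toSpecSections_resHom le_top, Category.assoc,
    resHom_appLE]

lemma isUnitAt_toSpecSections {U : Opens C.specSpace} {p : C.specSpace} (hp : p ∈ U) (c : C) :
    C.specSpace.IsUnitAt ((C.toSpecSections U).hom c) p ↔ c ∈ nz p := by
  rw [isUnitAt_spec_iff _ p hp, toSpecSections_specEval_apply, isUnit_toLoc_nz_iff]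

/-- An element lies outside a prime exactly when it is a unit at that point. A local morphism both
preserves and reflects this, so the point `f(x)` can be read off from `globalHom f`. -/
lemma mem_nz_iff_isUnitAt {f : T ⟶ C.specSpace} (hf : IsLocalHom f) (x : T) (c : C) :
    c ∈ nz (f.hom.base x) ↔ T.IsUnitAt ((globalHom f).hom c) x := by
  rw [← isUnitAt_toSpecSections (U := ⊤) (Opens.mem_top _)]
  exact ⟨fun h => isUnitAt_appLE f (apply_mem_top f) _ (Opens.mem_top _) h, fun h =>
    (isLocalHom_iff f).1 hf _ _ (apply_mem_top f) _ x (Opens.mem_top _) h⟩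

lemma toLoc_eq_mul_of_eq_frac {p : B.specSpace} {z : B.stalk p} {a h : B} (hh : h ∈ nz p)
    (e : z = frac (nz p) a ⟨h, hh⟩) : z * (toLoc (nz p)).hom h = (toLoc (nz p)).hom a := by
  rw [e]
  exact frac_mul_toLoc a (⟨h, hh⟩ : nz p)

/-- The statement `s = a / h` is rewritten as an equation `s h = a` between sections, a form that
every morphism preserves. -/
lemma exists_section_mul_eq {U : Opens B.specSpace} (s : B.specSpace.presheaf.obj (op U))
    (p : B.specSpace) (hp : p ∈ U) : ∃ (V : Opens B.specSpace) (_ : p ∈ V) (hV : V ≤ U) (a h : B),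
      (∀ q ∈ V, h ∈ nz q) ∧
        (B.specSpace.resHom hV).hom s * (B.toSpecSections V).hom h = (B.toSpecSections V).hom a := by
  obtain ⟨V, hpV, hV, a, h, H⟩ := exists_specEval_eq_frac s p hp
  refine ⟨V, hpV, hV, a, h, fun q hq => (H q hq).1, spec_section_ext fun q hq => ?_⟩
  obtain ⟨hh, e⟩ := H q hq
  rw [map_mul]
  exact toLoc_eq_mul_of_eq_frac hh e

/-- Near `f(x)` there is an equation `s k = a` with `k` a unit. If the pullback of `s` is a unit at
`x`, so is that of `a`; by hypothesis `a` lies outside `f(x)`, and then `s` is a unit there. -/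
lemma isLocalHom_to_spec {f : T ⟶ C.specSpace}
    (h : ∀ x c, T.IsUnitAt ((globalHom f).hom c) x → c ∈ nz (f.hom.base x)) : IsLocalHom f := by
  rw [isLocalHom_iff]
  intro U V hUV s x hx hu
  obtain ⟨W, hpW, hW, a, k, hk, e⟩ := exists_section_mul_eq s (f.hom.base x) (hUV x hx)
  have hUW : ∀ y ∈ V ⊓ preim f W, f.hom.base y ∈ W := fun _ h => h.2
  have key : ∀ c, (appLE f W (V ⊓ preim f W) hUW).hom ((C.toSpecSections W).hom c) =
      (T.resHom le_top).hom ((globalHom f).hom c) := fun c =>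
    congrArg (fun k => Hom.hom k c) (toSpecSections_appLE_hom f hUW)
  have e' := congrArg (appLE f W (V ⊓ preim f W) hUW).hom e
  rw [map_mul, key, key, ← comp_hom, resHom_appLE, ← appLE_resHom f hUV inf_le_left, comp_hom] at e'
  have hxV : x ∈ V ⊓ preim f W := ⟨hx, hpW⟩
  have h1 : T.IsUnitAt ((T.resHom (inf_le_left : V ⊓ preim f W ≤ V)).hom ((appLE f U V hUV).hom s)) x :=
    (isUnitAt_iff_of_le _ _ hxV).2 hu
  have h2 : T.IsUnitAt ((T.resHom (le_top : V ⊓ preim f W ≤ ⊤)).hom ((globalHom f).hom k)) x := by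
    refine (isUnitAt_iff_of_le _ _ hxV).2 ?_
    exact isUnitAt_appLE f (apply_mem_top f) _ (Opens.mem_top _) ((isUnitAt_toSpecSections (Opens.mem_top _) k).2 (hk _ hpW))
  have h3 : T.IsUnitAt ((T.resHom (le_top : V ⊓ preim f W ≤ ⊤)).hom ((globalHom f).hom a)) x := by
    rw [← e']
    obtain ⟨O, hO, hxO, hu⟩ := h1
    obtain ⟨O', hO', hxO', hu'⟩ := h2
    refine ⟨O ⊓ O', inf_le_left.trans hO, ⟨hxO, hxO'⟩, ?_⟩
    have h1' := hu.map (T.resHom (inf_le_left : O ⊓ O' ≤ O)).hom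
    have h2' := hu'.map (T.resHom (inf_le_right : O ⊓ O' ≤ O')).hom
    rw [← comp_hom] at h1' h2'
    have := h1'.mul h2'
    rw [show T.presheaf.map _ = T.resHom hO from rfl, resHom_resHom,
      show T.presheaf.map _ = T.resHom hO' from rfl, resHom_resHom, ← map_mul] at this
    exact this
  have h4 : a ∈ nz (f.hom.base x) := h x a ((isUnitAt_iff_of_le le_top _ hxV).1 h3)
  have h5 := congrArg (C.specEval W _ hpW).hom e
  rw [map_mul] at h5
  refine (isUnitAt_spec_iff s _ (hUV x hx)).2 ?_
  have h6 : IsUnit ((C.specEval W _ hpW).hom ((C.toSpecSections W).hom a)) :=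
    (isUnit_toLoc_nz_iff a).2 h4
  rw [← h5] at h6
  exact isUnit_of_mul_isUnit_left h6

/-- A local morphism between spectra is determined by its effect on global sections. -/
lemma spec_hom_ext {f g : D.specSpace ⟶ C.specSpace} (hf : IsLocalHom f) (hg : IsLocalHom g)
    (h : globalHom f = globalHom g) : f = g := by
  have hb : ∀ x, f.hom.base x = g.hom.base x := fun x => specSpace_ext fun c => by
    rw [mem_nz_iff_isUnitAt hf, mem_nz_iff_isUnitAt hg, h]
  refine hom_ext' hb fun U V hU hU' => spec_section_hom_ext fun x hx => hom_ext fun s => ?_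
  obtain ⟨W, hpW, hW, a, k, hk, e⟩ := exists_section_mul_eq s (f.hom.base x) (hU x hx)
  have hfW : ∀ y ∈ V ⊓ preim f W, f.hom.base y ∈ W := fun _ h => h.2
  have hgW : ∀ y ∈ V ⊓ preim f W, g.hom.base y ∈ W := fun y h => hb y ▸ h.2
  have hxV : x ∈ V ⊓ preim f W := ⟨hx, hpW⟩
  -- Any morphism inducing the same map on global sections satisfies the same equation at `x`: the
  -- pullback of `s` times the image of `k` is the image of `a`. The image of `k` is a unit, so the
  -- pullback of `s` is determined.
  have key : ∀ (f' : D.specSpace ⟶ C.specSpace) (hf' : globalHom f' = globalHom f)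
      (hU : ∀ y ∈ V, f'.hom.base y ∈ U) (hW' : ∀ y ∈ V ⊓ preim f W, f'.hom.base y ∈ W),
      (D.specEval V x hx).hom ((appLE f' U V hU).hom s) *
        (D.specEval ⊤ x (Opens.mem_top _)).hom ((globalHom f).hom k) =
        (D.specEval ⊤ x (Opens.mem_top _)).hom ((globalHom f).hom a) := by
    intro f' hf' hU hW'
    have key : ∀ c, (appLE f' W (V ⊓ preim f W) hW').hom ((C.toSpecSections W).hom c) =
        (D.specSpace.resHom le_top).hom ((globalHom f).hom c) := fun c => by
      rw [← hf']
      exact congrArg (fun k => Hom.hom k c) (toSpecSections_appLE_hom f' hW')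
    have e' := congrArg (appLE f' W (V ⊓ preim f W) hW').hom e
    rw [map_mul, key, key, ← comp_hom, resHom_appLE, ← appLE_resHom f' hU inf_le_left,
      comp_hom] at e'
    have e'' := congrArg (D.specEval _ x hxV).hom e'
    rw [map_mul] at e''
    exact e''
  have hu : IsUnit ((D.specEval ⊤ x (Opens.mem_top _)).hom ((globalHom f).hom k)) :=
    (isUnitAt_spec_iff _ x (Opens.mem_top _)).1 ((mem_nz_iff_isUnitAt hf x k).1 (hk _ hpW))
  exact hu.mul_right_cancel ((key f rfl hU hfW).trans (key g h.symm hU' hgW).symm)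

/-- Every morphism from `C` to the global sections of `Spec D` is induced by a local morphism of
spectra. -/
lemma exists_spec_hom (φ : C ⟶ D.specSpace.presheaf.obj (op ⊤)) :
    ∃ f : D.specSpace ⟶ C.specSpace, IsLocalHom f ∧ globalHom f = φ := by
  -- The point assigned to `x` is the preimage of the maximal ideal of `D_x` under `C → Γ(Spec D) →
  -- D_x`.
  choose F hF using fun x : D.specSpace => exists_base_of_hom x (φ ≫ D.specEval ⊤ x (Opens.mem_top _))
  have hF' : ∀ x c, c ∈ nz (F x) ↔ D.specSpace.IsUnitAt (φ.hom c) x := fun x c => by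
    rw [hF, isUnitAt_spec_iff _ x (Opens.mem_top _)]; rfl
  have hcont : Continuous F := by
    refine continuous_of_basicOpen fun a => isOpen_iff_forall_mem_open.2 fun x hx => ?_
    obtain ⟨V, hVt, hxV, hu⟩ := (hF' x a).1 hx
    exact ⟨V, fun y hy => (hF' y a).2 ⟨V, hVt, hy, hu⟩, V.2, hxV⟩
  let b : D.specSpace.carrier ⟶ C.specSpace.carrier := TopCat.ofHom ⟨F, hcont⟩
  let st : ∀ x, C.stalk (F x) ⟶ D.stalk x := fun x =>
    locLift (φ ≫ D.specEval ⊤ x (Opens.mem_top _)) fun s hs => (hF x s).1 hs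
  have hst : ∀ x, toLoc (nz (F x)) ≫ st x = φ ≫ D.specEval ⊤ x (Opens.mem_top _) := fun x =>
    toLoc_locLift _ _
  have frac_loc : ∀ (U : Opens C.specSpace) (s : C.specSpace.presheaf.obj (op U)),
      ∀ x (hx : F x ∈ U), ∃ (V : Opens D.specSpace) (_ : x ∈ V) (hV : ∀ y ∈ V, F y ∈ U) (a h : D),
        ∀ y (hy : y ∈ V), ∃ hh : h ∈ nz y,
          (C.specEval U (F y) (hV y hy) ≫ st y).hom s = frac (nz y) a ⟨h, hh⟩ := by
    intro U s x hx
    obtain ⟨W, hpW, hW, c, k, H⟩ := exists_specEval_eq_frac s (F x) hx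
    obtain ⟨V₁, hx₁, _, a₁, h₁, H₁⟩ := exists_specEval_eq_frac (φ.hom c) x (Opens.mem_top _)
    obtain ⟨V₂, hx₂, _, a₂, h₂, H₂⟩ := exists_specEval_eq_frac (φ.hom k) x (Opens.mem_top _)
    let V : Opens D.specSpace := ⟨F ⁻¹' W, W.2.preimage hcont⟩ ⊓ (V₁ ⊓ V₂)
    have hV : ∀ y ∈ V, F y ∈ U := fun y hy => hW hy.1
    -- The pullback of `c / k` has value `φ(c) / φ(k)`. Here `φ(c)` and `φ(k)` are global sections
    -- that are only locally fractions, `a₁ / h₁` and `a₂ / h₂`, so the quotient is `a₁ h₂ / (h₁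
    -- a₂)`.
    refine ⟨V, ⟨hpW, hx₁, hx₂⟩, hV, a₁ * h₂, h₁ * a₂, fun y hy => ?_⟩
    obtain ⟨hk, e⟩ := H (F y) hy.1
    obtain ⟨hh₁, e₁⟩ := H₁ y hy.2.1
    obtain ⟨hh₂, e₂⟩ := H₂ y hy.2.2
    have ha₂ : a₂ ∈ nz y := by
      have := (hF y k).1 hk
      rw [comp_hom] at this
      have h' : IsUnit (frac (nz y) a₂ ⟨h₂, hh₂⟩) := e₂ ▸ this
      exact (isUnit_frac_nz_iff _ _).1 h'
    refine ⟨mul_mem hh₁ ha₂, ?_⟩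
    have e3 := congrArg (st y).hom (toLoc_eq_mul_of_eq_frac hk e)
    have e4 : ∀ c, (st y).hom ((toLoc (nz (F y))).hom c) =
        (D.specEval ⊤ y (Opens.mem_top _)).hom (φ.hom c) := fun c =>
      congrArg (fun m : C ⟶ D.stalk y => m.hom c) (hst y)
    rw [map_mul, e4, e4] at e3
    have e5 : (D.specEval ⊤ y (Opens.mem_top _)).hom (φ.hom k) = frac (nz y) a₂ ⟨h₂, hh₂⟩ := e₂
    have e6 : (D.specEval ⊤ y (Opens.mem_top _)).hom (φ.hom c) = frac (nz y) a₁ ⟨h₁, hh₁⟩ := e₁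
    rw [e5, e6] at e3
    refine ((isUnit_frac_nz_iff a₂ ⟨h₂, hh₂⟩).2 ha₂).mul_right_cancel (e3.trans ?_)
    rw [frac_mul, frac_eq_iff]
    refine ⟨1, ?_⟩
    change 1 * (h₁ * a₂ * h₂ * a₁) = 1 * (h₁ * (a₁ * h₂ * a₂))
    simp only [one_mul]
    ac_rfl
  let c : ∀ U : Opens C.specSpace, C.specSpace.presheaf.obj (op U) ⟶
      D.specSpace.presheaf.obj (op ((Opens.map b).obj U)) := fun U =>
    specSectionHom _ (fun y hy => C.specEval U (F y) hy ≫ st y) fun s x hx => by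
      obtain ⟨V, hxV, hV, a, h, H⟩ := frac_loc U s x hx
      exact ⟨V, hxV, hV, a, h, H⟩
  let f : D.specSpace ⟶ C.specSpace := InducedCategory.homMk
    { base := b
      c := { app := fun U => c U.unop, naturality := fun _ _ _ => rfl } }
  have hf : globalHom f = φ := by
    refine spec_section_hom_ext fun x _ => ?_
    exact hst x
  refine ⟨f, isLocalHom_to_spec fun x a hu => ?_, hf⟩
  rw [hf] at hu
  exact (hF' x a).2 hu

end Blueprint

/-! ### Open immersions of spectra and localizations -/

namespace BlueprintedSpace

open AlgebraicGeometry

variable {X Y Z : BlueprintedSpace.{u}}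

lemma isOpenImmersion_of_comp (f : X ⟶ Y) (j : Y ⟶ Z) [H : SheafedSpace.IsOpenImmersion j]
    [H' : SheafedSpace.IsOpenImmersion (f ≫ j)] : SheafedSpace.IsOpenImmersion f := by
  refine isOpenImmersion_of_appLE f (Topology.IsOpenEmbedding.of_comp f.hom.base
    H.base_open H'.base_open) fun U V hU h hV => ?_
  have h1 : IsIso (appLE (f ≫ j) (image j U) V fun x hx => apply_mem_image j _ (h x hx)) := by
    refine isIso_appLE _ ?_ _ ?_
    · rintro _ ⟨y, hy, rfl⟩
      obtain ⟨x, rfl⟩ := hU y hy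
      exact ⟨x, rfl⟩
    · rintro x ⟨y, hy, e⟩
      exact hV x (injective j e ▸ hy)
  rw [← appLE_comp f j (apply_mem_image j) h] at h1
  exact IsIso.of_isIso_comp_left (appLE j (image j U) U (apply_mem_image j)) _

end BlueprintedSpace

namespace Blueprint

open BlueprintedSpace AlgebraicGeometry

variable {B C D E : Blueprint.{u}}

/-- The inverse on sections is built pointwise from the inverses of the stalk maps. What needs proof
is that the resulting family is again locally a fraction. -/
lemma specSpaceMap_isOpenImmersion (φ : C ⟶ D)
    (hemb : Topology.IsOpenEmbedding (specSpaceMap φ).hom.base)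
    (hst : ∀ p q h, IsIso (stalkMap φ p q h)) :
    SheafedSpace.IsOpenImmersion (specSpaceMap φ) := by
  refine isOpenImmersion_of_appLE _ hemb fun U V hU hUV hVU => ?_
  choose r hr using hU
  have hrV : ∀ p hp, r p hp ∈ V := fun p hp => hVU _ (by rw [hr]; exact hp)
  let g : D.specSpace.presheaf.obj (op V) ⟶ C.specSpace.presheaf.obj (op U) :=
    specSectionHom U (fun p hp => D.specEval V (r p hp) (hrV p hp) ≫
      inv (stalkMap φ p (r p hp) (hr p hp))) fun s p hp => by
      obtain ⟨W, hqW, hWV, a, h, H⟩ := exists_specEval_eq_frac s (r p hp) (hrV p hp)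
      obtain ⟨c, k, hck⟩ := frac_surj ((D.specEval V (r p hp) (hrV p hp) ≫
        inv (stalkMap φ p (r p hp) (hr p hp))).hom s)
      obtain ⟨hh, e⟩ := H _ hqW
      have e1 := congrArg (stalkMap φ p (r p hp) (hr p hp)).hom hck
      rw [← comp_hom, Category.assoc, IsIso.inv_hom_id, Category.comp_id, e, stalkMap_frac,
        frac_eq_iff] at e1
      obtain ⟨w, hw⟩ := e1
      have hk : φ.hom k ∈ nz (r p hp) := mem_nz_base.1 (by rw [hr]; exact k.2)
      -- The equality of `φ(c) / φ(k)` and `a / h` in one stalk is witnessed by a single `w`. It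
      -- therefore persists at all points of `W` where `w` and `φ(k)` do not vanish, and `c / k`
      -- represents the inverse image on all of `O`.
      let O : Opens D.specSpace := W ⊓ (basicOpen (w : D) ⊓ basicOpen (φ.hom k))
      have hO : ∀ q ∈ O, (specSpaceMap φ).hom.base q ∈ U := fun q hq => hUV q (hWV hq.1)
      refine ⟨⟨(specSpaceMap φ).hom.base '' O, hemb.isOpenMap _ O.2⟩,
        ⟨_, ⟨hqW, w.2, hk⟩, hr p hp⟩, ?_, c, k, ?_⟩
      · rintro _ ⟨q, hq, rfl⟩
        exact hO q hq
      · rintro _ ⟨q, hq, rfl⟩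
        refine ⟨hq.2.2, ?_⟩
        have hrq : r _ (hO q hq) = q := hemb.injective (hr _ (hO q hq))
        have hgen : ∀ q' (hq' : q' = q) (h1 : q' ∈ V)
            (h2 : (specSpaceMap φ).hom.base q' = (specSpaceMap φ).hom.base q),
            (D.specEval V q' h1 ≫ inv (stalkMap φ _ q' h2)).hom s =
              frac (nz ((specSpaceMap φ).hom.base q)) c ⟨k, hq.2.2⟩ := by
          rintro q' rfl h1 h2
          obtain ⟨hh, e⟩ := H q' hq.1
          have e2 : (D.specEval V q' h1).hom s = (stalkMap φ _ q' h2).hom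
              (frac (nz ((specSpaceMap φ).hom.base q')) c ⟨k, hq.2.2⟩) := by
            rw [stalkMap_frac]
            refine e.trans ?_
            rw [frac_eq_iff]
            exact ⟨⟨w, hq.2.1⟩, hw⟩
          rw [comp_hom, e2, ← comp_hom, IsIso.hom_inv_id, id_hom]
        exact hgen _ hrq _ _
  have key : ∀ p hp q (h : (specSpaceMap φ).hom.base q = p) (hq : q ∈ V),
      g ≫ C.specEval U p hp ≫ stalkMap φ p q h = D.specEval V q hq := by
    intro p hp q h hq
    obtain rfl : r p hp = q := hemb.injective ((hr p hp).trans h.symm)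
    rw [reassoc_of% specSectionHom_specEval, Category.assoc, IsIso.inv_hom_id, Category.comp_id]
  refine ⟨g, spec_section_hom_ext fun p hp => ?_, spec_section_hom_ext fun q hq => ?_⟩
  · rw [Category.assoc, specSectionHom_specEval,
      reassoc_of% appLE_specEval φ hUV p (r p hp) (hrV p hp) (hr p hp), IsIso.hom_inv_id,
      Category.comp_id, Category.id_comp]
  · rw [Category.assoc, appLE_specEval φ hUV _ q hq rfl, key _ _ _ _ hq, Category.id_comp]

/-- The property of a morphism of being a localization at `S`. -/
structure IsLocalizationHom (φ : C ⟶ D) (S : Submonoid C) : Prop where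
  isUnit : ∀ s ∈ S, IsUnit (φ.hom s)
  surj : ∀ d, ∃ c, ∃ s ∈ S, d * φ.hom s = φ.hom c
  exists_lift : ∀ (E : Blueprint.{u}) (ψ : C ⟶ E), (∀ s ∈ S, IsUnit (ψ.hom s)) →
    ∃ ψ' : D ⟶ E, φ ≫ ψ' = ψ

lemma isLocalizationHom_toLoc (S : Submonoid C) : IsLocalizationHom (toLoc S) S where
  isUnit _ hs := isUnit_toLoc hs
  surj d := by
    obtain ⟨c, s, rfl⟩ := frac_surj d
    exact ⟨c, s, s.2, frac_mul_toLoc c s⟩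
  exists_lift _ ψ h := ⟨locLift ψ h, toLoc_locLift ψ h⟩

namespace IsLocalizationHom

variable {φ : C ⟶ D} {S : Submonoid C} (H : IsLocalizationHom φ S)
include H

lemma hom_ext {f g : D ⟶ E} (h : φ ≫ f = φ ≫ g) : f = g := by
  have h' : ∀ c, f.hom (φ.hom c) = g.hom (φ.hom c) := fun c => congrArg (fun k : C ⟶ E => k.hom c) h
  refine Blueprint.hom_ext fun d => ?_
  obtain ⟨c, s, hs, e⟩ := H.surj d
  refine ((H.isUnit s hs).map g.hom).mul_right_cancel ?_
  rw [← map_mul, ← h', ← map_mul, e, h']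

lemma mem_nz_of_mem {q : D.specSpace} {s : C} (hs : s ∈ S) : φ.hom s ∈ nz q := by
  rw [← isUnit_toLoc_nz_iff]
  exact (H.isUnit s hs).map _

/-- The morphism `C → C_p` inverts `S`, so it extends to `D → C_p`. This extension inverts
everything outside `q`, since every `d` is a fraction with numerator in `C`, and so induces the
inverse `D_q → C_p`. -/
lemma isIso_stalkMap (p : C.specSpace) (q : D.specSpace)
    (h : (specSpaceMap φ).hom.base q = p) : IsIso (stalkMap φ p q h) := by
  subst h
  obtain ⟨ψ, hψ⟩ := H.exists_lift _ (toLoc (nz ((specSpaceMap φ).hom.base q)))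
    fun s hs => isUnit_toLoc (mem_nz_base.2 (H.mem_nz_of_mem hs))
  have hψ' : ∀ c, ψ.hom (φ.hom c) = (toLoc (nz ((specSpaceMap φ).hom.base q))).hom c := fun c =>
    congrArg (fun k : C ⟶ _ => k.hom c) hψ
  have hu : ∀ d ∈ nz q, IsUnit (ψ.hom d) := by
    intro d hd
    obtain ⟨c, s, hs, e⟩ := H.surj d
    have e' := congrArg ψ.hom e
    rw [map_mul, hψ', hψ'] at e'
    refine isUnit_of_mul_isUnit_left (y := (toLoc (nz ((specSpaceMap φ).hom.base q))).hom s) ?_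
    rw [e', isUnit_toLoc_nz_iff, mem_nz_base, ← e]
    exact mul_mem hd (H.mem_nz_of_mem hs)
  refine ⟨locLift ψ hu, loc_hom_ext ?_, loc_hom_ext (H.hom_ext ?_)⟩
  · rw [reassoc_of% toLoc_stalkMap, toLoc_locLift, hψ, Category.comp_id]
  · rw [reassoc_of% toLoc_locLift, reassoc_of% hψ, toLoc_stalkMap, Category.comp_id]

/-- Every `d` agrees, up to the image of an element of `S`, which is a unit, with the image of some
`c`; so `D(d)` is the preimage of `D(c)`. This gives injectivity and the induced topology. Openness
of the range is a hypothesis, since `S` is an arbitrary multiplicative subset. -/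
lemma isOpenEmbedding (hr : IsOpen (Set.range (specSpaceMap φ).hom.base)) :
    Topology.IsOpenEmbedding (specSpaceMap φ).hom.base := by
  have key : ∀ d : D, ∃ c : C, ∀ q : D.specSpace, d ∈ nz q ↔ c ∈ nz ((specSpaceMap φ).hom.base q) := by
    intro d
    obtain ⟨c, s, hs, e⟩ := H.surj d
    refine ⟨c, fun q => ?_⟩
    rw [mem_nz_base, ← e]
    exact ⟨fun hd => mul_mem hd (H.mem_nz_of_mem hs), mem_nz_of_mul⟩
  refine Topology.IsOpenEmbedding.of_continuous_injective_isOpenMap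
    (specSpaceMap φ).hom.base.hom.continuous ?_ ?_
  · intro q q' e
    refine specSpace_ext fun d => ?_
    obtain ⟨c, hc⟩ := key d
    rw [hc, hc, e]
  · intro O hO
    refine isOpen_iff_forall_mem_open.2 ?_
    rintro _ ⟨q, hq, rfl⟩
    obtain ⟨d, hd, hle⟩ := exists_basicOpen_le (U := ⟨O, hO⟩) hq
    obtain ⟨c, hc⟩ := key d
    refine ⟨(basicOpen c).1 ∩ Set.range (specSpaceMap φ).hom.base, ?_, (basicOpen c).2.inter hr,
      (hc q).1 hd, q, rfl⟩
    rintro _ ⟨hp, q', rfl⟩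
    exact ⟨q', hle ((hc q').2 hp), rfl⟩

lemma isOpenImmersion (hr : IsOpen (Set.range (specSpaceMap φ).hom.base)) :
    SheafedSpace.IsOpenImmersion (specSpaceMap φ) :=
  specSpaceMap_isOpenImmersion φ (H.isOpenEmbedding hr) H.isIso_stalkMap

end IsLocalizationHom

/-- For `a ∉ p` the morphism `C → C_p` factors through the localization at the powers of `a`, and
the maximal ideal of `C_p` pulls back to a preimage of `p`. -/
lemma range_toLoc_powers (a : C) :
    Set.range (specSpaceMap (toLoc (Submonoid.powers a))).hom.base = basicOpen a := by
  ext p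
  constructor
  · rintro ⟨q, rfl⟩
    exact mem_nz_base.2 ((isLocalizationHom_toLoc _).mem_nz_of_mem (Submonoid.mem_powers a))
  · intro hp
    have hu : ∀ s ∈ Submonoid.powers a, IsUnit ((toLoc (nz p)).hom s) := by
      rintro _ ⟨n, rfl⟩
      exact isUnit_toLoc (pow_mem (S := nz p) hp n)
    obtain ⟨q, hq⟩ := exists_base_of_hom p (locLift (toLoc (nz p)) hu)
    refine ⟨q, specSpace_ext fun c => ?_⟩
    rw [mem_nz_base, hq, ← comp_hom, toLoc_locLift, isUnit_toLoc_nz_iff]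

end Blueprint

/-! ### Affine neighbourhoods and open subschemes -/

namespace BlueScheme

open Blueprint BlueprintedSpace AlgebraicGeometry

/-- A basic open subset `D(a)` of an affine chart is itself affine, namely the spectrum of the
localization at the powers of `a`. -/
lemma exists_affine_le (X : BlueScheme.{u}) (U : Opens X.space) (x : X.space) (hx : x ∈ U) :
    ∃ (D : Blueprint.{u}) (j : D.specSpace ⟶ X.space), SheafedSpace.IsOpenImmersion j ∧
      x ∈ Set.range j.hom.base ∧ ∀ y, j.hom.base y ∈ U := by
  obtain ⟨C, j, hj, p, rfl⟩ := X.locallyAffine x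
  obtain ⟨a, ha, hle⟩ := exists_basicOpen_le (U := preim j U) hx
  have hr := range_toLoc_powers a
  have : SheafedSpace.IsOpenImmersion (specSpaceMap (toLoc (Submonoid.powers a))) :=
    (isLocalizationHom_toLoc _).isOpenImmersion (by rw [hr]; exact (basicOpen a).2)
  refine ⟨_, specSpaceMap (toLoc (Submonoid.powers a)) ≫ j, inferInstance, ?_, ?_⟩
  · have hp : p ∈ (basicOpen a : Set C.specSpace) := ha
    rw [← hr] at hp
    obtain ⟨q, rfl⟩ := hp
    exact ⟨q, rfl⟩
  · intro q
    refine apply_mem_of_mem_preim j _ (hle ?_)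
    have : (specSpaceMap (toLoc (Submonoid.powers a))).hom.base q ∈ (basicOpen a : Set C.specSpace) :=
      hr ▸ ⟨q, rfl⟩
    exact this

lemma exists_open_subscheme (X : BlueScheme.{u}) (U : Opens X.space) :
    ∃ (Y : BlueScheme.{u}) (u : Y ⟶ X), IsOpenImmersion u ∧ range u = U := by
  let u := X.space.ofRestrict U.isOpenEmbedding
  have hu : SheafedSpace.IsOpenImmersion u := inferInstance
  have hr : Set.range u.hom.base = U := Subtype.range_val
  let Y : BlueScheme.{u} := ⟨X.space.restrict U.isOpenEmbedding, by
    intro y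
    obtain ⟨D, j, hj, hy, hjU⟩ := X.exists_affine_le U (u.hom.base y) y.2
    obtain ⟨k, rfl⟩ := exists_lift u j (by rw [hr]; rintro _ ⟨x, rfl⟩; exact hjU x)
    refine ⟨D, k, isOpenImmersion_of_comp k u, ?_⟩
    obtain ⟨z, hz⟩ := hy
    exact ⟨z, injective u hz⟩⟩
  exact ⟨Y, ⟨u, isLocalHom_of_isOpenImmersion u⟩, hu, hr⟩

end BlueScheme

/-! ### Local constructions of morphisms and fibre products -/

namespace BlueScheme

open Blueprint BlueprintedSpace AlgebraicGeometry

variable {T X Y Z P : BlueScheme.{u}}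

lemma comp_toSpaceHom (f : X ⟶ Y) (g : Y ⟶ Z) : (f ≫ g).toSpaceHom = f.toSpaceHom ≫ g.toSpaceHom :=
  rfl

lemma hom_ext_space {f g : X ⟶ Y} (h : f.toSpaceHom = g.toSpaceHom) : f = g := Hom.ext h

lemma hom_ext_of_cover {f g : X ⟶ Y}
    (h : ∀ x : X, ∃ (W : BlueScheme.{u}) (j : W ⟶ X),
      IsOpenImmersion j ∧ x ∈ range j ∧ j ≫ f = j ≫ g) : f = g := by
  refine hom_ext_space (BlueprintedSpace.hom_ext_of_cover fun x => ?_)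
  obtain ⟨W, j, hj, hx, e⟩ := h x
  exact ⟨W.space, j.toSpaceHom, hj, hx, congrArg Hom.toSpaceHom e⟩

lemma exists_lift (j : Y ⟶ Z) (hj : IsOpenImmersion j) (f : X ⟶ Z)
    (h : range f ⊆ range j) : ∃ g : X ⟶ Y, g ≫ j = f := by
  have : SheafedSpace.IsOpenImmersion j.toSpaceHom := hj
  obtain ⟨g, hg⟩ := BlueprintedSpace.exists_lift j.toSpaceHom f.toSpaceHom h
  refine ⟨⟨g, isLocalHom_of_comp_openImmersion j.toSpaceHom g ?_⟩, hom_ext_space hg⟩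
  rw [hg]
  exact f.isLocalHom

lemma cancel_openImmersion (j : Y ⟶ Z) (hj : IsOpenImmersion j) {f g : X ⟶ Y}
    (h : f ≫ j = g ≫ j) : f = g :=
  have : SheafedSpace.IsOpenImmersion j.toSpaceHom := hj
  hom_ext_space (BlueprintedSpace.cancel_openImmersion j.toSpaceHom (congrArg Hom.toSpaceHom h))

lemma isOpenImmersion_comp {f : X ⟶ Y} {g : Y ⟶ Z} (hf : IsOpenImmersion f)
    (hg : IsOpenImmersion g) : IsOpenImmersion (f ≫ g) :=
  have : SheafedSpace.IsOpenImmersion f.toSpaceHom := hf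
  have : SheafedSpace.IsOpenImmersion g.toSpaceHom := hg
  SheafedSpace.IsOpenImmersion.comp f.toSpaceHom g.toSpaceHom

/-- Affine open immersions form a basis. -/
lemma exists_spec_le (X : BlueScheme.{u}) {s : Set X} (hs : IsOpen s) {x : X} (hx : x ∈ s) :
    ∃ (D : Blueprint.{u}) (j : Spec D ⟶ X), IsOpenImmersion j ∧ x ∈ range j ∧ range j ⊆ s := by
  obtain ⟨D, j, hj, hx, h⟩ := X.exists_affine_le ⟨s, hs⟩ x hx
  refine ⟨D, ⟨j, isLocalHom_of_isOpenImmersion j⟩, hj, hx, ?_⟩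
  rintro _ ⟨y, rfl⟩
  exact h y

lemma isOpen_range {j : X ⟶ Y} (hj : IsOpenImmersion j) : IsOpen (range j) :=
  have : SheafedSpace.IsOpenImmersion j.toSpaceHom := hj
  this.base_open.isOpen_range

/-- Gluing of locally defined morphisms that are characterised uniquely. -/
lemma exists_hom_of_local (Q : ∀ W : BlueScheme.{u}, (W ⟶ T) → (W ⟶ Z) → Prop)
    (hex : ∀ x : T, ∃ (W : BlueScheme.{u}) (j : W ⟶ T) (g : W ⟶ Z),
      IsOpenImmersion j ∧ x ∈ range j ∧ Q W j g)
    (hres : ∀ W j g, Q W j g → ∀ (W' : BlueScheme.{u}) (k : W' ⟶ W), Q W' (k ≫ j) (k ≫ g))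
    (huniq : ∀ W j g g', Q W j g → Q W j g' → g = g') :
    ∃ g : T ⟶ Z, ∀ x : T, ∃ (W : BlueScheme.{u}) (j : W ⟶ T),
      IsOpenImmersion j ∧ x ∈ range j ∧ Q W j (j ≫ g) := by
  choose W j g hj hx hQ using hex
  have hj' : ∀ x, SheafedSpace.IsOpenImmersion (j x).toSpaceHom := hj
  obtain ⟨f, hf⟩ := exists_hom_of_cover (fun x => (j x).toSpaceHom) (fun x => (g x).toSpaceHom)
    (fun x => ⟨x, hx x⟩) (by
      intro x x' y z e
      obtain ⟨D, v, hv, hyv, hvr⟩ := T.exists_spec_le ((isOpen_range (hj x)).inter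
        (isOpen_range (hj x'))) (x := (j x).toSpaceHom.hom.base y) ⟨⟨y, rfl⟩, ⟨z, e.symm⟩⟩
      obtain ⟨a, ha⟩ := exists_lift (j x) (hj x) v fun t ht => (hvr ht).1
      obtain ⟨b, hb⟩ := exists_lift (j x') (hj x') v fun t ht => (hvr ht).2
      refine ⟨_, a.toSpaceHom, b.toSpaceHom, ?_, ?_, ?_, ?_⟩
      · rw [← comp_toSpaceHom, ha]
        exact hv
      · obtain ⟨t, ht⟩ := hyv
        rw [← ha] at ht
        exact ⟨t, BlueprintedSpace.injective (j x).toSpaceHom ht⟩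
      · rw [← comp_toSpaceHom, ← comp_toSpaceHom, ha, hb]
      · rw [← comp_toSpaceHom, ← comp_toSpaceHom]
        refine congrArg Hom.toSpaceHom (huniq _ v _ _ ?_ ?_)
        · rw [← ha]; exact hres _ _ _ (hQ x) _ a
        · rw [← hb]; exact hres _ _ _ (hQ x') _ b)
  have hloc : IsLocalHom f := by
    intro U s x hxU hu
    have key : ∀ (i : T) (y : (W i).space) (hyU : f.hom.base ((j i).toSpaceHom.hom.base y) ∈ U),
        T.space.IsUnitAt (pullbackSection f s) ((j i).toSpaceHom.hom.base y) →
          Z.space.IsUnitAt s (f.hom.base ((j i).toSpaceHom.hom.base y)) := fun i y hyU hu =>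
      isLocalHom_of_comp (f := (j i).toSpaceHom) (g := f)
        (by rw [hf]; exact (g i).isLocalHom) U s y hyU hu
    obtain ⟨y, hy⟩ := hx x
    rw [← hy] at hxU hu ⊢
    exact key x y hxU hu
  refine ⟨⟨f, hloc⟩, fun x => ⟨W x, j x, hj x, hx x, ?_⟩⟩
  have e : j x ≫ ⟨f, hloc⟩ = g x := hom_ext_space (hf x)
  rw [e]
  exact hQ x

/-- Existence and uniqueness of lifts may be checked locally on the source `T`: local uniqueness
gives global uniqueness, and this makes the local lifts agree on intersections and glue. -/
lemma isPullback_of_local {p : P ⟶ X} {q : P ⟶ Y} {f : X ⟶ Z} {g : Y ⟶ Z} (comm : p ≫ f = q ≫ g)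
    (hex : ∀ (T : BlueScheme.{u}) (a : T ⟶ X) (b : T ⟶ Y), a ≫ f = b ≫ g → ∀ x : T,
      ∃ (W : BlueScheme.{u}) (j : W ⟶ T) (c : W ⟶ P), IsOpenImmersion j ∧ x ∈ range j ∧
        c ≫ p = j ≫ a ∧ c ≫ q = j ≫ b)
    (huniq : ∀ (T : BlueScheme.{u}) (c c' : T ⟶ P), c ≫ p = c' ≫ p → c ≫ q = c' ≫ q →
      ∀ x : T, ∃ (W : BlueScheme.{u}) (j : W ⟶ T), IsOpenImmersion j ∧ x ∈ range j ∧
        j ≫ c = j ≫ c') : IsPullback p q f g := by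
  have uniq : ∀ (T : BlueScheme.{u}) (c c' : T ⟶ P), c ≫ p = c' ≫ p → c ≫ q = c' ≫ q → c = c' :=
    fun T c c' h h' => hom_ext_of_cover (huniq T c c' h h')
  have ex : ∀ (T : BlueScheme.{u}) (a : T ⟶ X) (b : T ⟶ Y), a ≫ f = b ≫ g →
      ∃ c : T ⟶ P, c ≫ p = a ∧ c ≫ q = b := by
    intro T a b hab
    obtain ⟨c, hc⟩ := exists_hom_of_local (T := T) (Z := P)
      (fun W j c => c ≫ p = j ≫ a ∧ c ≫ q = j ≫ b) (hex T a b hab)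
      (fun W j c h W' k => by
        simp only [Category.assoc, h.1, h.2, and_self])
      (fun W j c c' h h' => uniq W c c' (h.1.trans h'.1.symm) (h.2.trans h'.2.symm))
    refine ⟨c, hom_ext_of_cover fun x => ?_, hom_ext_of_cover fun x => ?_⟩
    · obtain ⟨W, j, hj, hx, h, h'⟩ := hc x
      exact ⟨W, j, hj, hx, by rw [← Category.assoc, h]⟩
    · obtain ⟨W, j, hj, hx, h, h'⟩ := hc x
      exact ⟨W, j, hj, hx, by rw [← Category.assoc, h']⟩
  refine ⟨⟨comm⟩, ⟨Limits.PullbackCone.IsLimit.mk _ (fun s => (ex _ s.fst s.snd s.condition).choose)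
    (fun s => (ex _ s.fst s.snd s.condition).choose_spec.1)
    (fun s => (ex _ s.fst s.snd s.condition).choose_spec.2) fun s m h h' => ?_⟩⟩
  exact uniq _ _ _ (h.trans (ex _ s.fst s.snd s.condition).choose_spec.1.symm)
    (h'.trans (ex _ s.fst s.snd s.condition).choose_spec.2.symm)

lemma exists_spec_cover (T : BlueScheme.{u}) (x : T) :
    ∃ (D : Blueprint.{u}) (j : Spec D ⟶ T), IsOpenImmersion j ∧ x ∈ range j := by
  obtain ⟨D, j, hj, hx, -⟩ := T.exists_spec_le isOpen_univ (Set.mem_univ x)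
  exact ⟨D, j, hj, hx⟩

/-- Open immersions are stable under base change. -/
lemma isOpenImmersion_of_isPullback {p : P ⟶ X} {q : P ⟶ Y} {f : X ⟶ Z} {g : Y ⟶ Z}
    (H : IsPullback p q f g) (hg : IsOpenImmersion g) :
    IsOpenImmersion p ∧ ∀ x : X, x ∈ range p ↔ f.toSpaceHom.hom.base x ∈ range g := by
  have hr : range p ⊆ f.toSpaceHom.hom.base ⁻¹' range g := by
    rintro _ ⟨x, rfl⟩
    have := congrArg (fun k : P ⟶ Z => k.toSpaceHom.hom.base x) H.w
    exact ⟨_, this.symm⟩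
  -- The open subscheme on the preimage of the range of `g` maps to `P` by the universal property,
  -- and `P` maps to it since `p` has image in it. The two morphisms are inverse to each other.
  obtain ⟨U, u, hu, hru⟩ := X.exists_open_subscheme
    ⟨_, (isOpen_range hg).preimage f.toSpaceHom.hom.base.hom.continuous⟩
  have hru' : range u = f.toSpaceHom.hom.base ⁻¹' range g := hru
  obtain ⟨v, hv⟩ := exists_lift g hg (u ≫ f) (by
    rintro _ ⟨x, rfl⟩
    have : u.toSpaceHom.hom.base x ∈ range u := ⟨x, rfl⟩
    rw [hru'] at this
    exact this)
  obtain ⟨l, hl⟩ := exists_lift u hu p (by rw [hru']; exact hr)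
  obtain ⟨m, hm, hm'⟩ := H.exists_lift u v hv.symm
  have h1 : m ≫ l = 𝟙 U := cancel_openImmersion u hu (by rw [Category.assoc, hl, hm, Category.id_comp])
  have h2 : l ≫ m = 𝟙 P := H.hom_ext (by rw [Category.assoc, hm, hl, Category.id_comp])
    (cancel_openImmersion g hg (by
      rw [Category.assoc, Category.assoc, reassoc_of% hm', hv, ← Category.assoc l u f, hl, Category.id_comp, H.w]))
  have hl' : IsOpenImmersion l := by
    have : IsIso l.toSpaceHom :=
      ⟨m.toSpaceHom, congrArg Hom.toSpaceHom h2, congrArg Hom.toSpaceHom h1⟩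
    exact inferInstanceAs (SheafedSpace.IsOpenImmersion l.toSpaceHom)
  refine ⟨hl ▸ isOpenImmersion_comp hl' hu, fun x => ⟨fun h => hr h, fun h => ?_⟩⟩
  obtain ⟨y, rfl⟩ : x ∈ range u := hru' ▸ h
  exact ⟨m.toSpaceHom.hom.base y, congrArg (fun k : U ⟶ X => k.toSpaceHom.hom.base y) hm⟩

end BlueScheme

/-! ### The universal property of monoid blueprints -/

namespace Blueprint

variable {B C E : Blueprint.{u}} {M N : Type u} [CommMonoidWithZero M] [CommMonoidWithZero N]

lemma fOne_hom_ext (f g : fOne.{u} ⟶ E) : f = g := by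
  refine hom_ext fun b => ?_
  induction b using WithZero.recZeroCoe with
  | zero => exact (map_zero f.hom).trans (map_zero g.hom).symm
  | coe b => exact (map_one f.hom).trans (map_one g.hom).symm

/-- The canonical map `M → B[M]`, `m ↦ 1 ∧ m`. -/
def ofMonoid (B : Blueprint.{u}) (M : Type u) [CommMonoidWithZero M] :
    M →*₀ B.monoidBlueprint M where
  toFun m := Smash.mk (1, m)
  map_zero' := (Smash.mk_eq_zero_iff _).2 (Or.inr rfl)
  map_one' := map_one Smash.mk
  map_mul' m n := by
    refine Eq.trans ?_ (map_mul Smash.mk ((1 : B), m) (1, n))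
    rw [Prod.mk_mul_mk, one_mul]

lemma mk_eq_mul (b : B) (m : M) : (Smash.mk (b, m) : B.monoidBlueprint M) =
    (B.toMonoidBlueprint M).hom b * B.ofMonoid M m := by
  refine Eq.trans ?_ (map_mul Smash.mk (b, (1 : M)) ((1 : B), m))
  rw [Prod.mk_mul_mk, one_mul, mul_one]

lemma exists_eq_mul (x : B.monoidBlueprint M) :
    ∃ (b : B) (m : M), x = (B.toMonoidBlueprint M).hom b * B.ofMonoid M m := by
  obtain ⟨⟨b, m⟩, rfl⟩ := Smash.mk_surjective x
  exact ⟨b, m, mk_eq_mul b m⟩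

lemma monoidBlueprint_hom_ext {f g : B.monoidBlueprint M ⟶ E}
    (h : B.toMonoidBlueprint M ≫ f = B.toMonoidBlueprint M ≫ g)
    (h' : ∀ m, f.hom (B.ofMonoid M m) = g.hom (B.ofMonoid M m)) : f = g := by
  refine hom_ext fun x => ?_
  obtain ⟨b, m, rfl⟩ := exists_eq_mul x
  have e : f.hom ((B.toMonoidBlueprint M).hom b) = g.hom ((B.toMonoidBlueprint M).hom b) :=
    congrArg (fun k : B ⟶ E => k.hom b) h
  rw [map_mul, map_mul, h', e]

/-- The map underlying `monoidBlueprintLift`. -/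
def monoidBlueprintLiftHom (β : B ⟶ E) (m : M →*₀ E) : Smash B M →*₀ E :=
  Smash.lift
    { toFun := fun p => β.hom p.1 * m p.2
      map_one' := by rw [Prod.fst_one, Prod.snd_one, map_one, map_one, one_mul]
      map_mul' := fun p q => by
        rw [Prod.fst_mul, Prod.snd_mul, map_mul, map_mul, mul_mul_mul_comm] }
    (by
      rintro ⟨b, n⟩ (h | h)
      · have h : b = 0 := h
        change β.hom b * m n = 0
        rw [h, map_zero, zero_mul]
      · have h : n = 0 := h
        change β.hom b * m n = 0
        rw [h, map_zero, mul_zero])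

/-- The morphism `B[M] → E` given by `B → E` and a morphism of monoids `M → E`. -/
def monoidBlueprintLift (β : B ⟶ E) (m : M →*₀ E) : B.monoidBlueprint M ⟶ E where
  hom := monoidBlueprintLiftHom β m
  map_rel x y h := by
    have hle : ringConGen (B.monoidGen M) ≤
        E.rel.comap (mapSum (monoidBlueprintLiftHom β m)) := by
      rw [RingCon.ringConGen_le]
      rintro _ _ ⟨x, y, h, rfl, rfl⟩
      have e : (monoidBlueprintLiftHom β m).comp (Smash.inl B M) = β.hom := by
        ext b
        change β.hom b * m 1 = _
        rw [map_one, mul_one]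
      rw [RingCon.comap_rel, ← mapSum_comp, ← mapSum_comp, e]
      exact β.map_rel x y h
    exact hle h

lemma toMonoidBlueprint_lift (β : B ⟶ E) (m : M →*₀ E) :
    B.toMonoidBlueprint M ≫ monoidBlueprintLift β m = β := by
  refine hom_ext fun b => ?_
  change β.hom b * m 1 = _
  rw [map_one, mul_one]

lemma monoidBlueprintLift_ofMonoid (β : B ⟶ E) (m : M →*₀ E) (n : M) :
    (monoidBlueprintLift β m).hom (B.ofMonoid M n) = m n := by
  change β.hom 1 * m n = _
  rw [map_one, one_mul]

lemma toMonoidBlueprint_map (f : M →*₀ N) :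
    B.toMonoidBlueprint M ≫ B.monoidBlueprintMap f = B.toMonoidBlueprint N := by
  refine hom_ext fun b => ?_
  change Smash.mk (b, f 1) = Smash.mk (b, 1)
  rw [map_one]

lemma monoidBlueprintMap_ofMonoid (f : M →*₀ N) (m : M) :
    (B.monoidBlueprintMap f).hom (B.ofMonoid M m) = B.ofMonoid N (f m) := rfl

/-- The base change morphism `𝔽₁[M] → B[M]`. -/
def baseChange (B : Blueprint.{u}) (M : Type u) [CommMonoidWithZero M] :
    fOne.{u}.monoidBlueprint M ⟶ B.monoidBlueprint M :=
  monoidBlueprintLift (fromFOne _) (B.ofMonoid M)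

lemma baseChange_ofMonoid (m : M) :
    (B.baseChange M).hom (fOne.ofMonoid M m) = B.ofMonoid M m :=
  monoidBlueprintLift_ofMonoid _ _ _

/-- Every element of `𝔽₁[M]` is of the form `1 ∧ m`. -/
lemma ofMonoid_fOne_surjective : Function.Surjective (fOne.{u}.ofMonoid M) := by
  intro x
  obtain ⟨b, m, rfl⟩ := exists_eq_mul x
  induction b using WithZero.recZeroCoe with
  | zero => exact ⟨0, by rw [map_zero]; exact ((congrArg (· * _) (map_zero _)).trans (zero_mul _)).symm⟩
  | coe b => exact ⟨m, ((congrArg (· * _) (map_one _)).trans (one_mul _)).symm⟩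

lemma monoidBlueprintMap_baseChange (f : M →*₀ N) :
    fOne.monoidBlueprintMap f ≫ B.baseChange N = B.baseChange M ≫ B.monoidBlueprintMap f := by
  refine monoidBlueprint_hom_ext (fOne_hom_ext _ _) fun m => ?_
  rw [comp_hom, comp_hom, monoidBlueprintMap_ofMonoid, baseChange_ofMonoid, baseChange_ofMonoid,
    monoidBlueprintMap_ofMonoid]

/-- `B[M]` is the pushout of `B` and `𝔽₁[M]` over `𝔽₁`. -/
lemma isPushout_monoidBlueprint (B : Blueprint.{u}) (M : Type u) [CommMonoidWithZero M] :
    IsPushout (fOne.toMonoidBlueprint M) (fromFOne B) (B.baseChange M) (B.toMonoidBlueprint M) :=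
  ⟨⟨fOne_hom_ext _ _⟩, ⟨Limits.PushoutCocone.IsColimit.mk _
    (fun s => monoidBlueprintLift s.inr (s.inl.hom.comp (fOne.ofMonoid M)))
    (fun s => monoidBlueprint_hom_ext (fOne_hom_ext _ _) fun m => by
      rw [comp_hom, baseChange_ofMonoid, monoidBlueprintLift_ofMonoid]
      rfl)
    (fun s => toMonoidBlueprint_lift _ _)
    (fun s m h h' => monoidBlueprint_hom_ext (h'.trans (toMonoidBlueprint_lift _ _).symm)
      fun n => by
        rw [monoidBlueprintLift_ofMonoid, ← baseChange_ofMonoid]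
        exact congrArg (fun k : fOne.monoidBlueprint M ⟶ s.pt => k.hom (fOne.ofMonoid M n)) h)⟩⟩

end Blueprint

/-! ### Fibre products of spectra and base change of monoidal schemes -/

namespace BlueScheme

open Blueprint BlueprintedSpace

variable {A B C D : Blueprint.{u}}

lemma specMap_comp (f : B ⟶ C) (g : C ⟶ D) : specMap (f ≫ g) = specMap g ≫ specMap f := by
  refine hom_ext_space (spec_hom_ext (specSpaceMap_isLocalHom _)
    (isLocalHom_comp _ _ (specSpaceMap_isLocalHom g) (specSpaceMap_isLocalHom f)) ?_)
  have h : globalHom (specSpaceMap (f ≫ g)) = globalHom (𝟙 _ ≫ specSpaceMap (f ≫ g)) := by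
    rw [Category.id_comp]
  have h' : globalHom (specSpaceMap g ≫ specSpaceMap f) =
    globalHom ((𝟙 _ ≫ specSpaceMap g) ≫ specSpaceMap f) := by rw [Category.id_comp]
  refine h.trans (Eq.trans ?_ h'.symm)
  rw [globalHom_comp_specSpaceMap, globalHom_comp_specSpaceMap, globalHom_comp_specSpaceMap,
    Category.assoc]

/-- `Spec` turns pushouts of blueprints into fibre products of blue schemes. -/
lemma isPullback_spec {f : A ⟶ B} {g : A ⟶ C} {h : B ⟶ D} {i : C ⟶ D} (H : IsPushout f g h i) :
    IsPullback (specMap h) (specMap i) (specMap f) (specMap g) := by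
  refine isPullback_of_local (by rw [← specMap_comp, ← specMap_comp, H.w]) ?_ ?_
  · intro T a b hab x
    -- Locally the source is `Spec D'`, where morphisms to spectra are morphisms into the blueprint
    -- `Γ(Spec D')`. The universal property of the pushout then supplies the lift.
    obtain ⟨D', j, hj, hx⟩ := T.exists_spec_cover x
    let a' : D'.specSpace ⟶ B.specSpace := (j ≫ a).toSpaceHom
    let b' : D'.specSpace ⟶ C.specSpace := (j ≫ b).toSpaceHom
    have hab' : a' ≫ specSpaceMap f = b' ≫ specSpaceMap g :=
      congrArg (fun k : T ⟶ Spec A => (j ≫ k).toSpaceHom) hab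
    have e := congrArg globalHom hab'
    rw [globalHom_comp_specSpaceMap, globalHom_comp_specSpaceMap] at e
    obtain ⟨c, hc, ec⟩ := exists_spec_hom (H.desc _ _ e)
    refine ⟨Spec D', j, ⟨c, hc⟩, hj, hx, hom_ext_space ?_, hom_ext_space ?_⟩
    · refine spec_hom_ext (isLocalHom_comp _ _ hc (specSpaceMap_isLocalHom h)) (j ≫ a).isLocalHom ?_
      refine (globalHom_comp_specSpaceMap c h).trans ?_
      rw [ec, H.inl_desc]
    · refine spec_hom_ext (isLocalHom_comp _ _ hc (specSpaceMap_isLocalHom i)) (j ≫ b).isLocalHom ?_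
      refine (globalHom_comp_specSpaceMap c i).trans ?_
      rw [ec, H.inr_desc]
  · intro T c c' hc hc' x
    obtain ⟨D', j, hj, hx⟩ := T.exists_spec_cover x
    refine ⟨Spec D', j, hj, hx, hom_ext_space ?_⟩
    let d : D'.specSpace ⟶ D.specSpace := (j ≫ c).toSpaceHom
    let d' : D'.specSpace ⟶ D.specSpace := (j ≫ c').toSpaceHom
    have h1 : d ≫ specSpaceMap h = d' ≫ specSpaceMap h :=
      congrArg (fun k : T ⟶ Spec B => (j ≫ k).toSpaceHom) hc
    have h2 : d ≫ specSpaceMap i = d' ≫ specSpaceMap i :=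
      congrArg (fun k : T ⟶ Spec C => (j ≫ k).toSpaceHom) hc'
    refine spec_hom_ext (f := d) (g := d') (j ≫ c).isLocalHom (j ≫ c').isLocalHom
      (H.hom_ext ?_ ?_)
    · rw [← globalHom_comp_specSpaceMap, ← globalHom_comp_specSpaceMap, h1]
    · rw [← globalHom_comp_specSpaceMap, ← globalHom_comp_specSpaceMap, h2]

/-- `Spec B[M]` is the fibre product of `Spec 𝔽₁[M]` and `Spec B` over `Spec 𝔽₁`. -/
lemma isPullback_spec_monoidBlueprint (B : Blueprint.{u}) (M : Type u) [CommMonoidWithZero M] :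
    IsPullback (specMap (B.baseChange M)) (specMap (B.toMonoidBlueprint M))
      (specMap (fOne.toMonoidBlueprint M)) (specMap (fromFOne B)) :=
  isPullback_spec (isPushout_monoidBlueprint B M)

/-- `Spec 𝔽₁` is terminal. -/
lemma hom_spec_fOne_ext {T : BlueScheme.{u}} (f g : T ⟶ Spec fOne.{u}) : f = g := by
  refine hom_ext_of_cover fun x => ?_
  obtain ⟨D, j, hj, hx⟩ := T.exists_spec_cover x
  exact ⟨Spec D, j, hj, hx, hom_ext_space
    (spec_hom_ext (j ≫ f).isLocalHom (j ≫ g).isLocalHom (fOne_hom_ext _ _))⟩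

lemma nonempty_hom_spec_fOne (T : BlueScheme.{u}) : Nonempty (T ⟶ Spec fOne.{u}) := by
  obtain ⟨g, -⟩ := exists_hom_of_local (T := T) (Z := Spec fOne.{u}) (fun _ _ _ => True)
    (fun x => by
      obtain ⟨D, j, hj, hx⟩ := T.exists_spec_cover x
      exact ⟨Spec D, j, specMap (fromFOne D), hj, hx, trivial⟩)
    (fun _ _ _ _ _ _ => trivial) (fun _ _ _ _ _ _ => hom_spec_fOne_ext _ _)
  exact ⟨g⟩

/-- Base change of a monoidal scheme over `𝔽₁` is monoidal. -/
lemma isMonoidalOver_of_isPullback {X X₁ : BlueScheme.{u}} {π : X ⟶ Spec B}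
    {π₁ : X₁ ⟶ Spec fOne.{u}} (h : IsMonoidalOver fOne.{u} π₁) {p : X ⟶ X₁}
    (H : IsPullback p π π₁ (specMap (fromFOne B))) : IsMonoidalOver B π := by
  obtain ⟨c⟩ := h
  let _ := c.str
  have hex : ∀ i, ∃ u : Spec (B.monoidBlueprint (c.M i)) ⟶ X,
      u ≫ p = specMap (B.baseChange (c.M i)) ≫ c.chart i ∧
        u ≫ π = specMap (B.toMonoidBlueprint (c.M i)) := fun i =>
    H.exists_lift (specMap (B.baseChange (c.M i)) ≫ c.chart i)
      (specMap (B.toMonoidBlueprint (c.M i))) (by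
      rw [Category.assoc, c.chart_over]
      exact (isPullback_spec_monoidBlueprint B (c.M i)).w)
  choose u hu hu' using hex
  -- Pasting: the rectangle with corners `Spec B[Mᵢ]`, `Spec 𝔽₁[Mᵢ]`, `Spec B`, `Spec 𝔽₁` is
  -- cartesian, and so is `H`. Hence `u i` is the base change of the chart of `X₁` along `p`.
  have hP : ∀ i, IsPullback (specMap (B.baseChange (c.M i))) (u i) (c.chart i) p := fun i => by
    refine (IsPullback.of_right (t := H.flip) ?_ (hu i)).flip
    rw [hu', c.chart_over]
    exact (isPullback_spec_monoidBlueprint B (c.M i)).flip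
  have hO := fun i => isOpenImmersion_of_isPullback (hP i).flip (c.isOpenImmersion i)
  refine ⟨⟨c.ι, c.M, u, fun i => (hO i).1, hu', fun x => ?_, fun i k x hi hk => ?_⟩⟩
  · obtain ⟨i, hi⟩ := c.covers (p.toSpaceHom.hom.base x)
    exact ⟨i, ((hO i).2 x).2 hi⟩
  · obtain ⟨N, _, v, f, S, g, T, hv, hx, hf, hvf, hg, hvg⟩ :=
      c.overlap i k _ (((hO i).2 x).1 hi) (((hO k).2 x).1 hk)
    have hvπ : v ≫ π₁ = specMap (fOne.toMonoidBlueprint N) := hom_spec_fOne_ext _ _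
    have key : ∀ (l : c.ι) (f : c.M l →*₀ N), v = specMap (fOne.monoidBlueprintMap f) ≫ c.chart l →
        (specMap (B.monoidBlueprintMap f) ≫ u l) ≫ p = specMap (B.baseChange N) ≫ v ∧
        (specMap (B.monoidBlueprintMap f) ≫ u l) ≫ π = specMap (B.toMonoidBlueprint N) := by
      intro l f e
      constructor
      · rw [Category.assoc, hu, e, ← Category.assoc, ← Category.assoc, ← specMap_comp,
          ← specMap_comp, monoidBlueprintMap_baseChange]
      · rw [Category.assoc, hu', ← specMap_comp, toMonoidBlueprint_map]
    obtain ⟨h1, h2⟩ := key i f hvf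
    obtain ⟨h3, h4⟩ := key k g hvg
    have hPv : IsPullback (specMap (B.baseChange N)) (specMap (B.monoidBlueprintMap f) ≫ u i)
        v p := by
      refine (IsPullback.of_right (t := H.flip) ?_ h1).flip
      rw [h2, hvπ]
      exact (isPullback_spec_monoidBlueprint B N).flip
    obtain ⟨hw, hr⟩ := isOpenImmersion_of_isPullback hPv.flip hv
    -- The overlap in `X` is defined through `f`. That `g` gives the same morphism follows from
    -- uniqueness in the fibre product `X`, since both have the same components.
    exact ⟨N, _, _, f, S, g, T, hw, (hr x).2 hx, hf, rfl, hg,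
      H.hom_ext (h1.trans h3.symm) (h2.trans h4.symm)⟩

end BlueScheme

/-! ### Points and stalks of `Spec B[M]` -/

namespace Blueprint

open BlueprintedSpace

variable {B C E : Blueprint.{u}} {M N : Type u} [CommMonoidWithZero M] [CommMonoidWithZero N]

lemma mul_mem_nz_iff {p : B.specSpace} {a b : B} : a * b ∈ nz p ↔ a ∈ nz p ∧ b ∈ nz p :=
  ⟨fun h => ⟨mem_nz_of_mul h, mem_nz_of_mul (mul_comm a b ▸ h)⟩, fun h => mul_mem h.1 h.2⟩

/-- A product lies outside a prime exactly when both factors do. Membership in a prime of `B[M]`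
thus splits into one condition on `b` and one on `m`, so that the prime is determined by its
contractions to `B` and `𝔽₁[M]`. -/
lemma mk_mem_nz_iff {P : (B.monoidBlueprint M).specSpace} {b : B} {m : M} :
    (B.toMonoidBlueprint M).hom b * B.ofMonoid M m ∈ nz P ↔
      b ∈ nz ((specSpaceMap (B.toMonoidBlueprint M)).hom.base P) ∧
        fOne.ofMonoid M m ∈ nz ((specSpaceMap (B.baseChange M)).hom.base P) := by
  rw [mem_nz_base, mem_nz_base, baseChange_ofMonoid, mul_mem_nz_iff]

lemma monoidBlueprint_point_ext {P P' : (B.monoidBlueprint M).specSpace}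
    (h : (specSpaceMap (B.toMonoidBlueprint M)).hom.base P =
      (specSpaceMap (B.toMonoidBlueprint M)).hom.base P')
    (h' : (specSpaceMap (B.baseChange M)).hom.base P =
      (specSpaceMap (B.baseChange M)).hom.base P') : P = P' := by
  refine specSpace_ext fun x => ?_
  obtain ⟨b, m, rfl⟩ := exists_eq_mul x
  rw [mk_mem_nz_iff, mk_mem_nz_iff, h, h']

/-- The coefficient at `n ∉ p` of a sum of elements of the ideal of `(q, p)` lies in `q⁺`. -/
lemma exists_coeff_eq (q : B.PrimeIdeal) {I : Set (B.monoidBlueprint M)} {n : M}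
    (hI : ∀ b : B, (B.toMonoidBlueprint M).hom b * B.ofMonoid M n ∈ I → b ∈ q.asSet)
    (z : MonoidAlgebra ℕ (B.monoidBlueprint M)) (hz : ∀ a ∈ z.coeff.support, a ∈ I) :
    ∃ Z : MonoidAlgebra B.Plus M, evalSum (B.smashToPlusMonoid M) z = B.mkPlusMonoid M Z ∧
      ∃ w : MonoidAlgebra ℕ B, (∀ b ∈ w.coeff.support, b ∈ q.asSet) ∧
        Z.coeff n = B.mkPlus w := by
  refine sum_induction_on (P := fun z => ∃ Z : MonoidAlgebra B.Plus M,
    evalSum (B.smashToPlusMonoid M) z = B.mkPlusMonoid M Z ∧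
      ∃ w : MonoidAlgebra ℕ B, (∀ b ∈ w.coeff.support, b ∈ q.asSet) ∧
        Z.coeff n = B.mkPlus w) z hz ?_ ?_ ?_
  · exact ⟨0, by rw [map_zero, map_zero], 0, by simp, by simp⟩
  · rintro y z ⟨Y, hY, v, hv, eY⟩ ⟨Z, hZ, w, hw, eZ⟩
    exact ⟨Y + Z, by rw [map_add, map_add, hY, hZ], v + w, support_add hv hw, by
      rw [map_add, ← eY, ← eZ]; rfl⟩
  · intro a ha k
    obtain ⟨b, m, rfl⟩ := exists_eq_mul a
    refine ⟨k • MonoidAlgebra.single m (B.toPlus b), ?_, ?_⟩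
    · rw [← mk_eq_mul]
      have : (MonoidAlgebra.single (Smash.mk (b, m)) k : MonoidAlgebra ℕ (Smash B M)) =
          k • MonoidAlgebra.single (Smash.mk (b, m)) 1 := by simp
      refine (congrArg (evalSum (B.smashToPlusMonoid M)) this).trans ?_
      rw [map_nsmul, map_nsmul, evalSum_single]
      rfl
    · by_cases hmn : m = n
      · subst hmn
        refine ⟨MonoidAlgebra.single b k, support_single (hI b ha) k, ?_⟩
        have : (MonoidAlgebra.single b k : MonoidAlgebra ℕ B) = k • MonoidAlgebra.single b 1 := by
          simp
        rw [this, map_nsmul]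
        simp [MonoidAlgebra.coeff_single]
        rfl
      · exact ⟨0, by simp, by simp [MonoidAlgebra.coeff_single, Finsupp.single_eq_of_ne' hmn]⟩

/-- The prime over `(q, p)` is the complement of the set `J` of all `b ∧ m` with `b ∉ q` and `m ∉
p`. Closure under sums is the only real point: a relation in `B[M]` is mapped to `B⁺[M]`, and its
coefficients at the exponent `n` of the element in question give a relation in `B` that violates the
ideal property of `q`. -/
lemma exists_monoidBlueprint_point (q : B.specSpace) (p : (fOne.{u}.monoidBlueprint M).specSpace) :
    ∃ P : (B.monoidBlueprint M).specSpace, (specSpaceMap (B.toMonoidBlueprint M)).hom.base P = q ∧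
      (specSpaceMap (B.baseChange M)).hom.base P = p := by
  let J : Set (B.monoidBlueprint M) := {x | ∃ (b : B) (m : M),
    x = (B.toMonoidBlueprint M).hom b * B.ofMonoid M m ∧ b ∈ nz q ∧ fOne.ofMonoid M m ∈ nz p}
  have ne_zero : ∀ m : M, fOne.ofMonoid M m ∈ nz p → m ≠ 0 := by
    rintro m hm rfl
    rw [map_zero] at hm
    exact zero_notMem_nz p hm
  have ne_zero' : ∀ b : B, b ∈ nz q → b ≠ 0 := by
    rintro _ hb rfl
    exact zero_notMem_nz q hb
  have mem_iff : ∀ (b : B) (m : M), (B.toMonoidBlueprint M).hom b * B.ofMonoid M m ∈ J ↔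
      b ∈ nz q ∧ fOne.ofMonoid M m ∈ nz p := by
    refine fun b m => ⟨?_, fun h => ⟨b, m, rfl, h⟩⟩
    rintro ⟨b', m', e, hb, hm⟩
    rw [← mk_eq_mul, ← mk_eq_mul] at e
    rcases (Smash.mk_eq_iff _ _).1 e with e | ⟨-, h | h⟩
    · obtain ⟨rfl, rfl⟩ := Prod.mk.inj e
      exact ⟨hb, hm⟩
    · exact absurd h (ne_zero' _ hb)
    · exact absurd h (ne_zero _ hm)
  have mul_iff : ∀ x y : B.monoidBlueprint M, x * y ∈ J ↔ x ∈ J ∧ y ∈ J := by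
    intro x y
    obtain ⟨b, m, rfl⟩ := exists_eq_mul x
    obtain ⟨c, n, rfl⟩ := exists_eq_mul y
    rw [mul_mul_mul_comm, ← map_mul, ← map_mul, mem_iff, mem_iff, mem_iff, map_mul,
      mul_mem_nz_iff, mul_mem_nz_iff]
    tauto
  have hone : (1 : B.monoidBlueprint M) ∈ J :=
    ⟨1, 1, by rw [map_one, map_one, one_mul], one_mem _, by rw [map_one]; exact one_mem _⟩
  let P : (B.monoidBlueprint M).PrimeIdeal :=
    { asSet := Jᶜ
      one_notMem := fun h => h hone
      mem_or_mem := fun a b h => by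
        by_contra! h'
        exact h ((mul_iff a b).2 ⟨not_not.1 h'.1, not_not.1 h'.2⟩)
      isIdeal :=
        { mul_mem := fun a b hb h => hb ((mul_iff a b).1 h).2
          sum_mem := by
            rintro x y _ hx hy h ⟨b, n, rfl, hb, hn⟩
            have hI : ∀ b : B, (B.toMonoidBlueprint M).hom b * B.ofMonoid M n ∈ Jᶜ →
                b ∈ PrimeIdeal.asSet q := by
              intro b hb
              by_contra hb'
              exact hb ((mem_iff b n).2 ⟨hb', hn⟩)
            obtain ⟨X, hX, v, hv, eX⟩ := exists_coeff_eq q hI x hx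
            obtain ⟨Y, hY, w, hw, eY⟩ := exists_coeff_eq q hI y hy
            have h' : evalSum (B.smashToPlusMonoid M) _ = evalSum (B.smashToPlusMonoid M) _ :=
              B.monoidGen_le_ker M h
            rw [← mk_eq_mul] at h'
            have hs : evalSum (B.smashToPlusMonoid M) (MonoidAlgebra.single (Smash.mk (b, n)) 1) =
              B.mkPlusMonoid M (MonoidAlgebra.single n (B.toPlus b)) := evalSum_single _ _
            have h'' := ((map_add _ _ _).symm.trans h').trans hY
            have e3 : B.mkPlusMonoid M (X + MonoidAlgebra.single n (B.toPlus b)) =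
                B.mkPlusMonoid M Y := by
              rw [map_add, ← hX, ← hs]
              exact h''
            -- The two sides agree only up to multiples of the zero of `M`. Such multiples have no
            -- coefficient at `n`, as `n ≠ 0`.
            obtain ⟨c, d, e⟩ := (B.mkPlusMonoid_eq_iff M _ _).1 e3
            have e' := congrArg (fun z : MonoidAlgebra B.Plus M => z.coeff n) e
            simp only [MonoidAlgebra.coeff_add, MonoidAlgebra.coeff_single, Finsupp.add_apply,
              Finsupp.single_eq_same, Finsupp.single_eq_of_ne (ne_zero n hn), add_zero,
              eX, eY] at e'
            have e4 : B.mkPlus (v + MonoidAlgebra.single b 1) = B.mkPlus w := by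
              rw [map_add]
              exact e'
            exact hb ((PrimeIdeal.isIdeal q).sum_mem v w b hv hw ((B.mkPlus_eq_iff _ _).1 e4)) } }
  obtain ⟨P, hP⟩ : ∃ P : (B.monoidBlueprint M).specSpace, ∀ x, x ∈ nz P ↔ x ∈ J :=
    ⟨P, fun x => not_not⟩
  refine ⟨P, specSpace_ext fun b => ?_, specSpace_ext fun x => ?_⟩
  · rw [mem_nz_base, hP]
    have := mem_iff b 1
    rw [map_one, map_one, mul_one] at this
    rw [this]
    exact ⟨fun h => h.1, fun h => ⟨h, one_mem _⟩⟩
  · obtain ⟨m, rfl⟩ := ofMonoid_fOne_surjective x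
    rw [mem_nz_base, hP, baseChange_ofMonoid]
    have := mem_iff 1 m
    rw [map_one, one_mul] at this
    rw [this]
    exact ⟨fun h => h.2, fun h => ⟨one_mem _, h⟩⟩

/-- An equality of fractions in the stalk of `B[M]` is witnessed by some `c ∧ k` outside the prime;
in particular `c ≠ 0`. Comparing second coordinates in the smash product then gives an equality in
`M` with witness `k`, which lies outside `p`. -/
lemma stalkMap_baseChange_injective (p : (fOne.{u}.monoidBlueprint M).specSpace)
    (P : (B.monoidBlueprint M).specSpace) (h : (specSpaceMap (B.baseChange M)).hom.base P = p) :
    Function.Injective (stalkMap (B.baseChange M) p P h).hom := by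
  intro x y e
  obtain ⟨a, ⟨s, hs⟩, rfl⟩ := frac_surj x
  obtain ⟨b, ⟨t, ht⟩, rfl⟩ := frac_surj y
  obtain ⟨a, rfl⟩ := ofMonoid_fOne_surjective a
  obtain ⟨b, rfl⟩ := ofMonoid_fOne_surjective b
  obtain ⟨s, rfl⟩ := ofMonoid_fOne_surjective s
  obtain ⟨t, rfl⟩ := ofMonoid_fOne_surjective t
  rw [stalkMap_frac, stalkMap_frac, frac_eq_iff] at e
  obtain ⟨⟨c, hc⟩, e⟩ := e
  obtain ⟨c, k, rfl⟩ := exists_eq_mul c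
  rw [mk_mem_nz_iff] at hc
  simp only [baseChange_ofMonoid] at e
  rw [mul_assoc, mul_assoc, ← map_mul, ← map_mul, ← map_mul, ← map_mul, ← mk_eq_mul,
    ← mk_eq_mul] at e
  replace e := (Smash.mk_eq_iff _ _).1 e
  have hc0 : c ≠ 0 := by
    intro h0
    rw [h0] at hc
    exact zero_notMem_nz _ hc.1
  -- Either the two pairs agree, or both sides are zero in the smash product; in the latter case
  -- both second coordinates vanish because `c ≠ 0`.
  have e' : k * (t * a) = k * (s * b) := by
    rcases e with e | ⟨h1 | h1, h2 | h2⟩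
    · exact (Prod.mk.inj e).2
    · exact absurd h1 hc0
    · exact absurd h1 hc0
    · exact absurd h2 hc0
    · exact h1.trans h2.symm
  rw [frac_eq_iff]
  refine ⟨⟨fOne.ofMonoid M k, h ▸ hc.2⟩, ?_⟩
  simp only [← map_mul, e']

/-- Sections of `Spec 𝔽₁[M]` are determined by their pullback to `Spec B[M]`, unless `Spec B` is
empty. -/
lemma section_hom_ext_of_baseChange (q : B.specSpace)
    {U : Opens (fOne.{u}.monoidBlueprint M).specSpace} {V : Opens (B.monoidBlueprint M).specSpace}
    (h : ∀ P ∈ V, (specSpaceMap (B.baseChange M)).hom.base P ∈ U)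
    (hV : ∀ P, (specSpaceMap (B.baseChange M)).hom.base P ∈ U → P ∈ V)
    {f g : E ⟶ (fOne.{u}.monoidBlueprint M).specSpace.presheaf.obj (op U)}
    (e : f ≫ appLE (specSpaceMap (B.baseChange M)) U V h =
      g ≫ appLE (specSpaceMap (B.baseChange M)) U V h) : f = g := by
  refine spec_section_hom_ext fun p hp => hom_ext fun x => ?_
  obtain ⟨P, -, hP⟩ := exists_monoidBlueprint_point q p
  have hPV : P ∈ V := hV P (hP.symm ▸ hp)
  have e' := congrArg (fun k => k ≫ specEval _ V P hPV) e
  simp only [Category.assoc] at e'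
  rw [appLE_specEval _ h p P hPV hP] at e'
  exact stalkMap_baseChange_injective p P hP (congrArg (fun k : E ⟶ _ => k.hom x) e')

/-- On points the base change map is surjective because some `q` exists, and on sections the
pullback is injective. The lemma descends equalities of morphisms from `B` to `𝔽₁`. -/
lemma spec_baseChange_epi (q : B.specSpace) {Z : BlueprintedSpace.{u}}
    {f g : (fOne.{u}.monoidBlueprint M).specSpace ⟶ Z}
    (e : specSpaceMap (B.baseChange M) ≫ f = specSpaceMap (B.baseChange M) ≫ g) : f = g := by
  refine hom_ext' (fun p => ?_) fun U V hf hg => ?_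
  · obtain ⟨P, -, rfl⟩ := exists_monoidBlueprint_point q p
    exact congrArg (fun k : _ ⟶ Z => k.hom.base P) e
  · refine section_hom_ext_of_baseChange q (V := preim (specSpaceMap (B.baseChange M)) V)
      (apply_mem_of_mem_preim _) (fun P hP => hP) ?_
    exact (appLE_comp _ f _ _).trans ((appLE_congr e _).trans (appLE_comp _ g _ _).symm)

/-- A localization of monoids induces a localization of monoid blueprints. -/
lemma isLocalizationHom_monoidBlueprintMap (B : Blueprint.{u}) {f : M →*₀ N} {S : Submonoid M}
    (hf : S.IsLocalizationMap f) :
    IsLocalizationHom (B.monoidBlueprintMap f) (S.map (B.ofMonoid M : M →* B.monoidBlueprint M)) where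
  isUnit := by
    rintro _ ⟨s, hs, rfl⟩
    exact (hf.map_units ⟨s, hs⟩).map (B.ofMonoid N)
  surj d := by
    obtain ⟨b, n, rfl⟩ := exists_eq_mul d
    obtain ⟨⟨m, s⟩, e⟩ := hf.surj n
    refine ⟨(B.toMonoidBlueprint M).hom b * B.ofMonoid M m, B.ofMonoid M s, ⟨s, s.2, rfl⟩, ?_⟩
    rw [map_mul, monoidBlueprintMap_ofMonoid, monoidBlueprintMap_ofMonoid, mul_assoc, ← map_mul, e,
      ← comp_hom, toMonoidBlueprint_map]
  exists_lift E ψ hψ := by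
    let F : S.LocalizationMap N := ⟨(f : M →* N).toMulHom, hf⟩
    have hu : ∀ s : S, IsUnit (ψ.hom.comp (B.ofMonoid M) s) := fun s => hψ _ ⟨s, s.2, rfl⟩
    refine ⟨monoidBlueprintLift (B.toMonoidBlueprint M ≫ ψ)
      (F.lift₀ (ψ.hom.comp (B.ofMonoid M)) hu), monoidBlueprint_hom_ext ?_ fun m => ?_⟩
    · rw [← Category.assoc, toMonoidBlueprint_map, toMonoidBlueprint_lift]
    · rw [comp_hom, monoidBlueprintMap_ofMonoid, monoidBlueprintLift_ofMonoid]
      exact F.lift_eq hu m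

end Blueprint

/-! ### A limit of blueprints -/

namespace Blueprint

variable {κ : Type u} {E S : Blueprint.{u}} {T R : κ → Blueprint.{u}} (α : ∀ i, S ⟶ R i)
  (β : ∀ i, T i ⟶ R i)

/-- The compatible families in `S × ∏ Tᵢ`. -/
def compatibleSubmonoid : Submonoid (S × ∀ i, T i) where
  carrier := {x | ∀ i, (α i).hom x.1 = (β i).hom (x.2 i)}
  one_mem' i := by
    change (α i).hom 1 = (β i).hom 1
    rw [map_one, map_one]
  mul_mem' {x y} hx hy i := by
    change (α i).hom (x.1 * y.1) = (β i).hom (x.2 i * y.2 i)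
    rw [map_mul, map_mul, hx i, hy i]

/-- The compatible families in `S × ∏ Tᵢ`, as a type. -/
def Compatible : Type u := compatibleSubmonoid α β

instance : CommMonoid (Compatible α β) := inferInstanceAs (CommMonoid (compatibleSubmonoid α β))

instance : CommMonoidWithZero (Compatible α β) where
  zero := ⟨0, fun i => (map_zero (α i).hom).trans (map_zero (β i).hom).symm⟩
  zero_mul s := Subtype.ext (zero_mul s.1)
  mul_zero s := Subtype.ext (mul_zero s.1)

/-- The components of a compatible family. -/
def compatibleEval : ∀ o : Option κ, Compatible α β →*₀ (o.elim S T : Blueprint.{u})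
  | none => ⟨⟨fun x => x.1.1, rfl⟩, rfl, fun _ _ => rfl⟩
  | some i => ⟨⟨fun x => x.1.2 i, rfl⟩, rfl, fun _ _ => rfl⟩

/-- The limit of the diagram formed by the `S → Rᵢ` and the `Tᵢ → Rᵢ`. -/
def wideFibreProduct : Blueprint.{u} :=
  ofFamily (A := Compatible α β) (fun o : Option κ => (o.elim S T : Blueprint.{u}))
    (compatibleEval α β) fun _ _ h =>
      Subtype.ext (Prod.ext (h none) (funext fun i => h (some i)))

namespace wideFibreProduct

/-- The projection to `S`. -/
def fst : wideFibreProduct α β ⟶ S where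
  hom := compatibleEval α β none
  map_rel x y h := (ofFamily_rel_iff _ _ _ x y).1 h none

/-- The projection to `Tᵢ`. -/
def snd (i : κ) : wideFibreProduct α β ⟶ T i where
  hom := compatibleEval α β (some i)
  map_rel x y h := (ofFamily_rel_iff _ _ _ x y).1 h (some i)

lemma condition (i : κ) : fst α β ≫ α i = snd α β i ≫ β i :=
  hom_ext fun x => x.2 i

variable {α β}

lemma ext {f g : E ⟶ wideFibreProduct α β} (h : f ≫ fst α β = g ≫ fst α β)
    (h' : ∀ i, f ≫ snd α β i = g ≫ snd α β i) : f = g := by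
  refine hom_ext fun e => Subtype.ext (Prod.ext ?_ (funext fun i => ?_))
  · exact congrArg (fun k : E ⟶ S => k.hom e) h
  · exact congrArg (fun k : E ⟶ T i => k.hom e) (h' i)

/-- The map underlying `lift`. -/
def liftHom (f : E ⟶ S) (g : ∀ i, E ⟶ T i) (h : ∀ i, f ≫ α i = g i ≫ β i) :
    E →*₀ Compatible α β where
  toFun e := ⟨(f.hom e, fun i => (g i).hom e),
    fun i => congrArg (fun k : E ⟶ R i => k.hom e) (h i)⟩
  map_zero' := Subtype.ext (Prod.ext (map_zero f.hom) (funext fun i => map_zero (g i).hom))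
  map_one' := Subtype.ext (Prod.ext (map_one f.hom) (funext fun i => map_one (g i).hom))
  map_mul' a b := Subtype.ext (Prod.ext (map_mul f.hom a b) (funext fun i => map_mul (g i).hom a b))

/-- The morphism given by its components. -/
def lift (f : E ⟶ S) (g : ∀ i, E ⟶ T i) (h : ∀ i, f ≫ α i = g i ≫ β i) :
    E ⟶ wideFibreProduct α β where
  hom := liftHom f g h
  map_rel x y hxy := by
    refine (ofFamily_rel_iff _ _ _ _ _).2 ?_
    rintro (_ | i)
    · have e : ∀ z, mapSum f.hom z = mapSum (compatibleEval α β none) (mapSum (liftHom f g h) z) :=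
        fun z => mapSum_comp (compatibleEval α β none) (liftHom f g h) z
      have h' := f.map_rel x y hxy
      rw [e, e] at h'
      exact h'
    · have e : ∀ z, mapSum (g i).hom z =
          mapSum (compatibleEval α β (some i)) (mapSum (liftHom f g h) z) :=
        fun z => mapSum_comp (compatibleEval α β (some i)) (liftHom f g h) z
      have h' := (g i).map_rel x y hxy
      rw [e, e] at h'
      exact h'

end wideFibreProduct

end Blueprint

/-! ### Pushouts of blueprinted spaces along a prescribed underlying space -/

namespace BlueprintedSpace

open Blueprint

/-- Morphisms `S ← Rᵢ → Tᵢ` of blueprinted spaces together with a compatible family of continuous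
maps from `S` and the `Tᵢ` to a topological space. -/
structure PushoutDatum where
  Y : TopCat.{u}
  κ : Type u
  S : BlueprintedSpace.{u}
  T : κ → BlueprintedSpace.{u}
  R : κ → BlueprintedSpace.{u}
  r : (S.carrier : TopCat.{u}) ⟶ Y
  γ : ∀ i, ((T i).carrier : TopCat.{u}) ⟶ Y
  α : ∀ i, R i ⟶ S
  β : ∀ i, R i ⟶ T i
  w : ∀ i x, r ((α i).hom.base x) = γ i ((β i).hom.base x)

namespace PushoutDatum

variable (D : PushoutDatum.{u}) {E : Blueprint.{u}}

/-- The inverse image in `S`. -/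
def rPre (W : Opens D.Y) : Opens D.S := (Opens.map D.r).obj W

/-- The inverse image in `Tᵢ`. -/
def γPre (i : D.κ) (W : Opens D.Y) : Opens (D.T i) := (Opens.map (D.γ i)).obj W

/-- The inverse image in `Rᵢ`. -/
def αPre (i : D.κ) (W : Opens D.Y) : Opens (D.R i) := preim (D.α i) (D.rPre W)

section

variable {W W' : Opens D.Y} (h : W' ≤ W) (i : D.κ)
include h

lemma rPre_mono : D.rPre W' ≤ D.rPre W := fun _ hx => h hx

lemma γPre_mono : D.γPre i W' ≤ D.γPre i W := fun _ hx => h hx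

lemma αPre_mono : D.αPre i W' ≤ D.αPre i W := fun _ hx => h hx

end

lemma α_mem (W : Opens D.Y) (i : D.κ) : ∀ x ∈ D.αPre i W, (D.α i).hom.base x ∈ D.rPre W :=
  apply_mem_of_mem_preim (D.α i)

lemma β_mem (W : Opens D.Y) (i : D.κ) : ∀ x ∈ D.αPre i W, (D.β i).hom.base x ∈ D.γPre i W := by
  intro x hx
  have hx : D.r ((D.α i).hom.base x) ∈ W := hx
  rw [D.w] at hx
  exact hx

/-- Pullback of sections along `αᵢ`. -/
def αApp (W : Opens D.Y) (i : D.κ) :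
    D.S.presheaf.obj (op (D.rPre W)) ⟶ (D.R i).presheaf.obj (op (D.αPre i W)) :=
  appLE (D.α i) _ _ (D.α_mem W i)

/-- Pullback of sections along `βᵢ`. -/
def βApp (W : Opens D.Y) (i : D.κ) :
    (D.T i).presheaf.obj (op (D.γPre i W)) ⟶ (D.R i).presheaf.obj (op (D.αPre i W)) :=
  appLE (D.β i) _ _ (D.β_mem W i)

/-- Sections of the pushout. -/
def sections (W : Opens D.Y) : Blueprint.{u} := wideFibreProduct (D.αApp W) (D.βApp W)

/-- The component of a section on `S`. -/
def fst (W : Opens D.Y) : D.sections W ⟶ D.S.presheaf.obj (op (D.rPre W)) :=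
  wideFibreProduct.fst _ _

/-- The component of a section on `Tᵢ`. -/
def snd (W : Opens D.Y) (i : D.κ) : D.sections W ⟶ (D.T i).presheaf.obj (op (D.γPre i W)) :=
  wideFibreProduct.snd _ _ i

lemma condition (W : Opens D.Y) (i : D.κ) : D.fst W ≫ D.αApp W i = D.snd W i ≫ D.βApp W i :=
  wideFibreProduct.condition _ _ i

variable {D} in
lemma sections_hom_ext {W : Opens D.Y} {f g : E ⟶ D.sections W} (h : f ≫ D.fst W = g ≫ D.fst W)
    (h' : ∀ i, f ≫ D.snd W i = g ≫ D.snd W i) : f = g :=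
  wideFibreProduct.ext h h'

lemma αApp_resHom {W W' : Opens D.Y} (h : W' ≤ W) (i : D.κ) :
    D.S.resHom (D.rPre_mono h) ≫ D.αApp W' i = D.αApp W i ≫ (D.R i).resHom (D.αPre_mono h i) := by
  rw [αApp, αApp, resHom_appLE, appLE_resHom]

lemma βApp_resHom {W W' : Opens D.Y} (h : W' ≤ W) (i : D.κ) :
    (D.T i).resHom (D.γPre_mono h i) ≫ D.βApp W' i =
      D.βApp W i ≫ (D.R i).resHom (D.αPre_mono h i) := by
  rw [βApp, βApp, resHom_appLE, appLE_resHom]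

/-- Restriction of sections. -/
def restrict {W W' : Opens D.Y} (h : W' ≤ W) : D.sections W ⟶ D.sections W' :=
  wideFibreProduct.lift (D.fst W ≫ D.S.resHom (D.rPre_mono h))
    (fun i => D.snd W i ≫ (D.T i).resHom (D.γPre_mono h i)) fun i => by
      rw [Category.assoc, Category.assoc, D.αApp_resHom h i, D.βApp_resHom h i, ← Category.assoc,
        ← Category.assoc, condition]

lemma restrict_fst {W W' : Opens D.Y} (h : W' ≤ W) :
    D.restrict h ≫ D.fst W' = D.fst W ≫ D.S.resHom (D.rPre_mono h) := rfl

lemma restrict_snd {W W' : Opens D.Y} (h : W' ≤ W) (i : D.κ) :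
    D.restrict h ≫ D.snd W' i = D.snd W i ≫ (D.T i).resHom (D.γPre_mono h i) := rfl

/-- The presheaf of sections of the pushout. -/
def presheaf : TopCat.Presheaf Blueprint.{u} D.Y where
  obj W := D.sections W.unop
  map i := D.restrict i.unop.le
  map_id W := sections_hom_ext
    (by rw [restrict_fst, resHom_self, Category.comp_id, Category.id_comp])
    (fun i => by rw [restrict_snd, resHom_self, Category.comp_id, Category.id_comp])
  map_comp i k := sections_hom_ext
    (by rw [Category.assoc, restrict_fst, restrict_fst, reassoc_of% restrict_fst, resHom_resHom])
    (fun l => by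
      rw [Category.assoc, restrict_snd, restrict_snd, reassoc_of% restrict_snd, resHom_resHom])

/-- The sections form a limit of sheaves: the components on `S` and on the `Tᵢ` glue separately, and
their compatibility is checked locally on the `Rᵢ`. -/
lemma isSheaf : D.presheaf.IsSheaf := by
  intro E U 𝒮 h𝒮 x hx
  let I : Type u := {V : Opens D.Y // ∃ h : V ≤ U, 𝒮 (homOfLE h)}
  have hI : ∀ k : I, k.1 ≤ U := fun k => k.2.1
  obtain ⟨y, hyx⟩ : ∃ y : ∀ k : I, E ⟶ D.sections k.1, ∀ k, y k = x (homOfLE k.2.1) k.2.2 :=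
    ⟨fun k => x (homOfLE k.2.1) k.2.2, fun _ => rfl⟩
  have hy : ∀ k l : I, y k ≫ D.restrict (inf_le_left : k.1 ⊓ l.1 ≤ k.1) =
      y l ≫ D.restrict (inf_le_right : k.1 ⊓ l.1 ≤ l.1) := fun k l => by
    rw [hyx, hyx]
    exact hx (Z := k.1 ⊓ l.1) (homOfLE inf_le_left) (homOfLE inf_le_right) k.2.2 l.2.2
      (Subsingleton.elim _ _)
  have cov : ∀ z ∈ U, ∃ k : I, z ∈ k.1 := by
    intro z hz
    obtain ⟨V, i, hi, hzV⟩ := h𝒮 z hz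
    exact ⟨⟨V, i.le, hi⟩, hzV⟩
  have covS : ∀ z ∈ D.rPre U, ∃ k : I, z ∈ D.rPre k.1 := fun z hz => cov (D.r z) hz
  have covT : ∀ i, ∀ z ∈ D.γPre i U, ∃ k : I, z ∈ D.γPre i k.1 := fun i z hz => cov (D.γ i z) hz
  have covR : ∀ i, ∀ z ∈ D.αPre i U, ∃ k : I, z ∈ D.αPre i k.1 := fun i z hz =>
    covS ((D.α i).hom.base z) hz
  obtain ⟨f, hf⟩ := exists_section_hom (X := D.S) (fun k : I => D.rPre k.1)
    (fun k => D.rPre_mono (hI k)) covS (fun k => y k ≫ D.fst k.1) (fun k l => by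
      have := congrArg (fun g => g ≫ D.fst _) (hy k l)
      simp only [Category.assoc, restrict_fst] at this
      rw [Category.assoc, Category.assoc]
      exact this)
  have hg : ∀ i, ∃ g : E ⟶ (D.T i).presheaf.obj (op (D.γPre i U)), ∀ k : I,
      g ≫ (D.T i).resHom (D.γPre_mono (hI k) i) = y k ≫ D.snd k.1 i :=
    fun i => exists_section_hom (X := D.T i) (fun k : I => D.γPre i k.1)
      (fun k => D.γPre_mono (hI k) i) (covT i) (fun k => y k ≫ D.snd k.1 i) (fun k l => by
        have := congrArg (fun g => g ≫ D.snd _ i) (hy k l)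
        simp only [Category.assoc, restrict_snd] at this
        rw [Category.assoc, Category.assoc]
        exact this)
  choose g hg using hg
  have hfg : ∀ i, f ≫ D.αApp U i = g i ≫ D.βApp U i := fun i =>
    section_hom_ext (X := D.R i) (fun k : I => D.αPre i k.1) (fun k => D.αPre_mono (hI k) i)
      (covR i) (fun k => by
        rw [Category.assoc, Category.assoc, ← D.αApp_resHom (hI k) i,
          ← D.βApp_resHom (hI k) i, reassoc_of% (hf k),
          reassoc_of% (hg i k), condition])
  refine ⟨wideFibreProduct.lift f g hfg, ?_, ?_⟩
  · intro V j hj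
    exact (sections_hom_ext (hf ⟨V, j.le, hj⟩) fun i => hg i ⟨V, j.le, hj⟩).trans
      (hyx ⟨V, j.le, hj⟩)
  · intro y' hy'
    have key : ∀ y' : E ⟶ D.sections U, (∀ k : I, y' ≫ D.restrict (hI k) = y k) →
        y' = wideFibreProduct.lift f g hfg := by
      intro y' hy'
      refine sections_hom_ext (section_hom_ext (X := D.S) (fun k : I => D.rPre k.1)
        (fun k => D.rPre_mono (hI k)) covS fun k => ?_) fun i =>
          section_hom_ext (X := D.T i) (fun k : I => D.γPre i k.1)
            (fun k => D.γPre_mono (hI k) i) (covT i) fun k => ?_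
      · refine Eq.trans ?_ (hf k).symm
        rw [← hy' k, Category.assoc, Category.assoc, restrict_fst]
      · refine Eq.trans ?_ (hg i k).symm
        rw [← hy' k, Category.assoc, Category.assoc, restrict_snd]
    exact key y' fun k => (hy' (homOfLE k.2.1) k.2.2).trans (hyx k).symm

/-- The pushout. -/
def space : BlueprintedSpace.{u} where
  carrier := D.Y
  presheaf := D.presheaf
  IsSheaf := D.isSheaf

/-- The morphism from `S` to the pushout. -/
def inl : D.S ⟶ D.space :=
  InducedCategory.homMk
    { base := D.r
      c := { app := fun W => D.fst W.unop, naturality := fun _ _ _ => rfl } }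

/-- The morphism from `Tᵢ` to the pushout. -/
def inr (i : D.κ) : D.T i ⟶ D.space :=
  InducedCategory.homMk
    { base := D.γ i
      c := { app := fun W => D.snd W.unop i, naturality := fun _ _ _ => rfl } }

/-- Pullback of sections along `inl`. -/
def inlApp (W : Opens D.space) :
    D.space.presheaf.obj (op W) ⟶ D.S.presheaf.obj (op (preim D.inl W)) :=
  appLE D.inl W (preim D.inl W) (apply_mem_of_mem_preim _)

/-- Pullback of sections along `inr i`. -/
def inrApp (W : Opens D.space) (i : D.κ) :
    D.space.presheaf.obj (op W) ⟶ (D.T i).presheaf.obj (op (preim (D.inr i) W)) :=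
  appLE (D.inr i) W (preim (D.inr i) W) (apply_mem_of_mem_preim _)

lemma inlApp_eq (W : Opens D.space) : D.inlApp W = D.fst W :=
  (congrArg (fun k => D.fst W ≫ k) (resHom_self (X := D.S) le_rfl)).trans (Category.comp_id _)

lemma inrApp_eq (W : Opens D.space) (i : D.κ) : D.inrApp W i = D.snd W i :=
  (congrArg (fun k => D.snd W i ≫ k) (resHom_self (X := D.T i) le_rfl)).trans (Category.comp_id _)

lemma space_section_hom_ext {W : Opens D.space} {f g : E ⟶ D.space.presheaf.obj (op W)}
    (h : f ≫ D.inlApp W = g ≫ D.inlApp W) (h' : ∀ i, f ≫ D.inrApp W i = g ≫ D.inrApp W i) :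
    f = g := by
  refine sections_hom_ext ?_ fun i => ?_
  · rw [inlApp_eq] at h
    exact h
  · have h' := h' i
    rw [inrApp_eq] at h'
    exact h'

lemma β_mem_preim (W : Opens D.space) (i : D.κ) :
    ∀ x ∈ preim (D.α i) (preim D.inl W), (D.β i).hom.base x ∈ preim (D.inr i) W :=
  D.β_mem W i

lemma exists_space_section_hom {W : Opens D.space}
    (f : E ⟶ D.S.presheaf.obj (op (preim D.inl W)))
    (g : ∀ i, E ⟶ (D.T i).presheaf.obj (op (preim (D.inr i) W)))
    (h : ∀ i, f ≫ appLE (D.α i) _ (preim (D.α i) (preim D.inl W)) (apply_mem_of_mem_preim _) =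
      g i ≫ appLE (D.β i) _ _ (D.β_mem_preim W i)) :
    ∃ k : E ⟶ D.space.presheaf.obj (op W), k ≫ D.inlApp W = f ∧ ∀ i, k ≫ D.inrApp W i = g i := by
  refine ⟨wideFibreProduct.lift f g h, ?_, fun i => ?_⟩
  · rw [inlApp_eq]
    rfl
  · rw [inrApp_eq]
    rfl

lemma inlApp_α (W : Opens D.space) (i : D.κ) :
    D.inlApp W ≫ appLE (D.α i) _ (preim (D.α i) (preim D.inl W)) (apply_mem_of_mem_preim _) =
      D.inrApp W i ≫ appLE (D.β i) _ _ (D.β_mem_preim W i) := by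
  rw [inlApp_eq, inrApp_eq]
  exact D.condition W i

lemma w_hom (i : D.κ) : D.α i ≫ D.inl = D.β i ≫ D.inr i := by
  refine hom_ext' (D.w i) fun U V hf hg => ?_
  have hV : V ≤ preim (D.α i) (preim D.inl U) := hf
  have h := congrArg (fun k => k ≫ (D.R i).resHom hV) (D.inlApp_α U i)
  simp only [Category.assoc, appLE_resHom] at h
  rw [inlApp, inrApp, appLE_comp, appLE_comp] at h
  exact h

end PushoutDatum

end BlueprintedSpace

/-! ### The fibre over a point of `Spec B` -/

namespace Blueprint

open BlueprintedSpace AlgebraicGeometry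

variable {B : Blueprint.{u}} {M N : Type u} [CommMonoidWithZero M] [CommMonoidWithZero N]
  {T : BlueprintedSpace.{u}} (a : T ⟶ B.specSpace) (q : B.specSpace)

/-- The point `(q, p)` of `Spec B[M]`. -/
def pointOver (p : (fOne.{u}.monoidBlueprint M).specSpace) : (B.monoidBlueprint M).specSpace :=
  (exists_monoidBlueprint_point q p).choose

lemma toMonoidBlueprint_pointOver (p : (fOne.{u}.monoidBlueprint M).specSpace) :
    (specSpaceMap (B.toMonoidBlueprint M)).hom.base (pointOver q p) = q :=
  (exists_monoidBlueprint_point q p).choose_spec.1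

lemma baseChange_pointOver (p : (fOne.{u}.monoidBlueprint M).specSpace) :
    (specSpaceMap (B.baseChange M)).hom.base (pointOver q p) = p :=
  (exists_monoidBlueprint_point q p).choose_spec.2

variable {q} in
lemma pointOver_baseChange {P : (B.monoidBlueprint M).specSpace}
    (h : (specSpaceMap (B.toMonoidBlueprint M)).hom.base P = q) :
    pointOver q ((specSpaceMap (B.baseChange M)).hom.base P) = P :=
  monoidBlueprint_point_ext ((toMonoidBlueprint_pointOver q _).trans h.symm)
    (baseChange_pointOver q _)

lemma toMonoidBlueprint_map_base (f : M →*₀ N) (n : (B.monoidBlueprint N).specSpace) :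
    (specSpaceMap (B.toMonoidBlueprint M)).hom.base
      ((specSpaceMap (B.monoidBlueprintMap f)).hom.base n) =
        (specSpaceMap (B.toMonoidBlueprint N)).hom.base n := by
  rw [← toMonoidBlueprint_map f]
  rfl

lemma baseChange_map_base (f : M →*₀ N) (n : (B.monoidBlueprint N).specSpace) :
    (specSpaceMap (B.baseChange M)).hom.base
      ((specSpaceMap (B.monoidBlueprintMap f)).hom.base n) =
        (specSpaceMap (fOne.monoidBlueprintMap f)).hom.base
          ((specSpaceMap (B.baseChange N)).hom.base n) :=
  congrArg (fun φ => (specSpaceMap φ).hom.base n) (monoidBlueprintMap_baseChange f).symm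

lemma map_pointOver (f : M →*₀ N) (n : (fOne.{u}.monoidBlueprint N).specSpace) :
    (specSpaceMap (B.monoidBlueprintMap f)).hom.base (pointOver q n) =
      pointOver q ((specSpaceMap (fOne.monoidBlueprintMap f)).hom.base n) :=
  monoidBlueprint_point_ext
    (by rw [toMonoidBlueprint_map_base, toMonoidBlueprint_pointOver, toMonoidBlueprint_pointOver])
    (by rw [baseChange_map_base, baseChange_pointOver, baseChange_pointOver])

/-- The preimage of `D(b ∧ m)` under `p ↦ (q, p)` is `D(m)` if `b ∉ q`, and empty otherwise. -/
lemma continuous_pointOver :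
    Continuous (pointOver q : (fOne.{u}.monoidBlueprint M).specSpace → _) := by
  refine continuous_of_basicOpen fun x => ?_
  obtain ⟨b, m, rfl⟩ := exists_eq_mul x
  simp only [mk_mem_nz_iff, toMonoidBlueprint_pointOver, baseChange_pointOver]
  by_cases hb : b ∈ nz q
  · simp only [hb, true_and]
    exact (basicOpen (fOne.ofMonoid M m)).2
  · simp only [hb, false_and]
    exact isOpen_const

/-- The fibre over `q`. -/
def fibre : TopCat.{u} := TopCat.of {x : T // a.hom.base x = q}

variable {a} in
lemma apply_eq_of_over {v : (B.monoidBlueprint N).specSpace ⟶ T}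
    (hv : v ≫ a = specSpaceMap (B.toMonoidBlueprint N)) (P : (B.monoidBlueprint N).specSpace) :
    a.hom.base (v.hom.base P) = (specSpaceMap (B.toMonoidBlueprint N)).hom.base P :=
  congrArg (fun k : _ ⟶ B.specSpace => k.hom.base P) hv

variable {a} in
/-- The restriction of `v : Spec B[N] → T` to the fibres over `q`. -/
def slice {v : (B.monoidBlueprint N).specSpace ⟶ T}
    (hv : v ≫ a = specSpaceMap (B.toMonoidBlueprint N))
    (p : (fOne.{u}.monoidBlueprint N).specSpace) : fibre a q :=
  ⟨v.hom.base (pointOver q p), (apply_eq_of_over hv _).trans (toMonoidBlueprint_pointOver q p)⟩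

variable {a} in
lemma slice_baseChange {v : (B.monoidBlueprint N).specSpace ⟶ T}
    (hv : v ≫ a = specSpaceMap (B.toMonoidBlueprint N)) {P : (B.monoidBlueprint N).specSpace}
    (h : a.hom.base (v.hom.base P) = q) :
    slice q hv ((specSpaceMap (B.baseChange N)).hom.base P) = ⟨v.hom.base P, h⟩ := by
  refine Subtype.ext (congrArg v.hom.base (pointOver_baseChange ?_))
  rw [← apply_eq_of_over hv, h]

variable {a} in
-- The points of `Spec B[N]` over `q` are the `(q, p)`. The image of an open `O` is the intersection
-- of the fibre with the image under `v` of the preimage of `O` in `Spec B[N]`. This makes `Spec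
-- 𝔽₁[N]` an open piece of the fibre of `T`.
lemma slice_isOpenEmbedding {v : (B.monoidBlueprint N).specSpace ⟶ T}
    [SheafedSpace.IsOpenImmersion v] (hv : v ≫ a = specSpaceMap (B.toMonoidBlueprint N)) :
    Topology.IsOpenEmbedding (slice q hv) := by
  refine Topology.IsOpenEmbedding.of_continuous_injective_isOpenMap ?_ ?_ ?_
  · exact (v.hom.base.hom.continuous.comp (continuous_pointOver q)).subtype_mk _
  · intro p p' h
    have h' := injective v (congrArg Subtype.val h)
    rw [← baseChange_pointOver q p, h', baseChange_pointOver]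
  · intro O hO
    have h1 : IsOpen ((image v (preim (specSpaceMap (B.baseChange N)) ⟨O, hO⟩)) : Set T) :=
      (image v _).2
    have h2 : slice q hv '' O =
        Subtype.val ⁻¹' ((image v (preim (specSpaceMap (B.baseChange N)) ⟨O, hO⟩)) : Set T) := by
      ext y
      constructor
      · rintro ⟨p, hp, rfl⟩
        exact ⟨_, by
          change (specSpaceMap (B.baseChange N)).hom.base (pointOver q p) ∈ O
          rwa [baseChange_pointOver], rfl⟩
      · rintro ⟨P, hP, e⟩
        have h : a.hom.base (v.hom.base P) = q := by
          rw [e]; exact y.2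
        exact ⟨_, hP, (slice_baseChange q hv h).trans (Subtype.ext e)⟩
    rw [h2]
    exact h1.preimage continuous_subtype_val

end Blueprint

/-! ### Overlaps of charts and the retraction onto a fibre -/

namespace MonoidalCovering

open Blueprint BlueprintedSpace AlgebraicGeometry BlueScheme

variable {B : Blueprint.{u}} {X : BlueScheme.{u}} {π : X ⟶ Spec B} (c : MonoidalCovering π)

instance (i : c.ι) : CommMonoidWithZero (c.M i) := c.str i

/-- The structure morphism of the underlying spaces. -/
def structureHom (π : X ⟶ Spec B) : X.space ⟶ B.specSpace := π.toSpaceHom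

/-- The charts as morphisms of spaces. -/
def ch (i : c.ι) : (B.monoidBlueprint (c.M i)).specSpace ⟶ X.space := (c.chart i).toSpaceHom

instance (i : c.ι) : SheafedSpace.IsOpenImmersion (c.ch i) := c.isOpenImmersion i

lemma ch_structureHom (i : c.ι) : c.ch i ≫ structureHom π = specSpaceMap (B.toMonoidBlueprint (c.M i)) :=
  congrArg Hom.toSpaceHom (c.chart_over i)

lemma exists_ch_eq (x : X.space) : ∃ i P, (c.ch i).hom.base P = x := c.covers x

/-- A member of the affine covering of the intersection of two charts. -/
structure Overlap (i k : c.ι) where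
  N : Type u
  [str : CommMonoidWithZero N]
  v : (B.monoidBlueprint N).specSpace ⟶ X.space
  isOpenImmersion : SheafedSpace.IsOpenImmersion v
  f : c.M i →*₀ N
  S : Submonoid (c.M i)
  g : c.M k →*₀ N
  T : Submonoid (c.M k)
  hf : S.IsLocalizationMap f
  v_eq : specSpaceMap (B.monoidBlueprintMap f) ≫ c.ch i = v
  hg : T.IsLocalizationMap g
  v_eq' : specSpaceMap (B.monoidBlueprintMap g) ≫ c.ch k = v


instance {i k : c.ι} (o : c.Overlap i k) : CommMonoidWithZero o.N := o.str

instance {i k : c.ι} (o : c.Overlap i k) : SheafedSpace.IsOpenImmersion o.v := o.isOpenImmersion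

variable {c} in
lemma exists_overlap {i k : c.ι} {P : (B.monoidBlueprint (c.M i)).specSpace}
    {P' : (B.monoidBlueprint (c.M k)).specSpace} (h : (c.ch i).hom.base P = (c.ch k).hom.base P') :
    ∃ (o : c.Overlap i k) (n : (B.monoidBlueprint o.N).specSpace),
      (specSpaceMap (B.monoidBlueprintMap o.f)).hom.base n = P ∧
        (specSpaceMap (B.monoidBlueprintMap o.g)).hom.base n = P' := by
  obtain ⟨N, _, v, f, S, g, T, hv, ⟨n, hn⟩, hf, hvf, hg, hvg⟩ :=
    c.overlap i k ((c.ch i).hom.base P) ⟨P, rfl⟩ ⟨P', h.symm⟩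
  let o : c.Overlap i k := ⟨N, v.toSpaceHom, hv, f, S, g, T, hf, (congrArg Hom.toSpaceHom hvf).symm,
    hg, (congrArg Hom.toSpaceHom hvg).symm⟩
  refine ⟨o, n, injective (c.ch i) (Eq.trans ?_ hn), injective (c.ch k) (Eq.trans ?_ (hn.trans h))⟩
  · exact congrArg (fun k : BlueScheme.Spec _ ⟶ X => k.toSpaceHom.hom.base n) hvf.symm
  · exact congrArg (fun k : BlueScheme.Spec _ ⟶ X => k.toSpaceHom.hom.base n) hvg.symm

namespace Overlap

variable {c} {i k : c.ι} (o : c.Overlap i k) (q : B.specSpace)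

/-- The overlap with the charts exchanged. -/
def symm : c.Overlap k i where
  N := o.N
  v := o.v
  isOpenImmersion := o.isOpenImmersion
  f := o.g
  S := o.T
  g := o.f
  T := o.S
  hf := o.hg
  v_eq := o.v_eq'
  hg := o.hf
  v_eq' := o.v_eq

lemma v_structureHom : o.v ≫ structureHom π = specSpaceMap (B.toMonoidBlueprint o.N) := by
  rw [← o.v_eq, Category.assoc, ch_structureHom]
  refine congrArg Hom.toSpaceHom
    (specMap_comp (B.toMonoidBlueprint (c.M i)) (B.monoidBlueprintMap o.f)).symm |>.trans ?_
  rw [toMonoidBlueprint_map]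
  rfl

instance isOpenImmersion_map : SheafedSpace.IsOpenImmersion (specSpaceMap (B.monoidBlueprintMap o.f)) :=
  have : SheafedSpace.IsOpenImmersion (specSpaceMap (B.monoidBlueprintMap o.f) ≫ c.ch i) := by
    rw [o.v_eq]
    infer_instance
  isOpenImmersion_of_comp _ (c.ch i)

instance isOpenImmersion_map' :
    SheafedSpace.IsOpenImmersion (specSpaceMap (B.monoidBlueprintMap o.g)) :=
  o.symm.isOpenImmersion_map

lemma ch_map (n : (B.monoidBlueprint o.N).specSpace) :
    (c.ch i).hom.base ((specSpaceMap (B.monoidBlueprintMap o.f)).hom.base n) = o.v.hom.base n :=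
  congrArg (fun k : _ ⟶ X.space => k.hom.base n) o.v_eq

lemma ch_map' (n : (B.monoidBlueprint o.N).specSpace) :
    (c.ch k).hom.base ((specSpaceMap (B.monoidBlueprintMap o.g)).hom.base n) = o.v.hom.base n :=
  o.symm.ch_map n

lemma slice_map (p : (fOne.{u}.monoidBlueprint o.N).specSpace) :
    slice q (c.ch_structureHom i) ((specSpaceMap (fOne.monoidBlueprintMap o.f)).hom.base p) =
      slice q o.v_structureHom p := by
  refine Subtype.ext ?_
  change (c.ch i).hom.base (pointOver q _) = _
  rw [← map_pointOver]
  exact o.ch_map _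

lemma slice_map' (p : (fOne.{u}.monoidBlueprint o.N).specSpace) :
    slice q (c.ch_structureHom k) ((specSpaceMap (fOne.monoidBlueprintMap o.g)).hom.base p) =
      slice q o.v_structureHom p :=
  o.symm.slice_map q p

include q in
-- The localization `Mᵢ → N` may invert infinitely many elements, so openness of the range has to be
-- inherited from `X`. Both `Spec 𝔽₁[N]` and `Spec 𝔽₁[Mᵢ]` are open in the fibre over `q`,
-- compatibly with the map between them.
lemma isOpenImmersion_fOne_map :
    SheafedSpace.IsOpenImmersion (specSpaceMap (fOne.{u}.monoidBlueprintMap o.f)) := by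
  refine (isLocalizationHom_monoidBlueprintMap fOne o.hf).isOpenImmersion ?_
  have h := slice_isOpenEmbedding q o.v_structureHom
  have e : slice q o.v_structureHom = slice q (c.ch_structureHom i) ∘
      (specSpaceMap (fOne.{u}.monoidBlueprintMap o.f)).hom.base :=
    funext fun p => (o.slice_map q p).symm
  rw [e] at h
  exact ((slice_isOpenEmbedding q (c.ch_structureHom i)).of_comp _ h).isOpen_range

include q in
lemma isOpenImmersion_fOne_map' :
    SheafedSpace.IsOpenImmersion (specSpaceMap (fOne.{u}.monoidBlueprintMap o.g)) :=
  o.symm.isOpenImmersion_fOne_map q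

/-- At the level of points, `Spec B[N]` surjects onto the fibre product of `Spec B[Mᵢ]` and `Spec
𝔽₁[N]` over `Spec 𝔽₁[Mᵢ]`: the required point has its `B`-coordinate from `P` and its `N`-coordinate
from `p`. -/
lemma exists_map_eq {P : (B.monoidBlueprint (c.M i)).specSpace}
    {p : (fOne.{u}.monoidBlueprint o.N).specSpace}
    (h : (specSpaceMap (B.baseChange (c.M i))).hom.base P =
      (specSpaceMap (fOne.{u}.monoidBlueprintMap o.f)).hom.base p) :
    ∃ n, (specSpaceMap (B.monoidBlueprintMap o.f)).hom.base n = P ∧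
      (specSpaceMap (B.baseChange o.N)).hom.base n = p := by
  obtain ⟨n, hn, hn'⟩ := exists_monoidBlueprint_point
    ((specSpaceMap (B.toMonoidBlueprint (c.M i))).hom.base P) p
  refine ⟨n, monoidBlueprint_point_ext ?_ ?_, hn'⟩
  · rw [toMonoidBlueprint_map_base, hn]
  · rw [baseChange_map_base, hn', h]

end Overlap

variable (q : B.specSpace)

/-- Transition maps come from morphisms of monoids and leave the coordinate in `Spec B` alone.
Replacing that coordinate by `q` is therefore independent of the chart, and the retraction is well
defined. -/
lemma slice_eq_of_ch_eq {i k : c.ι} {P : (B.monoidBlueprint (c.M i)).specSpace}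
    {P' : (B.monoidBlueprint (c.M k)).specSpace} (h : (c.ch i).hom.base P = (c.ch k).hom.base P') :
    slice q (c.ch_structureHom i) ((specSpaceMap (B.baseChange (c.M i))).hom.base P) =
      slice q (c.ch_structureHom k) ((specSpaceMap (B.baseChange (c.M k))).hom.base P') := by
  obtain ⟨o, n, rfl, rfl⟩ := exists_overlap h
  rw [baseChange_map_base, baseChange_map_base, o.slice_map, o.slice_map']

/-- The retraction of `X` to its fibre over `q`. -/
def retract (x : X.space) : fibre (structureHom π) q :=
  slice q (c.ch_structureHom (c.exists_ch_eq x).choose)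
    ((specSpaceMap (B.baseChange _)).hom.base (c.exists_ch_eq x).choose_spec.choose)

lemma retract_ch (i : c.ι) (P : (B.monoidBlueprint (c.M i)).specSpace) :
    c.retract q ((c.ch i).hom.base P) =
      slice q (c.ch_structureHom i) ((specSpaceMap (B.baseChange (c.M i))).hom.base P) :=
  c.slice_eq_of_ch_eq q (c.exists_ch_eq _).choose_spec.choose_spec

lemma continuous_retract : Continuous (c.retract q) := by
  refine continuous_def.2 fun O hO => isOpen_iff_forall_mem_open.2 fun x hx => ?_
  obtain ⟨i, P, rfl⟩ := c.exists_ch_eq x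
  have hc : Continuous fun P => c.retract q ((c.ch i).hom.base P) := by
    simp only [retract_ch]
    exact (slice_isOpenEmbedding q (c.ch_structureHom i)).continuous.comp
      (specSpaceMap (B.baseChange (c.M i))).hom.base.hom.continuous
  refine ⟨image (c.ch i) ⟨_, hO.preimage hc⟩, ?_, (image (c.ch i) _).2, P, hx, rfl⟩
  rintro _ ⟨P', hP', rfl⟩
  exact hP'

lemma exists_slice_eq (y : fibre (structureHom π) q) :
    ∃ i p, slice q (c.ch_structureHom i) p = y := by
  obtain ⟨x, hx⟩ := y
  obtain ⟨i, P, rfl⟩ := c.exists_ch_eq x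
  exact ⟨i, _, slice_baseChange q (c.ch_structureHom i) hx⟩

/-- A chart of `X` contains the full preimage, under the retraction, of its slice over `q`. Indeed,
whether a point of one chart lies in an overlap with another depends only on its monoid coordinate.
-/
lemma exists_of_retract_eq {x : X.space} {i : c.ι}
    {p : (fOne.{u}.monoidBlueprint (c.M i)).specSpace}
    (h : c.retract q x = slice q (c.ch_structureHom i) p) :
    ∃ P, (c.ch i).hom.base P = x ∧ (specSpaceMap (B.baseChange (c.M i))).hom.base P = p := by
  obtain ⟨k, P', rfl⟩ := c.exists_ch_eq x
  rw [retract_ch] at h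
  obtain ⟨o, n, hn, hn'⟩ := exists_overlap (congrArg Subtype.val h)
  have e := congrArg (specSpaceMap (B.baseChange (c.M k))).hom.base hn
  rw [baseChange_pointOver, baseChange_map_base] at e
  have e' := congrArg (specSpaceMap (B.baseChange (c.M i))).hom.base hn'
  rw [baseChange_pointOver, baseChange_map_base] at e'
  -- The point `n` of the overlap lies over `q`. It is replaced by the point with the same monoid
  -- coordinate in the fibre of the given point of `X`.
  obtain ⟨n', rfl, h'⟩ := o.exists_map_eq e.symm
  refine ⟨(specSpaceMap (B.monoidBlueprintMap o.g)).hom.base n', ?_, ?_⟩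
  · rw [o.ch_map, o.ch_map']
  · rw [baseChange_map_base, h', e']

end MonoidalCovering

namespace BlueprintedSpace

lemma appLE_square {W X Y Z : BlueprintedSpace.{u}} {f : W ⟶ X} {g : X ⟶ Z} {f' : W ⟶ Y}
    {g' : Y ⟶ Z} (e : f ≫ g = f' ≫ g') {U : Opens Z} {V : Opens X} {V' : Opens Y} {O : Opens W}
    (h : ∀ x ∈ V, g.hom.base x ∈ U) (h' : ∀ x ∈ O, f.hom.base x ∈ V)
    (k : ∀ x ∈ V', g'.hom.base x ∈ U) (k' : ∀ x ∈ O, f'.hom.base x ∈ V') :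
    appLE g U V h ≫ appLE f V O h' = appLE g' U V' k ≫ appLE f' V' O k' :=
  (appLE_comp f g h h').trans ((appLE_congr e _).trans (appLE_comp f' g' k k').symm)

end BlueprintedSpace

namespace Blueprint

lemma specSpaceMap_comp {B C D : Blueprint.{u}} (f : B ⟶ C) (g : C ⟶ D) :
    specSpaceMap (f ≫ g) = specSpaceMap g ≫ specSpaceMap f :=
  congrArg BlueScheme.Hom.toSpaceHom (BlueScheme.specMap_comp f g)

lemma specSpaceMap_baseChange {B : Blueprint.{u}} {M N : Type u} [CommMonoidWithZero M]
    [CommMonoidWithZero N] (f : M →*₀ N) :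
    specSpaceMap (B.monoidBlueprintMap f) ≫ specSpaceMap (B.baseChange M) =
      specSpaceMap (B.baseChange N) ≫ specSpaceMap (fOne.monoidBlueprintMap f) := by
  rw [← specSpaceMap_comp, ← specSpaceMap_comp, monoidBlueprintMap_baseChange]

end Blueprint

/-! ### The model over `𝔽₁` and its charts -/

namespace MonoidalCovering

open Blueprint BlueprintedSpace AlgebraicGeometry BlueScheme

variable {B : Blueprint.{u}} {X : BlueScheme.{u}} {π : X ⟶ BlueScheme.Spec B}
  (c : MonoidalCovering π) (q : B.specSpace) {E : Blueprint.{u}}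

/-- The data for gluing the `Spec 𝔽₁[Mᵢ]` along the charts of `X`. -/
def datum : PushoutDatum.{u} where
  Y := fibre (structureHom π) q
  κ := c.ι
  S := X.space
  T i := (fOne.monoidBlueprint (c.M i)).specSpace
  R i := (B.monoidBlueprint (c.M i)).specSpace
  r := TopCat.ofHom ⟨c.retract q, c.continuous_retract q⟩
  γ i := TopCat.ofHom
    ⟨slice q (c.ch_structureHom i), (slice_isOpenEmbedding q (c.ch_structureHom i)).continuous⟩
  α i := c.ch i
  β i := specSpaceMap (B.baseChange (c.M i))
  w i P := c.retract_ch q i P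

/-- The model of `X` over `𝔽₁`: its points are those of the fibre over `q`. -/
def model : BlueprintedSpace.{u} := (c.datum q).space

/-- The projection from `X` to its model. -/
def toModel : X.space ⟶ c.model q := (c.datum q).inl

/-- The charts of the model. -/
def modelChart (i : c.ι) : (fOne.monoidBlueprint (c.M i)).specSpace ⟶ c.model q := (c.datum q).inr i

lemma ch_toModel (i : c.ι) :
    c.ch i ≫ c.toModel q = specSpaceMap (B.baseChange (c.M i)) ≫ c.modelChart q i :=
  (c.datum q).w_hom i

lemma ch_toModel_base (i : c.ι) (P : (B.monoidBlueprint (c.M i)).specSpace) :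
    (c.toModel q).hom.base ((c.ch i).hom.base P) =
      (c.modelChart q i).hom.base ((specSpaceMap (B.baseChange (c.M i))).hom.base P) :=
  c.retract_ch q i P

lemma exists_modelChart_eq (y : c.model q) : ∃ i p, (c.modelChart q i).hom.base p = y :=
  c.exists_slice_eq q y

variable {c q}

lemma exists_of_toModel_eq {x : X.space} {i : c.ι}
    {p : (fOne.{u}.monoidBlueprint (c.M i)).specSpace}
    (h : (c.toModel q).hom.base x = (c.modelChart q i).hom.base p) :
    ∃ P, (c.ch i).hom.base P = x ∧ (specSpaceMap (B.baseChange (c.M i))).hom.base P = p :=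
  c.exists_of_retract_eq q h

/-- Equality in the model means that the points `(q, p)` and `(q, p')` coincide in `X`. An overlap
of `X` contains that point, and its monoid coordinate is the required `n`. -/
lemma exists_model_overlap {i k : c.ι} {p : (fOne.{u}.monoidBlueprint (c.M i)).specSpace}
    {p' : (fOne.{u}.monoidBlueprint (c.M k)).specSpace}
    (h : (c.modelChart q i).hom.base p = (c.modelChart q k).hom.base p') :
    ∃ (o : c.Overlap i k) (n : (fOne.monoidBlueprint o.N).specSpace),
      (specSpaceMap (fOne.monoidBlueprintMap o.f)).hom.base n = p ∧
        (specSpaceMap (fOne.monoidBlueprintMap o.g)).hom.base n = p' := by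
  have h' : (c.ch i).hom.base (pointOver q p) = (c.ch k).hom.base (pointOver q p') :=
    congrArg Subtype.val h
  obtain ⟨o, n, hn, hn'⟩ := exists_overlap h'
  refine ⟨o, (specSpaceMap (B.baseChange o.N)).hom.base n, ?_, ?_⟩
  · rw [← baseChange_map_base, hn, baseChange_pointOver]
  · rw [← baseChange_map_base, hn', baseChange_pointOver]

variable (q) in
lemma Overlap.modelChart_map {i k : c.ι} (o : c.Overlap i k)
    (n : (fOne.{u}.monoidBlueprint o.N).specSpace) :
    (c.modelChart q i).hom.base ((specSpaceMap (fOne.monoidBlueprintMap o.f)).hom.base n) =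
      (c.modelChart q k).hom.base ((specSpaceMap (fOne.monoidBlueprintMap o.g)).hom.base n) :=
  (o.slice_map q n).trans (o.slice_map' q n).symm

lemma modelChart_isOpenEmbedding (i : c.ι) :
    Topology.IsOpenEmbedding (c.modelChart q i).hom.base :=
  slice_isOpenEmbedding q (c.ch_structureHom i)

lemma model_section_hom_ext {W : Opens (c.model q)} {f g : E ⟶ (c.model q).presheaf.obj (op W)}
    (h : f ≫ appLE (c.toModel q) W (preim (c.toModel q) W) (apply_mem_of_mem_preim _) =
      g ≫ appLE (c.toModel q) W (preim (c.toModel q) W) (apply_mem_of_mem_preim _))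
    (h' : ∀ i, f ≫ appLE (c.modelChart q i) W (preim (c.modelChart q i) W)
        (apply_mem_of_mem_preim _) =
      g ≫ appLE (c.modelChart q i) W (preim (c.modelChart q i) W) (apply_mem_of_mem_preim _)) :
    f = g :=
  (c.datum q).space_section_hom_ext h h'

lemma baseChange_mem (W : Opens (c.model q)) (i : c.ι) :
    ∀ P ∈ preim (c.ch i) (preim (c.toModel q) W),
      (specSpaceMap (B.baseChange (c.M i))).hom.base P ∈ preim (c.modelChart q i) W :=
  (c.datum q).β_mem_preim W i

lemma mem_of_baseChange_mem {W : Opens (c.model q)} {i : c.ι}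
    {P : (B.monoidBlueprint (c.M i)).specSpace}
    (h : (specSpaceMap (B.baseChange (c.M i))).hom.base P ∈ preim (c.modelChart q i) W) :
    P ∈ preim (c.ch i) (preim (c.toModel q) W) := by
  have h : (c.modelChart q i).hom.base ((specSpaceMap (B.baseChange (c.M i))).hom.base P) ∈ W := h
  rw [← ch_toModel_base] at h
  exact h

lemma exists_model_section_hom {W : Opens (c.model q)}
    (f : E ⟶ X.space.presheaf.obj (op (preim (c.toModel q) W)))
    (g : ∀ i, E ⟶ (fOne.monoidBlueprint (c.M i)).specSpace.presheaf.obj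
      (op (preim (c.modelChart q i) W)))
    (h : ∀ i, f ≫ appLE (c.ch i) _ (preim (c.ch i) (preim (c.toModel q) W))
        (apply_mem_of_mem_preim _) =
      g i ≫ appLE (specSpaceMap (B.baseChange (c.M i))) _ _ (baseChange_mem W i)) :
    ∃ k : E ⟶ (c.model q).presheaf.obj (op W),
      k ≫ appLE (c.toModel q) W (preim (c.toModel q) W) (apply_mem_of_mem_preim _) = f ∧
      ∀ i, k ≫ appLE (c.modelChart q i) W (preim (c.modelChart q i) W)
        (apply_mem_of_mem_preim _) = g i :=
  (c.datum q).exists_space_section_hom f g h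

/-- Sections on a chart of the model can be moved to any other chart, locally. -/
lemma exists_local_transition {i k : c.ι} {W : Opens (c.model q)}
    (hW : ∀ y ∈ W, y ∈ Set.range (c.modelChart q i).hom.base)
    (a : E ⟶ X.space.presheaf.obj (op (preim (c.toModel q) W)))
    (e : E ⟶ (fOne.monoidBlueprint (c.M i)).specSpace.presheaf.obj
      (op (preim (c.modelChart q i) W)))
    (h : a ≫ appLE (c.ch i) _ (preim (c.ch i) (preim (c.toModel q) W)) (apply_mem_of_mem_preim _) =
      e ≫ appLE (specSpaceMap (B.baseChange (c.M i))) _ _ (baseChange_mem W i))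
    {p' : (fOne.{u}.monoidBlueprint (c.M k)).specSpace} (hp' : p' ∈ preim (c.modelChart q k) W) :
    ∃ (V : Opens (fOne.{u}.monoidBlueprint (c.M k)).specSpace)
      (t : E ⟶ (fOne.monoidBlueprint (c.M k)).specSpace.presheaf.obj (op V)),
      p' ∈ V ∧ V ≤ preim (c.modelChart q k) W ∧
      ∀ (O : Opens (B.monoidBlueprint (c.M k)).specSpace)
        (h1 : ∀ P ∈ O, (specSpaceMap (B.baseChange (c.M k))).hom.base P ∈ V)
        (h2 : ∀ P ∈ O, (c.ch k).hom.base P ∈ preim (c.toModel q) W),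
        t ≫ appLE (specSpaceMap (B.baseChange (c.M k))) V O h1 = a ≫ appLE (c.ch k) _ O h2 := by
  obtain ⟨p, hp⟩ := hW _ (apply_mem_of_mem_preim _ _ hp')
  obtain ⟨o, n, rfl, rfl⟩ := exists_model_overlap hp
  have : SheafedSpace.IsOpenImmersion (specSpaceMap (fOne.{u}.monoidBlueprintMap o.g)) :=
    o.isOpenImmersion_fOne_map' q
  let VN := preim (specSpaceMap (fOne.{u}.monoidBlueprintMap o.f)) (preim (c.modelChart q i) W)
  have hVN : ∀ m ∈ VN, (specSpaceMap (fOne.{u}.monoidBlueprintMap o.f)).hom.base m ∈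
      preim (c.modelChart q i) W := apply_mem_of_mem_preim _
  let V := image (specSpaceMap (fOne.{u}.monoidBlueprintMap o.g)) VN
  have hV : ∀ m ∈ VN, (specSpaceMap (fOne.{u}.monoidBlueprintMap o.g)).hom.base m ∈ V :=
    apply_mem_image _
  have hVle : V ≤ preim (c.modelChart q k) W := by
    rintro _ ⟨m, hm, rfl⟩
    refine mem_preim.2 ?_
    rw [← o.modelChart_map q]
    exact hm
  have hIso : IsIso (appLE (specSpaceMap (fOne.{u}.monoidBlueprintMap o.g)) V VN hV) :=
    isIso_appLE_image _ VN
  let VB := preim (specSpaceMap (B.baseChange (c.M k))) V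
  have hVB : ∀ P ∈ VB, (specSpaceMap (B.baseChange (c.M k))).hom.base P ∈ V :=
    apply_mem_of_mem_preim _
  have hVB' : ∀ P ∈ VB, (c.ch k).hom.base P ∈ preim (c.toModel q) W := fun P hP =>
    mem_of_baseChange_mem (hVle hP)
  let VBN := preim (specSpaceMap (B.baseChange o.N)) VN
  have hVBN : ∀ m ∈ VBN, (specSpaceMap (B.baseChange o.N)).hom.base m ∈ VN :=
    apply_mem_of_mem_preim _
  have hg : ∀ m ∈ VBN, (specSpaceMap (B.monoidBlueprintMap o.g)).hom.base m ∈ VB := by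
    intro m hm
    refine mem_preim.2 ?_
    rw [baseChange_map_base]
    exact hV _ hm
  have hf : ∀ m ∈ VBN, (specSpaceMap (B.monoidBlueprintMap o.f)).hom.base m ∈
      preim (c.ch i) (preim (c.toModel q) W) := by
    intro m hm
    refine mem_of_baseChange_mem ?_
    rw [baseChange_map_base]
    exact hm
  -- Over `VB` the overlap `Spec B[N]` fills the whole chart, because membership in the overlap
  -- depends only on the monoid coordinate. Equalities of sections on `VB` can thus be tested on
  -- `Spec B[N]`.
  have hIso' : IsIso (appLE (specSpaceMap (B.monoidBlueprintMap o.g)) VB VBN hg) := by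
    refine isIso_appLE _ ?_ hg ?_
    · rintro P ⟨m, -, hm⟩
      obtain ⟨n', hn', -⟩ := o.symm.exists_map_eq hm.symm
      exact ⟨n', hn'⟩
    · intro m hm
      have hm : (specSpaceMap (B.baseChange (c.M k))).hom.base
        ((specSpaceMap (B.monoidBlueprintMap o.g)).hom.base m) ∈ V := hm
      rw [baseChange_map_base] at hm
      obtain ⟨m', hm', e'⟩ := hm
      rw [injective _ e'] at hm'
      exact hm'
  -- The section `e` is restricted along `f` to the overlap over `𝔽₁`, and then carried to the chart
  -- `k` through the open immersion given by `g`.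
  obtain ⟨t, ht⟩ : ∃ t, t ≫ appLE (specSpaceMap (fOne.{u}.monoidBlueprintMap o.g)) V VN hV =
      e ≫ appLE (specSpaceMap (fOne.{u}.monoidBlueprintMap o.f)) _ VN hVN :=
    ⟨(e ≫ appLE (specSpaceMap (fOne.{u}.monoidBlueprintMap o.f)) _ VN hVN) ≫
      inv (appLE (specSpaceMap (fOne.{u}.monoidBlueprintMap o.g)) V VN hV), by
        rw [Category.assoc, IsIso.inv_hom_id, Category.comp_id]⟩
  have key : t ≫ appLE (specSpaceMap (B.baseChange (c.M k))) V VB hVB =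
      a ≫ appLE (c.ch k) _ VB hVB' := by
    rw [← cancel_mono (appLE (specSpaceMap (B.monoidBlueprintMap o.g)) VB VBN hg), Category.assoc t,
      Category.assoc a, appLE_square (specSpaceMap_baseChange o.g) hVB hg hV hVBN,
      appLE_square (o.v_eq'.trans o.v_eq.symm) hVB' hg
        (apply_mem_of_mem_preim (c.ch i)) hf, reassoc_of% ht, reassoc_of% h,
      appLE_square (specSpaceMap_baseChange o.f) (baseChange_mem W i) hf hVN hVBN]
  refine ⟨V, t, ⟨n, ?_, rfl⟩, hVle, fun O h1 h2 => ?_⟩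
  · refine mem_preim.2 (mem_preim.2 ?_)
    rw [hp]
    exact hp'
  · have hO : O ≤ VB := h1
    have := congrArg (fun k => k ≫ BlueprintedSpace.resHom _ hO) key
    simpa only [Category.assoc, appLE_resHom] using this

/-- The local descents on chart `k` glue: after pullback to `Spec B[Mₖ]` all of them become the
restriction of `a`, and this pullback is injective on sections. -/
lemma exists_transition {i : c.ι} (k : c.ι) {W : Opens (c.model q)}
    (hW : ∀ y ∈ W, y ∈ Set.range (c.modelChart q i).hom.base)
    (a : E ⟶ X.space.presheaf.obj (op (preim (c.toModel q) W)))
    (e : E ⟶ (fOne.monoidBlueprint (c.M i)).specSpace.presheaf.obj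
      (op (preim (c.modelChart q i) W)))
    (h : a ≫ appLE (c.ch i) _ (preim (c.ch i) (preim (c.toModel q) W)) (apply_mem_of_mem_preim _) =
      e ≫ appLE (specSpaceMap (B.baseChange (c.M i))) _ _ (baseChange_mem W i)) :
    ∃ t : E ⟶ (fOne.monoidBlueprint (c.M k)).specSpace.presheaf.obj
        (op (preim (c.modelChart q k) W)),
      a ≫ appLE (c.ch k) _ (preim (c.ch k) (preim (c.toModel q) W)) (apply_mem_of_mem_preim _) =
        t ≫ appLE (specSpaceMap (B.baseChange (c.M k))) _ _ (baseChange_mem W k) := by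
  choose V t hmem hle ht using fun p' : {p' // p' ∈ preim (c.modelChart q k) W} =>
    exists_local_transition hW a e h p'.2
  have hV : ∀ (V : Opens (fOne.{u}.monoidBlueprint (c.M k)).specSpace),
      V ≤ preim (c.modelChart q k) W → ∀ P ∈ preim (specSpaceMap (B.baseChange (c.M k))) V,
        (c.ch k).hom.base P ∈ preim (c.toModel q) W := fun V hV P hP =>
    mem_of_baseChange_mem (hV hP)
  obtain ⟨T, hT⟩ := exists_section_hom (X := (fOne.monoidBlueprint (c.M k)).specSpace) V hle
    (fun p hp => ⟨⟨p, hp⟩, hmem _⟩) t (fun x y => by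
      have h1 : ∀ P ∈ preim (specSpaceMap (B.baseChange (c.M k))) (V x ⊓ V y),
        (specSpaceMap (B.baseChange (c.M k))).hom.base P ∈ V x ⊓ V y := apply_mem_of_mem_preim _
      refine section_hom_ext_of_baseChange q h1 (fun P hP => hP) ?_
      rw [Category.assoc, Category.assoc, resHom_appLE, resHom_appLE,
        ht x _ _ (hV _ (inf_le_left.trans (hle x))), ht y _ _ (hV _ (inf_le_left.trans (hle x)))])
  refine ⟨T, section_hom_ext (X := (B.monoidBlueprint (c.M k)).specSpace)
    (fun x => preim (specSpaceMap (B.baseChange (c.M k))) (V x))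
    (fun x P hP => mem_of_baseChange_mem (hle x hP))
    (fun P hP => ⟨⟨_, baseChange_mem W k P hP⟩, hmem _⟩) fun x => ?_⟩
  rw [Category.assoc, Category.assoc, appLE_resHom, appLE_resHom,
    ← ht x _ (apply_mem_of_mem_preim _) (hV _ (hle x)), ← hT x, Category.assoc, resHom_appLE]

variable (c q) in
-- A section of the model over an open `W` inside chart `i` must be recovered from its component on
-- `Spec 𝔽₁[Mᵢ]`. That component determines the component on `X`, since the preimage of `W` lies in
-- the chart `Spec B[Mᵢ]`, and then those on the other charts by `exists_transition`.
instance modelChart_isOpenImmersion (i : c.ι) : SheafedSpace.IsOpenImmersion (c.modelChart q i) := by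
  refine isOpenImmersion_of_appLE _ (modelChart_isOpenEmbedding i) fun W V hW h hV => ?_
  obtain rfl : V = preim (c.modelChart q i) W := Opens.ext (Set.ext fun p => ⟨h p, hV p⟩)
  have hI : IsIso (appLE (c.ch i) _ (preim (c.ch i) (preim (c.toModel q) W))
      (apply_mem_of_mem_preim _)) := by
    refine isIso_appLE _ (fun x hx => ?_) _ fun x hx => hx
    obtain ⟨p, hp⟩ := hW _ (apply_mem_of_mem_preim _ _ hx)
    obtain ⟨P, hP, -⟩ := exists_of_toModel_eq hp.symm
    exact ⟨P, hP⟩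
  have sq : ∀ k, appLE (c.toModel q) W (preim (c.toModel q) W) (apply_mem_of_mem_preim _) ≫
      appLE (c.ch k) _ (preim (c.ch k) (preim (c.toModel q) W)) (apply_mem_of_mem_preim _) =
      appLE (c.modelChart q k) W (preim (c.modelChart q k) W) (apply_mem_of_mem_preim _) ≫
        appLE (specSpaceMap (B.baseChange (c.M k))) _ _ (baseChange_mem W k) := fun k =>
    appLE_square (c.ch_toModel q k) _ _ _ _
  obtain ⟨a, ha⟩ : ∃ a, a ≫ appLE (c.ch i) _ (preim (c.ch i) (preim (c.toModel q) W))
      (apply_mem_of_mem_preim _) =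
        appLE (specSpaceMap (B.baseChange (c.M i))) _ _ (baseChange_mem W i) :=
    ⟨_ ≫ inv (appLE (c.ch i) _ (preim (c.ch i) (preim (c.toModel q) W))
      (apply_mem_of_mem_preim _)), by rw [Category.assoc, IsIso.inv_hom_id, Category.comp_id]⟩
  -- Applying the transition to the identity morphism treats all sections at once and directly
  -- produces a morphism of blueprints, the inverse `J`.
  choose t ht using fun k => exists_transition k hW a (𝟙 _) (by rw [ha, Category.id_comp])
  obtain ⟨J, hJ, hJ'⟩ := exists_model_section_hom a t ht
  have cancel : ∀ {E : Blueprint.{u}} (k : c.ι) {f g : E ⟶ (fOne.monoidBlueprint (c.M k)).specSpace.presheaf.obj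
      (op (preim (c.modelChart q k) W))},
      f ≫ appLE (specSpaceMap (B.baseChange (c.M k))) _ _ (baseChange_mem W k) =
        g ≫ appLE (specSpaceMap (B.baseChange (c.M k))) _ _ (baseChange_mem W k) → f = g :=
    fun k _ _ e => section_hom_ext_of_baseChange q (baseChange_mem W k)
      (fun P hP => mem_of_baseChange_mem hP) e
  have ha' : appLE (c.modelChart q i) W (preim (c.modelChart q i) W) h ≫ a =
      appLE (c.toModel q) W (preim (c.toModel q) W) (apply_mem_of_mem_preim _) := by
    rw [← cancel_mono (appLE (c.ch i) _ (preim (c.ch i) (preim (c.toModel q) W))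
      (apply_mem_of_mem_preim _)), Category.assoc, ha, sq]
  -- Components on charts over `𝔽₁` are compared after pullback to `B`, where they are all expressed
  -- through `a`.
  refine ⟨J, model_section_hom_ext ?_ fun k => cancel k ?_, cancel i ?_⟩
  · rw [Category.assoc, hJ, ha', Category.id_comp]
  · rw [Category.assoc, Category.assoc, reassoc_of% (hJ' k), ← ht k, reassoc_of% ha', sq, Category.id_comp]
  · rw [Category.assoc, ← sq i, reassoc_of% hJ, ha, Category.id_comp]

end MonoidalCovering

/-! ### The model as a monoidal scheme and its base change -/

namespace MonoidalCovering

open Blueprint BlueprintedSpace BlueScheme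

variable {B : Blueprint.{u}} {X : BlueScheme.{u}} {π : X ⟶ BlueScheme.Spec B}
  (c : MonoidalCovering π) (q : B.specSpace)

/-- The model of `X` over `𝔽₁` as a blue scheme. -/
def modelScheme : BlueScheme.{u} where
  space := c.model q
  locallyAffine y := by
    obtain ⟨i, p, rfl⟩ := c.exists_modelChart_eq q y
    exact ⟨_, c.modelChart q i, c.modelChart_isOpenImmersion q i, p, rfl⟩

/-- The charts of the model as morphisms of blue schemes. -/
def modelSchemeChart (i : c.ι) :
    BlueScheme.Spec (fOne.{u}.monoidBlueprint (c.M i)) ⟶ c.modelScheme q :=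
  ⟨c.modelChart q i, isLocalHom_of_isOpenImmersion (c.modelChart q i)⟩

lemma modelSchemeChart_isOpenImmersion (i : c.ι) :
    BlueScheme.IsOpenImmersion (c.modelSchemeChart q i) :=
  c.modelChart_isOpenImmersion q i

lemma toModel_isLocalHom : IsLocalHom (c.toModel q) := by
  intro U s x hxU hu
  obtain ⟨i, P, rfl⟩ := c.exists_ch_eq x
  refine isLocalHom_of_comp (f := c.ch i) (g := c.toModel q) ?_ U s P hxU hu
  rw [ch_toModel]
  exact isLocalHom_comp _ _ (specSpaceMap_isLocalHom _) (isLocalHom_of_isOpenImmersion _)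

/-- The projection from `X` to its model as a morphism of blue schemes. -/
def toModelScheme : X ⟶ c.modelScheme q := ⟨c.toModel q, c.toModel_isLocalHom q⟩

lemma chart_toModelScheme (i : c.ι) : c.chart i ≫ c.toModelScheme q =
    specMap (B.baseChange (c.M i)) ≫ c.modelSchemeChart q i :=
  hom_ext_space (c.ch_toModel q i)

/-- Both sides agree after composition with `Spec B[N] → Spec 𝔽₁[N]`, since there they come from the
same morphism `v` to `X`; that map is an epimorphism because `Spec B` has a point. -/
lemma Overlap.modelSchemeChart_map {i k : c.ι} (o : c.Overlap i k) :
    specMap (fOne.{u}.monoidBlueprintMap o.f) ≫ c.modelSchemeChart q i =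
      specMap (fOne.{u}.monoidBlueprintMap o.g) ≫ c.modelSchemeChart q k := by
  refine hom_ext_space (spec_baseChange_epi q ?_)
  have h : ∀ {l : c.ι} (f : c.M l →*₀ o.N),
      specSpaceMap (B.baseChange o.N) ≫ specSpaceMap (fOne.{u}.monoidBlueprintMap f) ≫
        c.modelChart q l = (specSpaceMap (B.monoidBlueprintMap f) ≫ c.ch l) ≫ c.toModel q := by
    intro l f
    rw [Category.assoc, ch_toModel, ← Category.assoc, ← Category.assoc, specSpaceMap_baseChange]
  exact (h o.f).trans ((congrArg (· ≫ c.toModel q) (o.v_eq.trans o.v_eq'.symm)).trans (h o.g).symm)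

/-- The model is monoidal over `𝔽₁`. -/
lemma modelScheme_isMonoidalOver (π₁ : c.modelScheme q ⟶ BlueScheme.Spec fOne.{u}) :
    IsMonoidalOver fOne.{u} π₁ := by
  refine ⟨⟨c.ι, c.M, c.modelSchemeChart q, c.modelSchemeChart_isOpenImmersion q,
    fun i => hom_spec_fOne_ext _ _, fun y => ?_, ?_⟩⟩
  · obtain ⟨i, p, rfl⟩ := c.exists_modelChart_eq q y
    exact ⟨i, p, rfl⟩
  · rintro i k _ ⟨p, rfl⟩ ⟨p', h⟩
    obtain ⟨o, n, rfl, rfl⟩ := exists_model_overlap (c := c) (q := q) h.symm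
    exact ⟨o.N, o.str, specMap (fOne.{u}.monoidBlueprintMap o.f) ≫ c.modelSchemeChart q i, o.f,
      o.S, o.g, o.T, isOpenImmersion_comp (o.isOpenImmersion_fOne_map q)
        (c.modelSchemeChart_isOpenImmersion q i), ⟨n, rfl⟩, o.hf, rfl, o.hg,
      o.modelSchemeChart_map c q⟩

lemma mem_range_chart {i : c.ι} {x : X}
    (h : (c.toModelScheme q).toSpaceHom.hom.base x ∈ range (c.modelSchemeChart q i)) :
    x ∈ range (c.chart i) := by
  obtain ⟨p, hp⟩ := h
  obtain ⟨P, hP, -⟩ := exists_of_toModel_eq (c := c) (q := q) hp.symm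
  exact ⟨P, hP⟩

/-- `X` is the base change of its model. -/
lemma isPullback_modelScheme (π₁ : c.modelScheme q ⟶ BlueScheme.Spec fOne.{u}) :
    IsPullback (c.toModelScheme q) π π₁ (specMap (fromFOne B)) := by
  refine isPullback_of_local (hom_spec_fOne_ext _ _) ?_ ?_
  · intro T a b _ x
    -- Near `x` the morphism `a` factors through a chart `Spec 𝔽₁[Mᵢ]` of the model, over which the
    -- fibre product with `Spec B` is known to be `Spec B[Mᵢ]`.
    obtain ⟨i, p, hp⟩ := c.exists_modelChart_eq q (a.toSpaceHom.hom.base x)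
    have hO := isOpen_range (c.modelSchemeChart_isOpenImmersion q i)
    obtain ⟨D, j, hj, hx, hr⟩ := T.exists_spec_le
      (hO.preimage a.toSpaceHom.hom.base.hom.continuous) (x := x) ⟨p, hp⟩
    obtain ⟨a', ha'⟩ := exists_lift (c.modelSchemeChart q i) (c.modelSchemeChart_isOpenImmersion q i)
      (j ≫ a) (by
        rintro _ ⟨y, rfl⟩
        exact hr ⟨y, rfl⟩)
    obtain ⟨l, hl, hl'⟩ := (isPullback_spec_monoidBlueprint B (c.M i)).exists_lift a' (j ≫ b)
      (hom_spec_fOne_ext _ _)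
    refine ⟨BlueScheme.Spec D, j, l ≫ c.chart i, hj, hx, ?_, ?_⟩
    · rw [Category.assoc, chart_toModelScheme, reassoc_of% hl, ha']
    · rw [Category.assoc, c.chart_over, hl']
  · intro T d d' h h' x
    obtain ⟨i, P, hP⟩ := c.exists_ch_eq (d.toSpaceHom.hom.base x)
    have hO := isOpen_range (c.isOpenImmersion i)
    obtain ⟨D, j, hj, hx, hr⟩ := T.exists_spec_le
      (hO.preimage d.toSpaceHom.hom.base.hom.continuous) (x := x) ⟨P, hP⟩
    obtain ⟨l, hl⟩ := exists_lift (c.chart i) (c.isOpenImmersion i) (j ≫ d) (by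
      rintro _ ⟨y, rfl⟩
      exact hr ⟨y, rfl⟩)
    have e : l ≫ specMap (B.baseChange (c.M i)) ≫ c.modelSchemeChart q i =
        j ≫ d' ≫ c.toModelScheme q := by
      rw [← h, ← chart_toModelScheme, reassoc_of% hl]
    -- The morphism `d'` lands in the same chart as `d`: the two have equal images in the model, and
    -- a point of `X` over chart `i` of the model lies in chart `i` of `X`.
    obtain ⟨l', hl'⟩ := exists_lift (c.chart i) (c.isOpenImmersion i) (j ≫ d') (by
      rintro _ ⟨y, rfl⟩
      refine c.mem_range_chart q ?_
      exact ⟨_, congrArg (fun k : BlueScheme.Spec D ⟶ c.modelScheme q => k.toSpaceHom.hom.base y) e⟩)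
    refine ⟨BlueScheme.Spec D, j, hj, hx, ?_⟩
    rw [← hl, ← hl']
    refine congrArg (· ≫ c.chart i) ((isPullback_spec_monoidBlueprint B (c.M i)).hom_ext ?_ ?_)
    · refine cancel_openImmersion _ (c.modelSchemeChart_isOpenImmersion q i) ?_
      rw [Category.assoc, Category.assoc, e, ← chart_toModelScheme, reassoc_of% hl']
    · rw [← c.chart_over, reassoc_of% hl, reassoc_of% hl', h']

end MonoidalCovering

/-! ### Descent to `𝔽₁`, including the case of an empty spectrum -/

namespace BlueScheme

open Blueprint

/-- A blue scheme that is monoidal over `B` descends to a monoidal scheme over `𝔽₁`. -/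
lemma IsMonoidalOver.exists_isPullback {B : Blueprint.{u}} {X : BlueScheme.{u}} {π : X ⟶ Spec B}
    (h : IsMonoidalOver B π) : ∃ (X₁ : BlueScheme.{u}) (π₁ : X₁ ⟶ Spec fOne.{u}),
      IsMonoidalOver fOne.{u} π₁ ∧ ∃ p : X ⟶ X₁, IsPullback p π π₁ (specMap (fromFOne B)) := by
  obtain ⟨c⟩ := h
  by_cases hB : Nonempty (Spec B)
  · obtain ⟨q⟩ := hB
    obtain ⟨π₁⟩ := nonempty_hom_spec_fOne (c.modelScheme q)
    exact ⟨c.modelScheme q, π₁, c.modelScheme_isMonoidalOver q π₁, c.toModelScheme q,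
      c.isPullback_modelScheme q π₁⟩
  -- Without a point of `Spec B`, the scheme `X` is empty and serves as its own model with the empty
  -- covering. Any scheme mapping to it is empty too, so the square is cartesian for trivial
  -- reasons.
  · have hX : ∀ x : X, False := fun x => hB ⟨π.toSpaceHom.hom.base x⟩
    obtain ⟨π₁⟩ := nonempty_hom_spec_fOne X
    let c₁ : MonoidalCovering π₁ :=
      { ι := PEmpty
        M := fun i => i.elim
        str := fun i => i.elim
        chart := fun i => i.elim
        isOpenImmersion := fun i => i.elim
        chart_over := fun i => i.elim
        covers := fun x => (hX x).elim
        overlap := fun i => i.elim }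
    exact ⟨X, π₁, ⟨c₁⟩, 𝟙 X, isPullback_of_local (hom_spec_fOne_ext _ _)
      (fun T a b _ x => (hX (a.toSpaceHom.hom.base x)).elim)
      (fun T d d' _ _ x => (hX (d.toSpaceHom.hom.base x)).elim)⟩

end BlueScheme

end

/-- A blue scheme over a blueprint `B` is monoidal over `B` if and only if it is isomorphic over `B`
to the fibre product of a monoidal scheme over `𝔽₁` with `Spec B` over `Spec 𝔽₁`. -/
theorem mainTheorem5 (B : Blueprint.{u}) (X : BlueScheme.{u}) (π : X ⟶ BlueScheme.Spec B) :
    BlueScheme.IsMonoidalOver B π ↔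
      ∃ (X₁ : BlueScheme.{u}) (π₁ : X₁ ⟶ BlueScheme.Spec Blueprint.fOne.{u}),
        BlueScheme.IsMonoidalOver Blueprint.fOne.{u} π₁ ∧
          ∃ p : X ⟶ X₁, IsPullback p π π₁ (BlueScheme.specMap (Blueprint.fromFOne B)) :=
  ⟨fun h => h.exists_isPullback, fun ⟨_, _, h, _, H⟩ => BlueScheme.isMonoidalOver_of_isPullback h H⟩
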